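/- Let $m\ge 1$, $r\ge 2$ and $1\le s\le r-1$ be integers. **Setting.** $\mathcal P(r,m)$ is the space of real polynomials in $m$ variables of degree at most $r$ with zero constant term; its coordinates are the coefficients $p_\mu$, $\mu\in\mathbb N^m$, $1\le|\mu|\le r$. For $i\in\{1,\dots,m\}$, $\Theta_m^i$ is the set of curves $\gamma$ in $\mathbb R^m$ that are real-analytic around $0$, satisfy $\gamma(0)=0$ and are parametrized by the $i$-th coordinate ($\gamma_i(t)=t$ near $0$); $\Theta_m=\bigcup_i\Theta^i_m$. The truncation at order $s$ of the Taylor expansion of $\gamma$ at $0$ is $J_{s,\gamma}$ (an $m$-tuple of polynomials in $t$), and $\vartheta^i_m(s)$, $\vartheta_m(s)$ are the sets of truncations of the curves in $\Theta^i_m$, $\Theta_m$. For $J\in\vartheta_m(s)$ write $a_{jk}$ for the coefficient of $t^k$ in the component $J_j$. We say that $\nabla P$ has a zero of order $s$ on $J$ if $\frac{d^\alpha}{dt^\alpha}\big(\frac{\partial P}{\partial x_\ell}(J(t))\big)_{t=0}=0$ for all $\ell\in\{1,\dots,m\}$, $\alpha\in\{0,\dots,s\}$. Let $$Z^i(r,s,m)=\{(P,J)\in\mathcal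 P(r,m)\times\vartheta^i_m(s):\nabla P\text{ has a zero of order } s\text{ on }J\},\qquad Z(r,s,m)=\bigcup_{i=1}^m Z^i(r,s,m),$$ and let $\sigma(r,s,m)$ be the set of $s$-vanishing polynomials, i.e. of the $P\in\mathcal P(r,m)$ such that $\nabla P$ has a zero of order $s$ on $J_{s,\gamma}$ for some $\gamma\in\Theta_m$. *Adapted chart.* Fix $i$. For $(P,J)\in\mathcal P(r,m)\times\vartheta^i_m(s)$ put $\mathtt a=(a_{j1})_{j\ne i}$, let $\mathcal L_{\mathtt a}:x\mapsto y$ be the linear map $y_i=x_i$, $y_j=x_j-a_{j1}x_i$ $(j\neq i)$, let $\mathtt P_{\mathtt a}=P\circ\mathcal L_{\mathtt a}^{-1}=\sum_\mu \mathtt p_\mu y^\mu$, $\mathtt J_{\mathtt a}=\mathcal L_{\mathtt a}\circ J$, and $$\Upsilon^i(P,J)=\big((\mathtt p_\mu)_{1\le|\mu|\le r},(a_{jk})_{j\ne i,\,1\le k\le s}\big).$$ *Explicit polynomials.* With $e_1,\dots,e_m$ the standard basis of $\mathbb N^m$, let $\nu(\ell,\beta)=\beta e_i+e_\ell$; let $\mathcal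 M(\alpha)$ be the set of $\mu\in\mathbb N^m$ with $2\le|\mu|\le\alpha+1$ different from all $\nu(\ell,\beta)$, $1\le\ell\le m$, $1\le\beta\le\alpha$; and for $\tau\in\mathbb N^m$ let $\mathcal G(\tau,\alpha)$ be the set of families $(k_{ju})_{j\ne i,\,2\le u\le\alpha}$ in $\mathbb N$ with $\sum_u k_{ju}=\tau_j$ for all $j\neq i$ and $\tau_i+\sum_{j\ne i}\sum_u u\,k_{ju}=\alpha$. Put $$R_{\ell\alpha}=\sum_{\substack{\mu\in\mathcal M(\alpha),\ \mu_\ell\ne0\\ \mathcal G(\mu-e_\ell,\alpha)\neq\varnothing}}\mu_\ell\,\mathtt p_\mu\sum_{k\in\mathcal G(\mu-e_\ell,\alpha)}\ \prod_{j\ne i}\frac{(\mu-e_\ell)_j!}{k_{j2}!\cdots k_{j\alpha}!}\,a_{j2}^{k_{j2}}\cdots a_{j\alpha}^{k_{j\alpha}} ,$$ and define polynomials $q^i_{\ell\alpha}$ in the coordinates $(\mathtt p_\mu,a_{jk})$, for $1\le\ell\le m$, $0\le\alpha\le s$, by $$q^i_{\ell0}=\mathtt p_{\nu(\ell,0)},\qquad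 q^i_{i1}=2\,\mathtt p_{\nu(i,1)},\qquad q^i_{\ell1}=\mathtt p_{\nu(\ell,1)}\ (\ell\ne i),$$ $$q^i_{i\alpha}=(\alpha+1)\,\mathtt p_{\nu(i,\alpha)}+\sum_{j\ne i}\sum_{\beta=1}^{\alpha-1}\beta\,\mathtt p_{\nu(j,\beta)}\,a_{j(\alpha-\beta+1)}+R_{i\alpha},\qquad q^i_{\ell\alpha}=\mathtt p_{\nu(\ell,\alpha)}+R_{\ell\alpha}\ (\ell\ne i)\qquad(2\le\alpha\le s).$$ **Theorem.** 1. $Z(r,s,m)$ is an algebraic set (in the coordinates $p_\mu$, $a_{jk}$, $1\le j\le m$, $1\le k\le s$). For every $i$, the map $\Upsilon^i$ is a bijection from $\mathcal P(r,m)\times\vartheta^i_m(s)$ onto the space of all $(\mathtt p_\mu,a_{jk})$; for all $(P,J)\in\mathcal P(r,m)\times\vartheta^i_m(s)$, $1\le\ell\le m$ and $0\le\alpha\le s$ one has $$\frac{d^\alpha}{dt^\alpha}\Big(\frac{\partial\mathtt P_{\mathtt a}}{\partial y_\ell}(\mathtt J_{\mathtt a}(t))\Big)_{t=0}=\alpha!\;q^i_{\ell\alpha}(\Upsilon^i(P,J));$$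 $Z^i(r,s,m)$ is the inverse image under $\Upsilon^i$ of the algebraic set $\{q^i_{\ell\alpha}=0,\ 1\le\ell\le m,\ 0\le\alpha\le s\}$; and the ideal of all polynomials vanishing on $\Upsilon^i(Z^i(r,s,m))$ is generated by the $m(s+1)$ polynomials $q^i_{\ell\alpha}$. 2. $Z(r,s,m)$ has codimension $m(s+1)$ in $\mathcal P(r,m)\times\vartheta_m(s)$. 3. $\sigma(r,s,m)$ is the projection of $Z(r,s,m)$ to $\mathcal P(r,m)$; it is a semi-algebraic set, of codimension $s+m$ in $\mathcal P(r,m)$. (The dimension of a semi-algebraic set $A\subseteq\mathbb R^N$ is the Krull dimension of its ring of polynomial functions $\mathbb R[x]/I(A)$.) -/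

import Mathlib

open Set Filter Topology MvPolynomial

noncomputable section

namespace SVanishing

/-! ## Real algebraic geometry in `ℝ^ι` -/

/-- Algebraic subsets of `ℝ^ι`: common zero sets of finitely many real polynomials. -/
def IsAlgebraicSet {ι : Type*} (A : Set (ι → ℝ)) : Prop :=
  ∃ F : Finset (MvPolynomial ι ℝ), A = {x | ∀ f ∈ F, eval x f = 0}

/-- Semi-algebraic subsets of `ℝ^ι`: finite unions of sets
`{R = 0, Q₁ < 0, …, Q_q < 0}` with `R, Q₁, …, Q_q` real polynomials. -/
def IsSemialgebraicSet {ι : Type*} (A : Set (ι → ℝ)) : Prop :=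
  ∃ (n : ℕ) (R : Fin n → MvPolynomial ι ℝ) (Q : Fin n → Finset (MvPolynomial ι ℝ)),
    A = ⋃ i, {x | eval x (R i) = 0 ∧ ∀ f ∈ Q i, eval x f < 0}

/-- The dimension of a (semi-algebraic) subset `A` of `ℝ^ι`: the Krull dimension of the ring of
polynomial functions on `A`, that is, of `ℝ[x] / I(A)` with `I(A)` the ideal of all polynomials
that vanish on `A`. -/
def saDim {ι : Type*} (A : Set (ι → ℝ)) : WithBot ℕ∞ :=
  ringKrullDim (MvPolynomial ι ℝ ⧸ vanishingIdeal ℝ A)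

/-- `A` has codimension `c` in `B`. -/
def HasCodimIn {ι : Type*} (A B : Set (ι → ℝ)) (c : ℕ) : Prop :=
  A ⊆ B ∧ saDim A + (c : WithBot ℕ∞) = saDim B

/-! ## Polynomials, curves and their truncations -/

/-- `𝒫(r,m)`: real polynomials in `m` variables of degree at most `r` without constant term. -/
def polySpace (r m : ℕ) : Set (MvPolynomial (Fin m) ℝ) :=
  {P | P.totalDegree ≤ r ∧ P.coeff 0 = 0}

/-- `Θ_m^i`: curves in `ℝ^m` that are real-analytic around the origin, pass through the origin at
time zero and are parametrized by the `i`-th coordinate. -/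
def curvesBy {m : ℕ} (i : Fin m) : Set (ℝ → Fin m → ℝ) :=
  {γ | AnalyticAt ℝ γ 0 ∧ γ 0 = 0 ∧ ∀ᶠ t in 𝓝 (0 : ℝ), γ t i = t}

/-- `Θ_m`: analytic curves through the origin that are parametrized by one of the coordinates. -/
def curves (m : ℕ) : Set (ℝ → Fin m → ℝ) := ⋃ i, curvesBy i

/-- `𝒥_{s,γ}`: the Taylor expansion of `γ` at the origin, truncated at order `s`; a tuple of `m`
real polynomials in one variable. -/
def truncation {m : ℕ} (s : ℕ) (γ : ℝ → Fin m → ℝ) (j : Fin m) : Polynomial ℝ :=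
  ∑ k ∈ Finset.range (s + 1),
    Polynomial.C (iteratedDeriv k (fun t => γ t j) 0 / (k.factorial : ℝ)) * Polynomial.X ^ k

/-- `ϑ_m^i(s)`: the `s`-truncations of the curves in `Θ_m^i`. -/
def truncationsBy {m : ℕ} (s : ℕ) (i : Fin m) : Set (Fin m → Polynomial ℝ) :=
  truncation s '' curvesBy i

/-- `ϑ_m(s)`: the `s`-truncations of the curves in `Θ_m`. -/
def truncations (s m : ℕ) : Set (Fin m → Polynomial ℝ) :=
  truncation s '' curves m

/-- The `α`-th derivative at `t = 0` of `t ↦ (∂P/∂x_ℓ)(J(t))`. -/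
def gradDeriv {m : ℕ} (P : MvPolynomial (Fin m) ℝ) (J : Fin m → Polynomial ℝ)
    (ℓ : Fin m) (α : ℕ) : ℝ :=
  iteratedDeriv α (fun t : ℝ => eval (fun j => (J j).eval t) (pderiv ℓ P)) 0

/-- The gradient of `P` has a zero of order `s` at the origin on the truncated curve `J`. -/
def VanishesOn {m : ℕ} (s : ℕ) (P : MvPolynomial (Fin m) ℝ) (J : Fin m → Polynomial ℝ) : Prop :=
  ∀ ℓ : Fin m, ∀ α : ℕ, α ≤ s → gradDeriv P J ℓ α = 0

/-- `σ(r,s,m)`: the set of `s`-vanishing polynomials in `𝒫(r,m)`. -/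
def sVanishingSet (r s m : ℕ) : Set (MvPolynomial (Fin m) ℝ) :=
  {P | P ∈ polySpace r m ∧ ∃ γ ∈ curves m, VanishesOn s P (truncation s γ)}

/-- `Z^i(r,s,m) ⊆ 𝒫(r,m) × ϑ_m^i(s)`. -/
def zSetBy (r s : ℕ) {m : ℕ} (i : Fin m) :
    Set (MvPolynomial (Fin m) ℝ × (Fin m → Polynomial ℝ)) :=
  {x | x ∈ polySpace r m ×ˢ truncationsBy s i ∧ VanishesOn s x.1 x.2}

/-- `Z(r,s,m) ⊆ 𝒫(r,m) × ϑ_m(s)`: the union of the sets `Z^i(r,s,m)`. -/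
def zSet (r s m : ℕ) : Set (MvPolynomial (Fin m) ℝ × (Fin m → Polynomial ℝ)) :=
  ⋃ i : Fin m, zSetBy r s i

/-! ## Charts -/

/-- Multi-indices `μ ∈ ℕ^m` with `1 ≤ |μ| ≤ r`; they label the coefficients of a polynomial
in `𝒫(r,m)`. -/
abbrev MultiIdx (r m : ℕ) : Type := {μ : Fin m →₀ ℕ // 1 ≤ μ.degree ∧ μ.degree ≤ r}

instance instFiniteMultiIdx (r m : ℕ) : Finite (MultiIdx r m) :=
  Set.Finite.to_subtype
    ((Finsupp.finite_of_degree_le (σ := Fin m) r).subset fun _ h => h.2)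

instance instFintypeMultiIdx (r m : ℕ) : Fintype (MultiIdx r m) := Fintype.ofFinite _

/-- The orders `1, …, s` of the coefficients of an `s`-truncation. -/
abbrev OrderIdx (s : ℕ) : Type := {k : ℕ // k ∈ Finset.Icc 1 s}

/-- The chart `P ↦ (p_μ)` of `𝒫(r,m)`. -/
def polyChart (r m : ℕ) (P : MvPolynomial (Fin m) ℝ) : MultiIdx r m → ℝ :=
  fun μ => P.coeff μ.1

/-- The chart `(P, J) ↦ (p_μ, a_{jk})` of `𝒫(r,m)` times the space of `m`-tuples of polynomials of
degree at most `s` in one variable without constant term; `a_{jk}` is the coefficient of `t^k`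
in the `j`-th component of `J`. -/
def stdChart (r s m : ℕ) (x : MvPolynomial (Fin m) ℝ × (Fin m → Polynomial ℝ)) :
    MultiIdx r m ⊕ (Fin m × OrderIdx s) → ℝ :=
  Sum.elim (polyChart r m x.1) (fun jk => (x.2 jk.1).coeff jk.2.1)

/-- `𝙿_b = P ∘ 𝓛_b⁻¹`, where `𝓛_b : x ↦ y` is the linear change of variables
`y_i = x_i`, `y_j = x_j - b_j x_i` for `j ≠ i`. -/
def adaptedPoly {m : ℕ} (i : Fin m) (b : Fin m → ℝ) (P : MvPolynomial (Fin m) ℝ) :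
    MvPolynomial (Fin m) ℝ :=
  aeval (fun j => if j = i then (X i : MvPolynomial (Fin m) ℝ) else X j + C (b j) * X i) P

/-- `𝓛_b ∘ J`, with `𝓛_b` as in `adaptedPoly`. -/
def adaptedCurve {m : ℕ} (i : Fin m) (b : Fin m → ℝ) (J : Fin m → Polynomial ℝ) :
    Fin m → Polynomial ℝ :=
  fun j => if j = i then J i else J j - Polynomial.C (b j) * J i

/-- The vector `𝚊` of the linear coefficients of a truncated curve. -/
def linearPart {m : ℕ} (J : Fin m → Polynomial ℝ) : Fin m → ℝ := fun j => (J j).coeff 1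

/-- Labels of the coordinates `(𝚙_μ, a_{jk})`, `1 ≤ |μ| ≤ r`, `j ≠ i`, `1 ≤ k ≤ s`. -/
abbrev AdaptedIdx (r s : ℕ) {m : ℕ} (i : Fin m) : Type :=
  MultiIdx r m ⊕ ({j : Fin m // j ≠ i} × OrderIdx s)

/-- The chart `Υ^i` of `𝒫(r,m) × ϑ_m^i(s)`: it maps `(P, J)` to the coefficients `𝚙_μ` of `𝙿_𝚊`,
where `𝚊` is the vector of linear coefficients of `J`, together with the coefficients
`a_{jk}`, `j ≠ i`, `1 ≤ k ≤ s`, of `J`. -/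
def adaptedChart (r s : ℕ) {m : ℕ} (i : Fin m)
    (x : MvPolynomial (Fin m) ℝ × (Fin m → Polynomial ℝ)) : AdaptedIdx r s i → ℝ :=
  Sum.elim (polyChart r m (adaptedPoly i (linearPart x.2) x.1))
    (fun jk => (x.2 jk.1.1).coeff jk.2.1)

/-! ## The explicit equations -/

/-- The coordinate `𝚙_μ` (zero if there is none with this label). -/
def pVar (r s : ℕ) {m : ℕ} (i : Fin m) (μ : Fin m →₀ ℕ) : MvPolynomial (AdaptedIdx r s i) ℝ :=
  if h : 1 ≤ μ.degree ∧ μ.degree ≤ r then X (Sum.inl ⟨μ, h⟩) else 0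

/-- The coordinate `a_{jk}` (zero if there is none with this label). -/
def aVar (r s : ℕ) {m : ℕ} (i : Fin m) (j : {j : Fin m // j ≠ i}) (k : ℕ) :
    MvPolynomial (AdaptedIdx r s i) ℝ :=
  if h : k ∈ Finset.Icc 1 s then X (Sum.inr (j, ⟨k, h⟩)) else 0

/-- `ν(ℓ,β)`: exponent `β` in the slot `i`, plus one in the slot `ℓ` (so that
`ν(i,β) = (β+1) e_i`). -/
def nu {m : ℕ} (i ℓ : Fin m) (β : ℕ) : Fin m →₀ ℕ :=
  Finsupp.single i β + Finsupp.single ℓ 1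

/-- `ℳ_m(α)`: the multi-indices `2 ≤ |μ| ≤ α + 1` different from all `ν(ℓ,β)`, `1 ≤ β ≤ α`. -/
def specialM {m : ℕ} (i : Fin m) (α : ℕ) : Set (Fin m →₀ ℕ) :=
  {μ | 2 ≤ μ.degree ∧ μ.degree ≤ α + 1 ∧ ∀ ℓ : Fin m, ∀ β ∈ Finset.Icc 1 α, μ ≠ nu i ℓ β}

/-- `𝒢_m(τ,α)`: the families `k_{ju} ∈ ℕ`, `j ≠ i`, `2 ≤ u ≤ α`, with `∑_u k_{ju} = τ_j` for all
`j ≠ i` and `τ_i + ∑_{j,u} u k_{ju} = α`. The entries of such a family are at most `α`, so that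
the search can be confined to a finite box. -/
def gFamilies {m : ℕ} (i : Fin m) (τ : Fin m →₀ ℕ) (α : ℕ) :
    Finset ({j : Fin m // j ≠ i} → {u : ℕ // u ∈ Finset.Icc 2 α} → ℕ) :=
  (Fintype.piFinset fun _ => Fintype.piFinset fun _ => Finset.range (α + 1)).filter fun k =>
    (∀ j, ∑ u, k j u = τ j.1) ∧ τ i + ∑ j, ∑ u, u.1 * k j u = α

/-- The finite box in `gFamilies` loses nothing. -/
theorem mem_gFamilies {m : ℕ} (i : Fin m) (τ : Fin m →₀ ℕ) (α : ℕ)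
    (k : {j : Fin m // j ≠ i} → {u : ℕ // u ∈ Finset.Icc 2 α} → ℕ) :
    k ∈ gFamilies i τ α ↔
      (∀ j, ∑ u, k j u = τ j.1) ∧ τ i + ∑ j, ∑ u, u.1 * k j u = α := by
  unfold gFamilies
  rw [Finset.mem_filter, and_iff_right_iff_imp]
  rintro ⟨-, h⟩
  simp only [Fintype.mem_piFinset, Finset.mem_range]
  intro j u
  have h1 : u.1 * k j u ≤ ∑ u, u.1 * k j u :=
    Finset.single_le_sum (f := fun u : {u : ℕ // u ∈ Finset.Icc 2 α} => u.1 * k j u)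
      (fun _ _ => Nat.zero_le _) (Finset.mem_univ u)
  have h2 : ∑ u, u.1 * k j u ≤ ∑ j, ∑ u, u.1 * k j u :=
    Finset.single_le_sum (f := fun j : {j : Fin m // j ≠ i} => ∑ u, u.1 * k j u)
      (fun _ _ => Nat.zero_le _) (Finset.mem_univ j)
  have h3 : 2 ≤ u.1 := (Finset.mem_Icc.mp u.2).1
  nlinarith

/-- `∑_{k ∈ 𝒢_m(τ,α)} ∏_{j ≠ i} (multinomial of (k_{j2}, …, k_{jα})) a_{j2}^{k_{j2}} ⋯ a_{jα}^{k_{jα}}`. -/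
def gSum (r s : ℕ) {m : ℕ} (i : Fin m) (τ : Fin m →₀ ℕ) (α : ℕ) :
    MvPolynomial (AdaptedIdx r s i) ℝ :=
  ∑ k ∈ gFamilies i τ α, ∏ j,
    ((Nat.multinomial Finset.univ (k j) : ℕ) : MvPolynomial (AdaptedIdx r s i) ℝ) *
      ∏ u, aVar r s i j u.1 ^ k j u

open Classical in
/-- The sum over the multi-indices `μ ∈ ℰ_m(ℓ,α) ∩ ℳ_m(α)` with `μ_ℓ ≠ 0`, where `ℰ_m(ℓ,α)` is the
set of the `μ` for which `𝒢_m(μ - e_ℓ, α)` is not empty. -/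
def remainderTerm (r s : ℕ) {m : ℕ} (i ℓ : Fin m) (α : ℕ) : MvPolynomial (AdaptedIdx r s i) ℝ :=
  ∑ μ : MultiIdx r m with
      (gFamilies i (μ.1 - Finsupp.single ℓ 1) α).Nonempty ∧ μ.1 ∈ specialM i α ∧ μ.1 ℓ ≠ 0,
    ((μ.1 ℓ : ℕ) : MvPolynomial (AdaptedIdx r s i) ℝ) * pVar r s i μ.1 *
      gSum r s i (μ.1 - Finsupp.single ℓ 1) α

/-- The explicit polynomials `𝚀_{ℓα} / α!` in the coordinates `(𝚙_μ, a_{jk})`. -/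
def explicitQ (r s : ℕ) {m : ℕ} (i ℓ : Fin m) (α : ℕ) : MvPolynomial (AdaptedIdx r s i) ℝ :=
  if α = 0 then pVar r s i (nu i ℓ 0)
  else if α = 1 then
    if ℓ = i then 2 * pVar r s i (nu i i 1) else pVar r s i (nu i ℓ 1)
  else if ℓ = i then
    ((α + 1 : ℕ) : MvPolynomial (AdaptedIdx r s i) ℝ) * pVar r s i (nu i i α)
      + ∑ j : {j : Fin m // j ≠ i}, ∑ β ∈ Finset.Icc 1 (α - 1),
          (β : MvPolynomial (AdaptedIdx r s i) ℝ) * pVar r s i (nu i j.1 β)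
            * aVar r s i j (α - (β - 1))
      + remainderTerm r s i i α
  else pVar r s i (nu i ℓ α) + remainderTerm r s i ℓ α

end SVanishing

end

/-!
The proof reduces every assertion to the adapted chart of index `i`, in which a curve parametrized
by `x_i` becomes tangent to the `i`-th axis. The change of variables is linear and invertible, and
by the chain rule (`pderiv_adaptedPoly`) it does not affect the vanishing of the gradient along the
curve (`vanishesOn_adapted_iff`).

*The equations.* Along a curve `J` with `J_i = t` and `J_j = a_{j2} t² + ⋯`, the multinomial theorem
gives the coefficients of each monomial (`IsAdaptedTo.coeff_prod`). A multi-index that contributes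
to the coefficient of order `α` of the gradient is either one of the `ν(j,β)` or belongs to `ℳ(α)`,
which is how the polynomials `q_{ℓα}` arise (`IsAdaptedTo.coeff_gradient`). The `𝚙_{ν(ℓ,α)}` are
leading variables of a triangular linear system: the remainders contain none of them, and for
`ℓ = i` only those with `ℓ ≠ i` occur in addition. Solving the system identifies the quotient by the
ideal `(q_{ℓα})` with a polynomial ring in the remaining coordinates. Hence the ideal is the full
vanishing ideal (`vanishingIdeal_eqZeros`) and its zero set is parametrized by an affine space
(`exists_param_eqZeros`). Both chart changes are polynomial (`exists_adaptedChart_eq`,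
`exists_stdChart_eq`), which makes `Z` algebraic in the standard coordinates.

*Dimensions.* Let `N` be the number of coefficients of a polynomial. Through Noether normalization,
a set covered by finitely many polynomial images of spaces of dimension at most `d` has dimension
at most `d` (`saDim_le_of_subset_iUnion`), and a set with a Zariski dense polynomial image in `ℝ^d`
has dimension at least `d` (`le_saDim_of_dense`). The parametrization bounds the dimensions of `Z`
and of `σ` by `N + (m - 1)s - m(s + 1) = N - m - s`. Conversely, all coefficients other than the
`m` linear ones and those of `x_i²,…, x_i^{s+1}` can be prescribed generically: if the Hessian in
the variables `x_j`, `j ≠ i`, is invertible, Newton iteration solves `∂_ℓ P = 0`, `ℓ ≠ i`, along a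
curve to order `s`, and the coefficients of the powers of `x_i` are then adjusted to make `∂_i P`
vanish (`exists_mem_zSetBy`, `eq_zero_of_forall_zSetBy`). So both dimensions equal `N - m - s`.

*Semi-algebraicity.* The set `σ` is a projection of `Z`, so the Tarski–Seidenberg theorem applies
(`SignDetermined.projection`). It is proved by comparing sign diagrams: in a finite family of
polynomials in one variable closed under derivation, deletion of leading terms and pseudo-division,
the signs of the coefficients determine the ordered list of sign vectors realized on the line
(`IsClosedFamily.lineMatch`). A polynomial is added to the family when those of smaller degree are
present: its sign at their roots is that of a remainder, and it is monotone on the intervals between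
these roots.
-/

noncomputable section

namespace SVanishing

/-! ### Matching two sign diagrams on the line -/

/-- Two codings `c, c'` of the real line by labels in `S` are matched: they take the same labels,
different labels occur in the same order, each label occupies an interval, which is a single point
for the labels in `B` and open for the others. -/
structure LineMatch {S : Type*} (B : Set S) (c c' : ℝ → S) : Prop where
  fwd : ∀ t, ∃ u, c t = c' u
  bwd : ∀ u, ∃ t, c t = c' u
  mono : ∀ {t t' u u'}, c t = c' u → c t' = c' u' → c t ≠ c t' → t < t' → u < u'
  conv : ∀ {t v u}, t ≤ v → v ≤ u → c t = c u → c v = c t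
  conv' : ∀ {t v u}, t ≤ v → v ≤ u → c' t = c' u → c' v = c' t
  isOpen : ∀ t, c t ∉ B → ∀ᶠ v in 𝓝 t, c v = c t
  isOpen' : ∀ t, c' t ∉ B → ∀ᶠ v in 𝓝 t, c' v = c' t
  point : ∀ {t v}, c t ∈ B → c v = c t → v = t
  point' : ∀ {t v}, c' t ∈ B → c' v = c' t → v = t

namespace LineMatch

variable {S : Type*} {B : Set S} {c c' : ℝ → S}

theorem symm (h : LineMatch B c c') : LineMatch B c' c where
  fwd u := (h.bwd u).imp fun _ e => e.symm
  bwd t := (h.fwd t).imp fun _ e => e.symm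
  mono := by
    intro t t' u u' e e' hne hlt
    rcases lt_trichotomy u u' with hu | hu | hu
    · exact hu
    · exact absurd (e.trans ((congrArg c hu).trans e'.symm)) hne
    · exact absurd (h.mono e'.symm e.symm (by rwa [← e, ← e', ne_comm]) hu) hlt.asymm
  conv := h.conv'
  conv' := h.conv
  isOpen := h.isOpen'
  isOpen' := h.isOpen
  point := h.point'
  point' := h.point

/-- Reflection of both lines. -/
theorem neg (h : LineMatch B c c') : LineMatch B (fun t => c (-t)) (fun t => c' (-t)) where
  fwd t := by
    obtain ⟨u, hu⟩ := h.fwd (-t)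
    exact ⟨-u, by simpa using hu⟩
  bwd t := by
    obtain ⟨u, hu⟩ := h.bwd (-t)
    exact ⟨-u, by simpa using hu⟩
  mono := fun e e' hne hlt =>
    neg_lt_neg_iff.mp (h.mono e' e hne.symm (neg_lt_neg hlt))
  conv := fun h1 h2 e =>
    (h.conv (neg_le_neg h2) (neg_le_neg h1) e.symm).trans e.symm
  conv' := fun h1 h2 e =>
    (h.conv' (neg_le_neg h2) (neg_le_neg h1) e.symm).trans e.symm
  isOpen t ht := (continuous_neg.tendsto t).eventually (h.isOpen _ ht)
  isOpen' t ht := (continuous_neg.tendsto t).eventually (h.isOpen' _ ht)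
  point := fun ht e => neg_injective (h.point ht e)
  point' := fun ht e => neg_injective (h.point' ht e)

/-- If the left ends of two matched intervals carry the same sign of the increasing functions `p`
and `q`, and `p` has a negative value in the interval, then so does `q`: otherwise the left end
of the second interval is a point with `q ≥ 0`, and `p ≥ 0` at the matching point, which is the
left end of the first interval. -/
theorem exists_neg_of_monotoneOn (h : LineMatch B c c') {p q : ℝ → ℝ} (hp : Continuous p)
    (hq : Continuous q)
    (hB : ∀ t u, c t = c' u → c t ∈ B → SignType.sign (p t) = SignType.sign (q u))
    {t : ℝ} (htB : c t ∉ B) (mp : MonotoneOn p {v | c v = c t})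
    (mq : MonotoneOn q {v | c' v = c t}) (hlim : Tendsto (fun v => |q v|) atBot atTop)
    (ht : p t < 0) : ∃ w, c' w = c t ∧ q w < 0 := by
  by_contra! hcon
  obtain ⟨u, hu⟩ := h.fwd t
  set I : Set ℝ := {v | c' v = c t} with hI
  have huI : u ∈ I := hu.symm
  have hbdd : BddBelow I := by
    obtain ⟨N, hN⟩ := (hlim.eventually (eventually_gt_atTop |q u|)).exists_forall_of_atBot
    refine ⟨min N u, fun v hv => ?_⟩
    by_contra! hlt
    have h1 := hN v (hlt.le.trans (min_le_left _ _))
    have h2 := mq hv huI (hlt.le.trans (min_le_right _ _))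
    rw [abs_of_nonneg (hcon v hv), abs_of_nonneg (hcon u huI)] at h1
    exact absurd h1 h2.not_gt
  have hne : I.Nonempty := ⟨u, huI⟩
  set a' := sInf I
  have hmemI : ∀ v, a' < v → v ≤ u → v ∈ I := by
    intro v h1 h2
    obtain ⟨w, hw, hwv⟩ := (csInf_lt_iff hbdd hne).mp h1
    exact (h.conv' hwv.le h2 (hw.trans huI.symm)).trans hw
  have ha'I : a' ∉ I := by
    intro hmem
    have := h.isOpen' a' (by rw [show c' a' = c t from hmem]; exact htB)
    obtain ⟨ε, hε, hb⟩ := Metric.eventually_nhds_iff.mp this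
    have h1 : c' (a' - ε / 2) = c' a' := hb (by simp [abs_of_pos hε]; linarith)
    have := csInf_le hbdd (h1.trans hmem)
    linarith
  have ha'u : a' < u := lt_of_le_of_ne (csInf_le hbdd huI) fun e => ha'I (e ▸ huI)
  have ha'B : c' a' ∈ B := by
    by_contra hnB
    obtain ⟨ε, hε, hb⟩ := Metric.eventually_nhds_iff.mp (h.isOpen' a' hnB)
    have hlt : a' < min u (a' + ε / 2) := lt_min ha'u (by linarith)
    have h1 : c' (min u (a' + ε / 2)) = c' a' := by
      refine hb ?_
      rw [Real.dist_eq, abs_of_pos (by linarith)]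
      have := min_le_right u (a' + ε / 2)
      linarith
    exact ha'I (h1.symm.trans (hmemI _ hlt (min_le_left _ _)))
  have hqa : 0 ≤ q a' := by
    have hcl : a' ∈ closure I := csInf_mem_closure hne hbdd
    exact closure_minimal (fun v hv => hcon v hv) (isClosed_le continuous_const hq) hcl
  obtain ⟨a, ha⟩ := h.bwd a'
  have haB : c a ∈ B := ha ▸ ha'B
  have hpa : 0 ≤ p a := by
    have := hB a a' ha haB
    rw [← sign_nonneg_iff] at hqa ⊢
    rwa [this]
  have hat : c a ≠ c t := fun e => ha'I (ha.symm.trans e)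
  have hlt : a < t := h.symm.mono ha.symm hu.symm (by rw [← ha, ← hu]; exact hat) ha'u
  have hcell : ∀ v, a < v → v ≤ t → c v = c t := by
    intro v hav hvt
    by_contra hv
    obtain ⟨v', hv'⟩ := h.fwd v
    have h1 : a' < v' := h.mono ha hv' (fun e => hav.ne' (h.point haB e.symm)) hav
    have h2 : v' < u := h.mono hv' hu hv (lt_of_le_of_ne hvt fun e => hv (e ▸ rfl))
    exact hv (hv'.trans (hmemI v' h1 h2.le))
  have hle : p a ≤ p t := by
    have hcl : a ∈ closure (Ioc a t) := by
      rw [closure_Ioc hlt.ne]; exact left_mem_Icc.mpr hlt.le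
    refine closure_minimal (s := Ioc a t) (t := {v | p v ≤ p t}) (fun v hv => ?_)
      (isClosed_le hp continuous_const) hcl
    exact mp (hcell v hv.1 hv.2) rfl hv.2
  linarith

theorem exists_neg_of_antitoneOn (h : LineMatch B c c') {p q : ℝ → ℝ} (hp : Continuous p)
    (hq : Continuous q)
    (hB : ∀ t u, c t = c' u → c t ∈ B → SignType.sign (p t) = SignType.sign (q u))
    {t : ℝ} (htB : c t ∉ B) (mp : AntitoneOn p {v | c v = c t})
    (mq : AntitoneOn q {v | c' v = c t}) (hlim : Tendsto (fun v => |q v|) atTop atTop)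
    (ht : p t < 0) : ∃ w, c' w = c t ∧ q w < 0 := by
  obtain ⟨w, h1, h2⟩ := h.neg.exists_neg_of_monotoneOn (p := fun v => p (-v)) (q := fun v => q (-v))
    (hp.comp continuous_neg) (hq.comp continuous_neg) (fun t u e hb => hB _ _ e hb) (t := -t)
    (by simpa using htB)
    (fun v hv w hw hvw => mp (by simpa using hw) (by simpa using hv) (neg_le_neg hvw))
    (fun v hv w hw hvw => mq (by simpa using hw) (by simpa using hv) (neg_le_neg hvw))
    (hlim.comp tendsto_neg_atBot_atTop) (by simpa using ht)
  exact ⟨-w, by simpa using h1, h2⟩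

/-- The sign of an increasing function on an interval of the first line is also taken by the
matching increasing function on the matching interval. -/
theorem exists_sign_of_strictMonoOn (h : LineMatch B c c') {p q : ℝ → ℝ} (hp : Continuous p)
    (hq : Continuous q)
    (hB : ∀ t u, c t = c' u → c t ∈ B → SignType.sign (p t) = SignType.sign (q u))
    {t : ℝ} (htB : c t ∉ B) (mp : StrictMonoOn p {v | c v = c t})
    (mq : StrictMonoOn q {v | c' v = c t}) (hbot : Tendsto (fun v => |q v|) atBot atTop)
    (htop : Tendsto (fun v => |q v|) atTop atTop) :
    ∃ w, c' w = c t ∧ SignType.sign (q w) = SignType.sign (p t) := by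
  have hneg : ∀ v, c v = c t → p v < 0 → ∃ w, c' w = c t ∧ q w < 0 := fun v hv hpv => by
    have := h.exists_neg_of_monotoneOn hp hq hB (t := v) (hv ▸ htB)
      (by rw [hv]; exact mp.monotoneOn) (by rw [hv]; exact mq.monotoneOn) hbot hpv
    rwa [hv] at this
  have hpos : ∀ v, c v = c t → 0 < p v → ∃ w, c' w = c t ∧ 0 < q w := fun v hv hpv => by
    have := h.exists_neg_of_antitoneOn (p := fun v => -p v) (q := fun v => -q v) hp.neg hq.neg
      (fun t u e hb => by simp only [Left.sign_neg, hB t u e hb]) (t := v) (hv ▸ htB)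
      (by rw [hv]; exact mp.monotoneOn.neg) (by rw [hv]; exact mq.monotoneOn.neg)
      (by simpa using htop) (by simpa using hpv)
    rw [hv] at this
    simpa using this
  rcases lt_trichotomy (p t) 0 with h0 | h0 | h0
  · obtain ⟨w, h1, h2⟩ := hneg t rfl h0
    exact ⟨w, h1, by rw [sign_neg h0, sign_neg h2]⟩
  · obtain ⟨ε, hε, hb⟩ := Metric.eventually_nhds_iff.mp (h.isOpen t htB)
    have hl : c (t - ε / 2) = c t := hb (by simp [abs_of_pos hε]; linarith)
    have hr : c (t + ε / 2) = c t := hb (by simp [abs_of_pos hε]; linarith)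
    obtain ⟨w1, hw1, hn⟩ := hneg _ hl (h0 ▸ mp hl rfl (by linarith))
    obtain ⟨w2, hw2, hpo⟩ := hpos _ hr (h0 ▸ mp rfl hr (by linarith))
    have hlt : w1 ≤ w2 := by
      by_contra! hlt
      have := mq hw2 hw1 hlt
      linarith
    obtain ⟨w, hw, hw0⟩ := intermediate_value_Icc hlt hq.continuousOn ⟨hn.le, hpo.le⟩
    exact ⟨w, (h.conv' hw.1 hw.2 (hw1.trans hw2.symm)).trans hw1, by rw [hw0, h0]⟩
  · obtain ⟨w, h1, h2⟩ := hpos t rfl h0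
    exact ⟨w, h1, by rw [sign_pos h0, sign_pos h2]⟩

/-- The functions `p` and `q` behave alike on the matching intervals labelled `σ`: either they
have the same constant sign, or both increase, or both decrease. -/
def Alike (c c' : ℝ → S) (p q : ℝ → ℝ) (σ : S) : Prop :=
  (∀ t u, c t = σ → c' u = σ → SignType.sign (p t) = SignType.sign (q u)) ∨
  (StrictMonoOn p {v | c v = σ} ∧ StrictMonoOn q {v | c' v = σ}) ∨
  (StrictAntiOn p {v | c v = σ} ∧ StrictAntiOn q {v | c' v = σ})

theorem Alike.symm {p q : ℝ → ℝ} {σ : S} (h : Alike c c' p q σ) : Alike c' c q p σ := by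
  rcases h with h | h | h
  · exact .inl fun t u e e' => (h u t e' e).symm
  · exact .inr (.inl h.symm)
  · exact .inr (.inr h.symm)

/-- Matching labels refined by the signs of `p` and `q`. -/
theorem exists_sign (h : LineMatch B c c') {p q : ℝ → ℝ} (hp : Continuous p)
    (hq : Continuous q)
    (hB : ∀ t u, c t = c' u → c t ∈ B → SignType.sign (p t) = SignType.sign (q u))
    (hA : ∀ σ ∉ B, Alike c c' p q σ)
    (hlim : (∀ t u, q t = q u) ∨
      Tendsto (fun v => |q v|) atBot atTop ∧ Tendsto (fun v => |q v|) atTop atTop) (t : ℝ) :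
    ∃ w, c t = c' w ∧ SignType.sign (p t) = SignType.sign (q w) := by
  obtain ⟨u, hu⟩ := h.fwd t
  by_cases htB : c t ∈ B
  · exact ⟨u, hu, hB t u hu htB⟩
  have hopen := h.isOpen' u (hu ▸ htB)
  have hnc : (∀ t u, q t = q u) → ∃ v w, c' v = c t ∧ c' w = c t ∧ v < w ∧ q v = q w := by
    intro hc
    obtain ⟨ε, hε, hb⟩ := Metric.eventually_nhds_iff.mp hopen
    have hr : c' (u + ε / 2) = c' u := hb (by simp [abs_of_pos hε]; linarith)
    exact ⟨u, u + ε / 2, hu.symm, hr.trans hu.symm, by linarith, hc _ _⟩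
  rcases hA _ htB with h1 | ⟨h1, h2⟩ | ⟨h1, h2⟩
  · exact ⟨u, hu, h1 t u rfl hu.symm⟩
  · rcases hlim with hlim | hlim
    · obtain ⟨v, w, hv, hw, hvw, e⟩ := hnc hlim
      exact absurd (h2 hv hw hvw) (by rw [e]; exact lt_irrefl _)
    obtain ⟨w, e, e'⟩ := h.exists_sign_of_strictMonoOn hp hq hB htB h1 h2 hlim.1 hlim.2
    exact ⟨w, e.symm, e'.symm⟩
  · rcases hlim with hlim | hlim
    · obtain ⟨v, w, hv, hw, hvw, e⟩ := hnc hlim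
      exact absurd (h2 hv hw hvw) (by rw [e]; exact lt_irrefl _)
    obtain ⟨w, e, e'⟩ := h.exists_sign_of_strictMonoOn (p := fun v => -p v) (q := fun v => -q v)
      hp.neg hq.neg (fun t u e hb => by simp only [Left.sign_neg, hB t u e hb]) htB h1.neg h2.neg
      (by simpa using hlim.1) (by simpa using hlim.2)
    exact ⟨w, e.symm, by simpa [Left.sign_neg] using e'.symm⟩

/-- Labels refined by the signs of `p` and `q` still occur in the same order on both lines. -/
theorem lt_of_sign_ne (h : LineMatch B c c') {p q : ℝ → ℝ} (hA : ∀ σ ∉ B, Alike c c' p q σ)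
    {t t' u u' : ℝ} (e : c t = c' u) (e' : c t' = c' u')
    (s : SignType.sign (p t) = SignType.sign (q u))
    (s' : SignType.sign (p t') = SignType.sign (q u'))
    (hne : c t ≠ c t' ∨ SignType.sign (p t) ≠ SignType.sign (p t')) (hlt : t < t') : u < u' := by
  by_cases hc : c t = c t'
  · replace hne := hne.resolve_left (not_not.mpr hc)
    have htB : c t ∉ B := fun hb => hlt.ne' (h.point hb hc.symm)
    rcases hA _ htB with h1 | ⟨h1, h2⟩ | ⟨h1, h2⟩
    · exact absurd ((h1 t u rfl e.symm).trans (h1 t' u hc.symm e.symm).symm) hne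
    · by_contra! hle
      have a1 := SignType.sign.monotone' (h1.monotoneOn rfl hc.symm hlt.le)
      have a2 := SignType.sign.monotone' (h2.monotoneOn (e'.symm.trans hc.symm) e.symm hle)
      simp only [OrderHom.toFun_eq_coe] at a1 a2
      rw [← s, ← s'] at a2
      exact hne (le_antisymm a1 a2)
    · by_contra! hle
      have a1 := SignType.sign.monotone' (h1.antitoneOn rfl hc.symm hlt.le)
      have a2 := SignType.sign.monotone' (h2.antitoneOn (e'.symm.trans hc.symm) e.symm hle)
      simp only [OrderHom.toFun_eq_coe] at a1 a2
      rw [← s, ← s'] at a2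
      exact hne (le_antisymm a2 a1)
  · exact h.mono e e' hc hlt

/-- Labels refined by the sign of `p` still occupy intervals. -/
theorem sign_eq_of_between (h : LineMatch B c c') {p q : ℝ → ℝ} (hA : ∀ σ ∉ B, Alike c c' p q σ)
    {t v u : ℝ} (h1 : t ≤ v) (h2 : v ≤ u) (e : c t = c u)
    (s : SignType.sign (p t) = SignType.sign (p u)) :
    SignType.sign (p v) = SignType.sign (p t) := by
  have hv := h.conv h1 h2 e
  by_cases htB : c t ∈ B
  · rw [h.point htB hv]
  obtain ⟨w, hw⟩ := h.fwd t
  rcases hA _ htB with h3 | ⟨h3, -⟩ | ⟨h3, -⟩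
  · exact (h3 v w hv hw.symm).trans (h3 t w rfl hw.symm).symm
  · have a1 := SignType.sign.monotone' (h3.monotoneOn rfl hv h1)
    have a2 := SignType.sign.monotone' (h3.monotoneOn hv e.symm h2)
    simp only [OrderHom.toFun_eq_coe] at a1 a2
    rw [← s] at a2
    exact le_antisymm a2 a1
  · have a1 := SignType.sign.monotone' (h3.antitoneOn rfl hv h1)
    have a2 := SignType.sign.monotone' (h3.antitoneOn hv e.symm h2)
    simp only [OrderHom.toFun_eq_coe] at a1 a2
    rw [← s] at a2
    exact le_antisymm a1 a2

end LineMatch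

/-! ### Sign diagrams of finite families of polynomials -/

section SignDiagram

variable {R : Type*} [CommRing R]

open Classical in
/-- The signs at `t` of the polynomials in the finite family `F`, whose coefficients are
specialized along `x`. -/
def signCode (F : Finset (Polynomial R)) (x : R →+* ℝ) (t : ℝ) : Polynomial R → SignType :=
  fun f => if f ∈ F then SignType.sign (f.eval₂ x t) else 0

/-- The sign vectors of the points at which a member of `F` vanishes without being identically
zero. -/
def rootCodes (F : Finset (Polynomial R)) (x : R →+* ℝ) : Set (Polynomial R → SignType) :=
  {σ | ∃ h ∈ F, h.map x ≠ 0 ∧ σ h = 0}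

/-- The coefficients of the members of `F` have the same signs at `x` and at `y`. -/
def SameCoeffs (F : Finset (Polynomial R)) (x y : R →+* ℝ) : Prop :=
  ∀ f ∈ F, ∀ k, SignType.sign (x (f.coeff k)) = SignType.sign (y (f.coeff k))

theorem signCode_eq_iff {F : Finset (Polynomial R)} {x y : R →+* ℝ} {t u : ℝ} :
    signCode F x t = signCode F y u ↔
      ∀ f ∈ F, SignType.sign (f.eval₂ x t) = SignType.sign (f.eval₂ y u) := by
  classical
  refine ⟨fun h f hf => ?_, fun h => funext fun f => ?_⟩
  · simpa [signCode, hf] using congrFun h f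
  · by_cases hf : f ∈ F
    · simpa [signCode, hf] using h f hf
    · simp [signCode, hf]

theorem signCode_insert [DecidableEq (Polynomial R)] {F : Finset (Polynomial R)} {f : Polynomial R}
    {x y : R →+* ℝ} {t u : ℝ} :
    signCode (insert f F) x t = signCode (insert f F) y u ↔
      signCode F x t = signCode F y u ∧
        SignType.sign (f.eval₂ x t) = SignType.sign (f.eval₂ y u) := by
  simp only [signCode_eq_iff, Finset.forall_mem_insert]
  exact and_comm

theorem continuous_eval₂ (f : Polynomial R) (x : R →+* ℝ) : Continuous fun t => f.eval₂ x t := by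
  simp only [← Polynomial.eval_map]
  exact (f.map x).continuous

theorem SameCoeffs.map_eq_zero_iff {F : Finset (Polynomial R)} {x y : R →+* ℝ}
    (h : SameCoeffs F x y) {f : Polynomial R} (hf : f ∈ F) : f.map x = 0 ↔ f.map y = 0 := by
  simp only [Polynomial.ext_iff, Polynomial.coeff_map, Polynomial.coeff_zero]
  refine forall_congr' fun k => ?_
  rw [← sign_eq_zero_iff, h f hf k, sign_eq_zero_iff]

theorem SameCoeffs.symm {F : Finset (Polynomial R)} {x y : R →+* ℝ}
    (h : SameCoeffs F x y) : SameCoeffs F y x := fun f hf k => (h f hf k).symm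

theorem SameCoeffs.mono {F G : Finset (Polynomial R)} {x y : R →+* ℝ}
    (h : SameCoeffs F x y) (hG : G ⊆ F) : SameCoeffs G x y := fun f hf k => h f (hG hf) k

theorem SameCoeffs.rootCodes_eq {F : Finset (Polynomial R)} {x y : R →+* ℝ}
    (h : SameCoeffs F x y) : rootCodes F x = rootCodes F y := by
  ext σ
  exact exists_congr fun f => and_congr_right fun hf => and_congr_left' (h.map_eq_zero_iff hf).not

theorem signCode_eventually_eq {F : Finset (Polynomial R)} {x : R →+* ℝ} {t : ℝ}
    (ht : signCode F x t ∉ rootCodes F x) : ∀ᶠ v in 𝓝 t, signCode F x v = signCode F x t := by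
  simp only [signCode_eq_iff]
  rw [Filter.eventually_all_finset]
  intro f hf
  by_cases h0 : f.map x = 0
  · simp [← Polynomial.eval_map, h0]
  · have hne : f.eval₂ x t ≠ 0 := fun e => ht ⟨f, hf, h0, by simp [signCode, hf, e]⟩
    rcases lt_or_gt_of_ne hne with h | h
    · filter_upwards [(continuous_eval₂ f x).continuousAt.eventually (gt_mem_nhds h)] with v hv
      rw [sign_neg h, sign_neg hv]
    · filter_upwards [(continuous_eval₂ f x).continuousAt.eventually (lt_mem_nhds h)] with v hv
      rw [sign_pos h, sign_pos hv]

theorem eq_of_signCode_mem_rootCodes {F : Finset (Polynomial R)} {x : R →+* ℝ}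
    (hconv : ∀ {t v u}, t ≤ v → v ≤ u → signCode F x t = signCode F x u →
      signCode F x v = signCode F x t) {t v : ℝ}
    (ht : signCode F x t ∈ rootCodes F x) (hv : signCode F x v = signCode F x t) : v = t := by
  obtain ⟨h, hF, h0, hs⟩ := ht
  have key : ∀ a b, a < b → signCode F x a = signCode F x b → signCode F x a h = 0 → False := by
    intro a b hab e ha
    refine h0 (Polynomial.eq_zero_of_infinite_isRoot _ ((Icc_infinite hab).mono fun w hw => ?_))
    have := congrFun (hconv hw.1 hw.2 e) h
    rw [ha] at this
    simpa [signCode, hF, Polynomial.eval_map] using this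
  rcases lt_trichotomy v t with h1 | h1 | h1
  · exact (key v t h1 hv (by rw [hv, hs])).elim
  · exact h1
  · exact (key t v h1 hv.symm hs).elim

theorem tendsto_abs_eval₂ (f : Polynomial R) (y : R →+* ℝ) :
    (∀ t u, f.eval₂ y t = f.eval₂ y u) ∨
      Tendsto (fun v => |f.eval₂ y v|) atBot atTop ∧
        Tendsto (fun v => |f.eval₂ y v|) atTop atTop := by
  simp only [← Polynomial.eval_map]
  set q := f.map y
  by_cases hd : q.natDegree = 0
  · left
    intro t u
    rw [Polynomial.eq_C_of_natDegree_eq_zero hd]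
    simp
  · right
    refine ⟨?_, q.abs_tendsto_atTop (Polynomial.natDegree_pos_iff_degree_pos.mp
      (Nat.pos_of_ne_zero hd))⟩
    have h2 : 0 < (q.comp (-Polynomial.X)).degree := by
      rw [← Polynomial.natDegree_pos_iff_degree_pos, Polynomial.natDegree_comp]
      simpa using Nat.pos_of_ne_zero hd
    have := ((q.comp (-Polynomial.X)).abs_tendsto_atTop h2).comp tendsto_neg_atBot_atTop
    simpa [Function.comp_def] using this

theorem sign_eval₂_eq_of_derivative_eq_zero {f : Polynomial R} {x y : R →+* ℝ}
    (hc : SignType.sign (x (f.coeff 0)) = SignType.sign (y (f.coeff 0)))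
    (hx : f.derivative.map x = 0) (hy : f.derivative.map y = 0) (t u : ℝ) :
    SignType.sign (f.eval₂ x t) = SignType.sign (f.eval₂ y u) := by
  have key : ∀ (z : R →+* ℝ) (w : ℝ), f.derivative.map z = 0 → f.eval₂ z w = z (f.coeff 0) := by
    intro z w hz
    rw [← Polynomial.derivative_map] at hz
    rw [← Polynomial.eval_map, Polynomial.eq_C_of_natDegree_eq_zero
      (Polynomial.derivative_eq_zero.mp hz)]
    simp
  rw [key x t hx, key y u hy, hc]

theorem strictMonoOn_of_derivative_pos {f : Polynomial R} {x : R →+* ℝ} {s : Set ℝ}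
    (hs : s.OrdConnected) (h : ∀ t ∈ s, 0 < f.derivative.eval₂ x t) :
    StrictMonoOn (fun t => f.eval₂ x t) s := by
  refine strictMonoOn_of_deriv_pos hs.convex (continuous_eval₂ f x).continuousOn fun t ht => ?_
  have := h t (interior_subset ht)
  rw [← Polynomial.eval_map, ← Polynomial.derivative_map] at this
  simpa only [← Polynomial.eval_map, Polynomial.deriv] using this

theorem strictAntiOn_of_derivative_neg {f : Polynomial R} {x : R →+* ℝ} {s : Set ℝ}
    (hs : s.OrdConnected) (h : ∀ t ∈ s, f.derivative.eval₂ x t < 0) :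
    StrictAntiOn (fun t => f.eval₂ x t) s := by
  refine strictAntiOn_of_deriv_neg hs.convex (continuous_eval₂ f x).continuousOn fun t ht => ?_
  have := h t (interior_subset ht)
  rw [← Polynomial.eval_map, ← Polynomial.derivative_map] at this
  simpa only [← Polynomial.eval_map, Polynomial.deriv] using this

/-- A polynomial whose derivative belongs to `F` behaves alike on the matching open intervals of
the two sign diagrams. -/
theorem alike_of_derivative_mem {F : Finset (Polynomial R)} {f : Polynomial R} {x y : R →+* ℝ}
    (h : LineMatch (rootCodes F x) (signCode F x) (signCode F y)) (hF : SameCoeffs F x y)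
    (hc : SignType.sign (x (f.coeff 0)) = SignType.sign (y (f.coeff 0)))
    (hd : f.derivative ∈ F) {σ : Polynomial R → SignType} (hσ : σ ∉ rootCodes F x) :
    LineMatch.Alike (signCode F x) (signCode F y) (fun t => f.eval₂ x t) (fun t => f.eval₂ y t)
      σ := by
  have cx : {v | signCode F x v = σ}.OrdConnected :=
    ⟨fun a ha b hb w hw => (h.conv hw.1 hw.2 (Eq.trans ha (Eq.symm hb))).trans ha⟩
  have cy : {v | signCode F y v = σ}.OrdConnected :=
    ⟨fun a ha b hb w hw => (h.conv' hw.1 hw.2 (Eq.trans ha (Eq.symm hb))).trans ha⟩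
  have val : ∀ (z : R →+* ℝ) t, signCode F z t = σ →
      SignType.sign (f.derivative.eval₂ z t) = σ f.derivative := by
    rintro z t rfl
    simp [signCode, hd]
  rcases hs : σ f.derivative with _ | _ | _
  · left
    intro t u _ _
    have hx : f.derivative.map x = 0 := by
      by_contra h0
      exact hσ ⟨_, hd, h0, hs⟩
    exact sign_eval₂_eq_of_derivative_eq_zero hc hx ((hF.map_eq_zero_iff hd).mp hx) t u
  · right; right
    exact ⟨strictAntiOn_of_derivative_neg cx fun t ht =>
        sign_eq_neg_one_iff.mp ((val x t ht).trans hs),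
      strictAntiOn_of_derivative_neg cy fun t ht =>
        sign_eq_neg_one_iff.mp ((val y t ht).trans hs)⟩
  · right; left
    exact ⟨strictMonoOn_of_derivative_pos cx fun t ht => sign_eq_one_iff.mp ((val x t ht).trans hs),
      strictMonoOn_of_derivative_pos cy fun t ht => sign_eq_one_iff.mp ((val y t ht).trans hs)⟩

/-- A matching of the sign diagrams of `F` extends to `insert f F` if `F` contains the derivative
of `f` and determines the sign of `f` at the roots of its members. -/
theorem lineMatch_insert [DecidableEq (Polynomial R)] {F : Finset (Polynomial R)}
    {f : Polynomial R} {x y : R →+* ℝ}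
    (h : LineMatch (rootCodes F x) (signCode F x) (signCode F y))
    (hF : SameCoeffs (insert f F) x y) (hd : f.derivative ∈ F)
    (hroot : ∀ t u, signCode F x t = signCode F y u → signCode F x t ∈ rootCodes F x →
      SignType.sign (f.eval₂ x t) = SignType.sign (f.eval₂ y u)) :
    LineMatch (rootCodes (insert f F) x) (signCode (insert f F) x) (signCode (insert f F) y) := by
  have hF' : SameCoeffs F x y := hF.mono (Finset.subset_insert _ _)
  have hc := hF f (Finset.mem_insert_self _ _) 0
  have hA := fun σ (hσ : σ ∉ rootCodes F x) => alike_of_derivative_mem h hF' hc hd hσ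
  have conv : ∀ {t v u}, t ≤ v → v ≤ u →
      signCode (insert f F) x t = signCode (insert f F) x u →
      signCode (insert f F) x v = signCode (insert f F) x t := by
    intro t v u h1 h2 e
    rw [signCode_insert] at e ⊢
    exact ⟨h.conv h1 h2 e.1, h.sign_eq_of_between hA h1 h2 e.1 e.2⟩
  have hAs : ∀ σ ∉ rootCodes F x, LineMatch.Alike (signCode F y) (signCode F x)
      (fun t => f.eval₂ y t) (fun t => f.eval₂ x t) σ := fun σ hσ => (hA σ hσ).symm
  have conv' : ∀ {t v u}, t ≤ v → v ≤ u →
      signCode (insert f F) y t = signCode (insert f F) y u →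
      signCode (insert f F) y v = signCode (insert f F) y t := by
    intro t v u h1 h2 e
    rw [signCode_insert] at e ⊢
    exact ⟨h.conv' h1 h2 e.1, h.symm.sign_eq_of_between hAs h1 h2 e.1 e.2⟩
  refine ⟨fun t => ?_, fun u => ?_, ?_, conv, conv', fun t ht => signCode_eventually_eq ht,
    fun t ht => signCode_eventually_eq (hF.rootCodes_eq ▸ ht), eq_of_signCode_mem_rootCodes conv,
    fun {t v} ht => eq_of_signCode_mem_rootCodes conv' (hF.rootCodes_eq ▸ ht)⟩
  · obtain ⟨w, hw⟩ := h.exists_sign (continuous_eval₂ f x) (continuous_eval₂ f y) hroot hA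
      (tendsto_abs_eval₂ f y) t
    exact ⟨w, signCode_insert.mpr hw⟩
  · obtain ⟨w, hw⟩ := h.symm.exists_sign (continuous_eval₂ f y) (continuous_eval₂ f x)
      (fun t u e hb => (hroot u t e.symm (e ▸ hb)).symm) hAs (tendsto_abs_eval₂ f x) u
    exact ⟨w, (signCode_insert.mpr hw).symm⟩
  · intro t t' u u' e e' hne hlt
    rw [signCode_insert] at e e'
    rw [Ne, signCode_insert, not_and_or] at hne
    exact h.lt_of_sign_ne hA e.1 e'.1 e.2 e'.2 hne hlt

theorem lineMatch_of_natDegree_eq_zero {F : Finset (Polynomial R)} {x y : R →+* ℝ}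
    (hF : SameCoeffs F x y) (h0 : ∀ f ∈ F, f.natDegree = 0) :
    LineMatch (rootCodes F x) (signCode F x) (signCode F y) := by
  have key : ∀ (z : R →+* ℝ) (f) (w : ℝ), f ∈ F → f.eval₂ z w = z (f.coeff 0) := by
    intro z f w hf
    conv_lhs => rw [Polynomial.eq_C_of_natDegree_eq_zero (h0 f hf)]
    simp
  have hxy : ∀ t u, signCode F x t = signCode F y u := fun t u => signCode_eq_iff.mpr fun f hf => by
    rw [key x f t hf, key y f u hf, hF f hf 0]
  have hx : ∀ t u, signCode F x t = signCode F x u := fun t u => (hxy t 0).trans (hxy u 0).symm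
  have hy : ∀ t u, signCode F y t = signCode F y u := fun t u => (hxy 0 t).symm.trans (hxy 0 u)
  have hno : ∀ t, signCode F x t ∉ rootCodes F x := by
    rintro t ⟨f, hf, hne, hs⟩
    refine hne ?_
    rw [Polynomial.eq_C_of_natDegree_eq_zero (h0 f hf)]
    simpa [signCode, hf, key x f t hf] using hs
  exact ⟨fun t => ⟨0, hxy _ _⟩, fun t => ⟨0, hxy _ _⟩, fun _ _ hne => absurd (hx _ _) hne,
    fun _ _ _ => hx _ _, fun _ _ _ => hy _ _, fun t _ => Eventually.of_forall fun v => hx v t,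
    fun t _ => Eventually.of_forall fun v => hy v t, fun {t v} ht => absurd ht (hno t),
    fun {t v} ht => absurd (hxy 0 t ▸ ht) (hno 0)⟩

/-! ### Families closed under derivation and pseudo-division -/

/-- Pseudo-division by `h`. The multiplier is an even power of the leading coefficient, so that it
does not change signs after specialization. -/
theorem exists_pseudo_division (h : Polynomial R) (hh : 0 < h.natDegree) (f : Polynomial R) :
    ∃ (k : ℕ) (q r : Polynomial R),
      Polynomial.C (h.leadingCoeff ^ (2 * k)) * f = q * h + r ∧ r.natDegree < h.natDegree := by
  suffices H : ∀ n, ∀ f : Polynomial R, f.natDegree ≤ n → ∃ (k : ℕ) (q r : Polynomial R),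
      Polynomial.C (h.leadingCoeff ^ k) * f = q * h + r ∧ r.natDegree < h.natDegree by
    obtain ⟨k, q, r, e, hr⟩ := H _ f le_rfl
    refine ⟨k, Polynomial.C (h.leadingCoeff ^ k) * q, Polynomial.C (h.leadingCoeff ^ k) * r, ?_,
      (Polynomial.natDegree_C_mul_le _ _).trans_lt hr⟩
    rw [two_mul, pow_add, map_mul, mul_assoc, e]
    ring
  intro n
  induction n with
  | zero => exact fun f hf => ⟨0, 0, f, by simp, by omega⟩
  | succ n ih =>
    intro f hf
    by_cases hlt : f.natDegree < h.natDegree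
    · exact ⟨0, 0, f, by simp, hlt⟩
    set g := Polynomial.C h.leadingCoeff * f -
      Polynomial.C (f.coeff (n + 1)) * Polynomial.X ^ (n + 1 - h.natDegree) * h with hg
    have hle : h.natDegree ≤ n + 1 := by omega
    have hgn : g.natDegree ≤ n := by
      rw [Polynomial.natDegree_le_iff_coeff_eq_zero]
      intro N hN
      rw [hg, Polynomial.coeff_sub, Polynomial.coeff_C_mul, mul_assoc, Polynomial.coeff_C_mul,
        Polynomial.coeff_X_pow_mul', if_pos (by omega)]
      rcases (Nat.succ_le_of_lt hN).eq_or_lt with e | e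
      · rw [← e, Nat.succ_eq_add_one, Nat.sub_sub_self hle, Polynomial.leadingCoeff]
        ring
      · rw [Polynomial.coeff_eq_zero_of_natDegree_lt (by omega),
          Polynomial.coeff_eq_zero_of_natDegree_lt (n := N - (n + 1 - h.natDegree)) (by omega)]
        ring
    obtain ⟨k, q, r, e, hr⟩ := ih g hgn
    refine ⟨k + 1, q + Polynomial.C (h.leadingCoeff ^ k) * (Polynomial.C (f.coeff (n + 1)) *
      Polynomial.X ^ (n + 1 - h.natDegree)), r, ?_, hr⟩
    rw [pow_succ, map_mul, mul_assoc, show Polynomial.C h.leadingCoeff * f = g +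
      Polynomial.C (f.coeff (n + 1)) * Polynomial.X ^ (n + 1 - h.natDegree) * h by rw [hg]; ring,
      mul_add, e]
    ring

/-- A finite set can be closed under a binary operation whose values other than `z` have smaller
degree than both arguments. -/
theorem exists_finset_closed {α : Type*} [DecidableEq α] (deg : α → ℕ) (op : α → α → Finset α)
    (z : α) (hop : ∀ f h, ∀ g ∈ op f h, g = z ∨ deg g < deg f ∧ deg g < deg h) (F : Finset α) :
    ∃ F' : Finset α, F ⊆ F' ∧ ∀ f ∈ F', ∀ h ∈ F', op f h ⊆ F' := by
  obtain ⟨N, hN⟩ : ∃ N, ∀ f ∈ insert z F, deg f ≤ N :=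
    ⟨(insert z F).sup deg, fun f hf => Finset.le_sup hf⟩
  -- In each round the bound on the degrees of the missing values drops by one.
  have H : ∀ k, ∃ F' : Finset α, insert z F ⊆ F' ∧ ∀ f ∈ F', ∀ h ∈ F', ∀ g ∈ op f h,
      g ∈ F' ∨ deg g + k < N := by
    intro k
    induction k with
    | zero =>
      refine ⟨insert z F, subset_rfl, fun f hf h hh g hg => ?_⟩
      rcases hop f h g hg with rfl | ⟨h1, -⟩
      · exact .inl (Finset.mem_insert_self _ _)
      · exact .inr (by have := hN f hf; omega)
    | succ k ih =>
      obtain ⟨F', hF, hc⟩ := ih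
      refine ⟨F' ∪ F'.biUnion fun f => F'.biUnion fun h => op f h,
        hF.trans Finset.subset_union_left, fun f hf h hh g hg => ?_⟩
      rcases hop f h g hg with rfl | ⟨h1, h2⟩
      · exact .inl (Finset.mem_union_left _ (hF (Finset.mem_insert_self _ _)))
      have new : ∀ e ∈ F' ∪ F'.biUnion fun f => F'.biUnion fun h => op f h,
          e ∈ F' ∨ deg e + k < N := by
        intro e he
        simp only [Finset.mem_union, Finset.mem_biUnion] at he
        rcases he with he | ⟨a, ha, b, hb, he⟩
        · exact .inl he
        · exact hc a ha b hb e he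
      rcases new f hf with hf | hf
      · rcases new h hh with hh | hh
        · left
          simp only [Finset.mem_union, Finset.mem_biUnion]
          exact .inr ⟨f, hf, h, hh, hg⟩
        · right; omega
      · right; omega
  obtain ⟨F', hF, hc⟩ := H N
  exact ⟨F', (Finset.subset_insert _ _).trans hF, fun f hf h hh g hg =>
    (hc f hf h hh g hg).resolve_right (by omega)⟩

/-- Finite families closed under derivation, deletion of the leading term and pseudo-division. -/
structure IsClosedFamily (F : Finset (Polynomial R)) : Prop where
  derivative : ∀ f ∈ F, f.derivative ∈ F
  eraseLead : ∀ f ∈ F, f.eraseLead ∈ F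
  division : ∀ f ∈ F, ∀ h ∈ F, 0 < h.natDegree → h.natDegree ≤ f.natDegree →
    ∃ r ∈ F, ∃ (k : ℕ) (q : Polynomial R),
      Polynomial.C (h.leadingCoeff ^ (2 * k)) * f = q * h + r ∧ r.natDegree < h.natDegree

theorem exists_isClosedFamily (F : Finset (Polynomial R)) :
    ∃ F', F ⊆ F' ∧ IsClosedFamily F' := by
  classical
  choose k q r e hr using fun (h : Polynomial R) (hh : 0 < h.natDegree) =>
    exists_pseudo_division h hh
  let prem : Polynomial R → Polynomial R → Polynomial R := fun f h =>
    if hh : 0 < h.natDegree ∧ h.natDegree ≤ f.natDegree then r h hh.1 f else 0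
  let op : Polynomial R → Polynomial R → Finset (Polynomial R) := fun f h =>
    insert (prem f h) (if f = h then {f.derivative, f.eraseLead} else ∅)
  obtain ⟨F', hF, hc⟩ := exists_finset_closed Polynomial.natDegree op 0 (by
    intro f h g hg
    have hg' : g = prem f h ∨ f = h ∧ (g = f.derivative ∨ g = f.eraseLead) := by
      by_cases hfh : f = h
      · simpa [op, hfh] using hg
      · simpa [op, hfh] using hg
    rcases hg' with hg' | ⟨rfl, hg'⟩
    · by_cases hh : 0 < h.natDegree ∧ h.natDegree ≤ f.natDegree
      · right
        simp only [hg', prem, dif_pos hh]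
        have := hr h hh.1 f
        omega
      · left
        simp only [hg', prem, dif_neg hh]
    · by_cases h0 : f.natDegree = 0
      · left
        rw [Polynomial.eq_C_of_natDegree_eq_zero h0] at hg'
        simpa using hg'
      · right
        rw [and_self]
        rcases hg' with rfl | rfl
        · exact Polynomial.natDegree_derivative_lt h0
        · have := f.eraseLead_natDegree_le
          omega) F
  refine ⟨F', hF, fun f hf => hc f hf f hf (by simp [op]), fun f hf => hc f hf f hf (by simp [op]),
    fun f hf h hh h1 h2 => ⟨r h h1 f, hc f hf h hh ?_, k h h1 f, q h h1 f, e h h1 f, hr h h1 f⟩⟩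
  refine Finset.mem_insert.mpr (.inl ?_)
  simp only [prem, dif_pos (And.intro h1 h2)]

/-- In a closed family a polynomial may be truncated until its leading coefficient does not vanish
at `x`. -/
theorem IsClosedFamily.exists_leadingCoeff_ne_zero {F : Finset (Polynomial R)}
    (hF : IsClosedFamily F) {x y : R →+* ℝ} (hs : SameCoeffs F x y) :
    ∀ n, ∀ h ∈ F, h.natDegree ≤ n → h.map x ≠ 0 → ∃ h' ∈ F, h'.natDegree ≤ h.natDegree ∧
      h'.map x = h.map x ∧ h'.map y = h.map y ∧ x h'.leadingCoeff ≠ 0 := by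
  intro n
  induction n with
  | zero =>
    intro h hh hn h0
    refine ⟨h, hh, le_rfl, rfl, rfl, fun hl => h0 ?_⟩
    rw [Polynomial.leadingCoeff, Nat.le_zero.mp hn] at hl
    rw [Polynomial.eq_C_of_natDegree_eq_zero (Nat.le_zero.mp hn)]
    simp [hl]
  | succ n ih =>
    intro h hh hn h0
    by_cases hl : x h.leadingCoeff = 0
    · have hly : y h.leadingCoeff = 0 := by
        rw [← sign_eq_zero_iff, Polynomial.leadingCoeff, ← hs h hh, sign_eq_zero_iff]
        exact hl
      have key : ∀ z : R →+* ℝ, z h.leadingCoeff = 0 → h.eraseLead.map z = h.map z := by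
        intro z hz
        have := congrArg (Polynomial.map z) h.eraseLead_add_C_mul_X_pow
        rwa [Polynomial.map_add, Polynomial.map_mul, Polynomial.map_C, hz, map_zero, zero_mul,
          add_zero] at this
      have hd := h.eraseLead_natDegree_le
      obtain ⟨h', m, d, ex, ey, l⟩ := ih _ (hF.eraseLead h hh) (by omega) (by rwa [key x hl])
      exact ⟨h', m, by omega, ex.trans (key x hl), ey.trans (key y hly), l⟩
    · exact ⟨h, hh, le_rfl, rfl, rfl, hl⟩

theorem sign_eq_of_pseudo_division {f h q r : Polynomial R} {k : ℕ}
    (e : Polynomial.C (h.leadingCoeff ^ (2 * k)) * f = q * h + r) {x : R →+* ℝ} {t : ℝ}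
    (hl : x h.leadingCoeff ≠ 0) (h0 : h.eval₂ x t = 0) :
    SignType.sign (f.eval₂ x t) = SignType.sign (r.eval₂ x t) := by
  have := congrArg (Polynomial.eval₂ x t) e
  rw [Polynomial.eval₂_mul, Polynomial.eval₂_add, Polynomial.eval₂_mul, h0, mul_zero, zero_add,
    Polynomial.eval₂_C, map_pow] at this
  have hpos : 0 < x h.leadingCoeff ^ (2 * k) := by
    rw [pow_mul]
    positivity
  rw [← this, sign_mul, sign_pos hpos, one_mul]

/-- If the coefficients of a closed family have the same signs at `x` and at `y`, then its sign
diagrams at `x` and at `y` are matched. -/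
theorem IsClosedFamily.lineMatch {F : Finset (Polynomial R)} (hF : IsClosedFamily F)
    {x y : R →+* ℝ} (hs : SameCoeffs F x y) :
    LineMatch (rootCodes F x) (signCode F x) (signCode F y) := by
  classical
  -- Members are added by increasing degree.
  suffices H : ∀ n, ∀ G ⊆ F, G.card = n →
      (∀ g ∈ G, ∀ f ∈ F, f.natDegree < g.natDegree → f ∈ G) →
      LineMatch (rootCodes G x) (signCode G x) (signCode G y) from
    H _ F subset_rfl rfl fun _ _ f hf _ => hf
  intro n
  induction n with
  | zero =>
    intro G hG hn _
    rw [Finset.card_eq_zero] at hn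
    subst hn
    exact lineMatch_of_natDegree_eq_zero (hs.mono hG) (by simp)
  | succ n ih =>
    intro G hG hn hdown
    obtain ⟨a, haG, hmax⟩ := G.exists_max_image Polynomial.natDegree
      (Finset.card_pos.mp (by omega))
    by_cases h0 : a.natDegree = 0
    · exact lineMatch_of_natDegree_eq_zero (hs.mono hG) fun f hf => by
        have := hmax f hf
        omega
    have hlow : ∀ f ∈ F, f.natDegree < a.natDegree → f ∈ G.erase a := fun f hf hlt =>
      Finset.mem_erase.mpr ⟨fun e => by rw [e] at hlt; omega, hdown a haG f hf hlt⟩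
    have hsub : G.erase a ⊆ F := (Finset.erase_subset _ _).trans hG
    have IH := ih (G.erase a) hsub (by rw [Finset.card_erase_of_mem haG]; omega) (by
      intro g hg f hf hlt
      exact hlow f hf (hlt.trans_le (hmax g (Finset.mem_of_mem_erase hg))))
    have := lineMatch_insert (f := a) IH (by rw [Finset.insert_erase haG]; exact hs.mono hG)
      (hlow _ (hF.derivative a (hG haG)) (Polynomial.natDegree_derivative_lt h0)) (by
        rintro t u e ⟨h, hh, hne, h1⟩
        have hu : signCode (G.erase a) y u h = 0 := by rw [← e, h1]
        have ht0 : h.eval₂ x t = 0 := by simpa [signCode, hh] using h1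
        have hu0 : h.eval₂ y u = 0 := by simpa [signCode, hh] using hu
        obtain ⟨h', m, d, ex, ey, l⟩ :=
          hF.exists_leadingCoeff_ne_zero hs _ h (hsub hh) le_rfl hne
        have ly : y h'.leadingCoeff ≠ 0 := by
          rwa [Ne, ← sign_eq_zero_iff, Polynomial.leadingCoeff, ← hs h' m, sign_eq_zero_iff]
        rw [← Polynomial.eval_map] at ht0 hu0
        rw [← ex, Polynomial.eval_map] at ht0
        rw [← ey, Polynomial.eval_map] at hu0
        have hpos : 0 < h'.natDegree := by
          refine Nat.pos_of_ne_zero fun hz => l ?_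
          rw [Polynomial.eq_C_of_natDegree_eq_zero hz] at ht0
          rw [Polynomial.leadingCoeff, hz]
          simpa using ht0
        have hda := hmax h (Finset.mem_of_mem_erase hh)
        obtain ⟨r, hr, k, q, eq, hdr⟩ := hF.division a (hG haG) h' m hpos (by omega)
        rw [sign_eq_of_pseudo_division eq l ht0, sign_eq_of_pseudo_division eq ly hu0]
        exact signCode_eq_iff.mp e r (hlow r hr (by omega)))
    rwa [Finset.insert_erase haG] at this

/-- Quantifier elimination for one variable: finitely many elements of the coefficient ring decide
by their signs which sign conditions on `F` can be realized on the line. -/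
theorem exists_finset_sign_determines (F : Finset (Polynomial R)) :
    ∃ G : Finset R, ∀ x y : R →+* ℝ, (∀ g ∈ G, SignType.sign (x g) = SignType.sign (y g)) →
      ∀ t, ∃ u, ∀ f ∈ F, SignType.sign (f.eval₂ x t) = SignType.sign (f.eval₂ y u) := by
  classical
  obtain ⟨F', hsub, hF⟩ := exists_isClosedFamily F
  refine ⟨insert 0 (F'.biUnion fun f => f.coeffs), fun x y h t => ?_⟩
  have hs : SameCoeffs F' x y := by
    intro f hf k
    by_cases h0 : f.coeff k = 0
    · simp [h0]
    · exact h _ (Finset.mem_insert_of_mem (Finset.mem_biUnion.mpr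
        ⟨f, hf, Polynomial.coeff_mem_coeffs h0⟩))
  obtain ⟨u, hu⟩ := (hF.lineMatch hs).fwd t
  exact ⟨u, fun f hf => signCode_eq_iff.mp hu f (hsub hf)⟩

end SignDiagram

/-! ### Projections of algebraic sets are semi-algebraic -/

theorem eval₂_optionEquivLeft {R κ : Type*} [CommRing R] (x : R →+* ℝ) (b : κ → ℝ) (u : ℝ)
    (f : MvPolynomial (Option κ) R) :
    (optionEquivLeft R κ f).eval₂ (eval₂Hom x b) u = eval₂ x (fun o => o.elim u b) f := by
  induction f using MvPolynomial.induction_on with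
  | C r => simp
  | add p q hp hq => rw [map_add, Polynomial.eval₂_add, hp, hq, eval₂_add]
  | mul_X p o hp =>
    rw [map_mul, Polynomial.eval₂_mul, hp, eval₂_mul]
    cases o <;> simp

/-- Quantifier elimination for finitely many variables: finitely many elements of the coefficient
ring decide by their signs which sign conditions on `F` can be realized. -/
theorem exists_finset_sign_determines_mv (κ : Type*) [Finite κ] :
    ∀ {R : Type*} [CommRing R] (F : Finset (MvPolynomial κ R)), ∃ G : Finset R, ∀ x y : R →+* ℝ,
      (∀ g ∈ G, SignType.sign (x g) = SignType.sign (y g)) → ∀ a : κ → ℝ, ∃ b : κ → ℝ, ∀ f ∈ F,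
        SignType.sign (eval₂ x a f) = SignType.sign (eval₂ y b f) := by
  classical
  induction κ using Finite.induction_empty_option with
  | of_equiv e ih =>
    intro R _ F
    obtain ⟨G, hG⟩ := ih (F.image (rename e.symm))
    refine ⟨G, fun x y h a => ?_⟩
    obtain ⟨b, hb⟩ := hG x y h (a ∘ e)
    refine ⟨b ∘ e.symm, fun f hf => ?_⟩
    have := hb _ (Finset.mem_image_of_mem _ hf)
    rw [eval₂_rename, eval₂_rename, Function.comp_assoc, e.self_comp_symm, Function.comp_id] at this
    exact this
  | h_empty =>
    intro R _ F
    refine ⟨F.image fun f => f.coeff 0, fun x y h a => ⟨a, fun f hf => ?_⟩⟩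
    have := h _ (Finset.mem_image_of_mem _ hf)
    rw [MvPolynomial.eq_C_of_isEmpty f]
    simpa using this
  | h_option ih =>
    intro R _ F
    obtain ⟨G₁, h₁⟩ := exists_finset_sign_determines (F.image (optionEquivLeft R _))
    obtain ⟨G, hG⟩ := ih G₁
    refine ⟨G, fun x y h a => ?_⟩
    obtain ⟨b, hb⟩ := hG x y h (fun k => a (some k))
    obtain ⟨u, hu⟩ := h₁ (eval₂Hom x fun k => a (some k)) (eval₂Hom y b) hb (a none)
    refine ⟨fun o => o.elim u b, fun f hf => ?_⟩
    have := hu _ (Finset.mem_image_of_mem _ hf)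
    rw [eval₂_optionEquivLeft, eval₂_optionEquivLeft] at this
    convert this using 4 with o
    cases o <;> rfl

/-- Membership in `A` depends only on the signs of finitely many polynomials. -/
def SignDetermined {ι : Type*} (A : Set (ι → ℝ)) : Prop :=
  ∃ G : Finset (MvPolynomial ι ℝ), ∀ x y : ι → ℝ,
    (∀ g ∈ G, SignType.sign (eval x g) = SignType.sign (eval y g)) → x ∈ A → y ∈ A

theorem IsAlgebraicSet.signDetermined {ι : Type*} {A : Set (ι → ℝ)} (h : IsAlgebraicSet A) :
    SignDetermined A := by
  obtain ⟨F, rfl⟩ := h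
  refine ⟨F, fun x y hxy hx f hf => ?_⟩
  rw [← sign_eq_zero_iff, ← hxy f hf, sign_eq_zero_iff]
  exact hx f hf

theorem SignDetermined.isSemialgebraicSet {ι : Type*} {A : Set (ι → ℝ)} (h : SignDetermined A) :
    IsSemialgebraicSet A := by
  classical
  obtain ⟨G, hG⟩ := h
  let e := (Fintype.equivFin (G → SignType)).symm
  -- Each sign vector realized on `A` gives one basic set, whose vanishing conditions are combined
  -- into a sum of squares; the other sign vectors are given the empty set `{1 = 0}`.
  let realized : (G → SignType) → Prop := fun ε =>
    ∃ x ∈ A, ∀ g : G, SignType.sign (eval x g.1) = ε g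
  refine ⟨Fintype.card (G → SignType),
    fun i => if realized (e i) then ∑ g : G with e i g = 0, g.1 ^ 2 else 1,
    fun i => (Finset.univ.filter fun g : G => e i g = -1).image (fun g => g.1) ∪
      (Finset.univ.filter fun g : G => e i g = 1).image (fun g => -g.1), ?_⟩
  ext y
  simp only [mem_iUnion, mem_ofPred_eq]
  constructor
  · intro hy
    refine ⟨e.symm fun g => SignType.sign (eval y g.1), ?_⟩
    rw [Equiv.apply_symm_apply, if_pos ⟨y, hy, fun _ => rfl⟩]
    refine ⟨?_, fun f hf => ?_⟩
    · rw [map_sum]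
      refine Finset.sum_eq_zero fun g hg => ?_
      have := sign_eq_zero_iff.mp (Finset.mem_filter.mp hg).2
      rw [map_pow, this, zero_pow two_ne_zero]
    · rcases Finset.mem_union.mp hf with hf | hf
      · obtain ⟨g, hg, rfl⟩ := Finset.mem_image.mp hf
        exact sign_eq_neg_one_iff.mp (Finset.mem_filter.mp hg).2
      · obtain ⟨g, hg, rfl⟩ := Finset.mem_image.mp hf
        have := sign_eq_one_iff.mp (Finset.mem_filter.mp hg).2
        rw [map_neg]
        linarith
  · rintro ⟨i, h1, h2⟩
    by_cases hr : realized (e i)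
    · rw [if_pos hr] at h1
      obtain ⟨x, hx, hxs⟩ := hr
      refine hG x y (fun g hg => ?_) hx
      rw [hxs ⟨g, hg⟩]
      rcases hs : e i ⟨g, hg⟩ with _ | _ | _
      · rw [map_sum, Finset.sum_eq_zero_iff_of_nonneg fun g _ => by rw [map_pow]; positivity] at h1
        have := h1 ⟨g, hg⟩ (Finset.mem_filter.mpr ⟨Finset.mem_univ _, hs⟩)
        rw [map_pow, sq_eq_zero_iff] at this
        rw [this, sign_zero]
        rfl
      · have := h2 g (Finset.mem_union_left _ (Finset.mem_image.mpr
          ⟨⟨g, hg⟩, Finset.mem_filter.mpr ⟨Finset.mem_univ _, hs⟩, rfl⟩))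
        rw [sign_neg this]
        rfl
      · have := h2 (-g) (Finset.mem_union_right _ (Finset.mem_image.mpr
          ⟨⟨g, hg⟩, Finset.mem_filter.mpr ⟨Finset.mem_univ _, hs⟩, rfl⟩))
        rw [map_neg] at this
        rw [sign_pos (by linarith)]
        rfl
    · rw [if_neg hr, map_one] at h1
      exact absurd h1 one_ne_zero

/-- Tarski–Seidenberg: the projection of a set described by the signs of polynomials is again such
a set. -/
theorem SignDetermined.projection {ι κ : Type*} [Finite κ] {A : Set (ι ⊕ κ → ℝ)}
    (h : SignDetermined A) : SignDetermined {x : ι → ℝ | ∃ a : κ → ℝ, Sum.elim x a ∈ A} := by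
  classical
  obtain ⟨F, hF⟩ := h
  let Ψ : MvPolynomial (ι ⊕ κ) ℝ →+* MvPolynomial κ (MvPolynomial ι ℝ) :=
    eval₂Hom (C.comp C) (Sum.elim (fun i => C (X i)) X)
  have hΨ : ∀ (x : ι → ℝ) (a : κ → ℝ) f, eval₂ (eval x) a (Ψ f) = eval (Sum.elim x a) f := by
    intro x a f
    induction f using MvPolynomial.induction_on with
    | C r => simp [Ψ]
    | add p q hp hq => rw [map_add, eval₂_add, hp, hq, map_add]
    | mul_X p o hp =>
      rw [map_mul, eval₂_mul, hp, map_mul]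
      cases o <;> simp [Ψ]
  obtain ⟨G, hG⟩ := exists_finset_sign_determines_mv κ (F.image Ψ)
  refine ⟨G, fun x y hxy => ?_⟩
  rintro ⟨a, ha⟩
  obtain ⟨b, hb⟩ := hG (eval x) (eval y) hxy a
  refine ⟨b, hF _ _ (fun f hf => ?_) ha⟩
  rw [← hΨ, ← hΨ]
  exact hb _ (Finset.mem_image_of_mem _ hf)

theorem isAlgebraicSet_iUnion {ι α : Type*} [Finite α] {A : α → Set (ι → ℝ)}
    (h : ∀ i, IsAlgebraicSet (A i)) : IsAlgebraicSet (⋃ i, A i) := by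
  classical
  cases nonempty_fintype α
  choose F hF using h
  refine ⟨(Fintype.piFinset F).image fun f => ∏ i, f i, ?_⟩
  ext x
  simp only [mem_iUnion, mem_ofPred_eq, Finset.mem_image, Fintype.mem_piFinset]
  constructor
  · rintro ⟨i, hi⟩ _ ⟨f, hf, rfl⟩
    rw [hF i] at hi
    rw [map_prod]
    exact Finset.prod_eq_zero (Finset.mem_univ i) (hi _ (hf i))
  · intro h
    by_contra! hx
    have : ∀ i, ∃ f ∈ F i, eval x f ≠ 0 := fun i => by
      have := hx i
      rw [hF i] at this
      simpa using this
    choose f hf hne using this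
    have := h _ ⟨f, hf, rfl⟩
    rw [map_prod] at this
    exact Finset.prod_ne_zero_iff.mpr (fun i _ => hne i) this

/-! ### Dimension of finitely generated algebras -/

section Dimension

variable {A C : Type*} [CommRing A] [CommRing C]

theorem ringKrullDim_le_of_isIntegral (g : A →+* C) (hg : g.IsIntegral) :
    ringKrullDim C ≤ ringKrullDim A := by
  algebraize [g]
  have : Algebra.IsIntegral A C := ⟨hg⟩
  refine Order.krullDim_le_of_strictMono (PrimeSpectrum.comap (algebraMap A C)) fun p q hpq => ?_
  exact Ideal.IsIntegral.comap_lt_comap (R := A) (I := p.asIdeal) (J := q.asIdeal) hpq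

/-- Going up: a chain of primes of `A` lifts to an integral extension. -/
theorem ringKrullDim_le_of_isIntegral_of_injective (g : A →+* C) (hg : g.IsIntegral)
    (hinj : Function.Injective g) : ringKrullDim A ≤ ringKrullDim C := by
  algebraize [g]
  have hint : Algebra.IsIntegral A C := ⟨hg⟩
  have key : ∀ n : ℕ, ∀ p : PrimeSpectrum A, (n : ℕ∞) ≤ Order.height p →
      ∃ q : PrimeSpectrum C, q.asIdeal.comap (algebraMap A C) = p.asIdeal ∧
        (n : ℕ∞) ≤ Order.height q := by
    intro n
    induction n with
    | zero =>
      intro p _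
      obtain ⟨Q, -, hQ, e⟩ := Ideal.exists_ideal_over_prime_of_isIntegral (S := C) p.asIdeal ⊥ (by
        rw [← RingHom.ker_eq_comap_bot]
        exact ((RingHom.injective_iff_ker_eq_bot g).mp hinj).le.trans bot_le)
      exact ⟨⟨Q, hQ⟩, e, by simp⟩
    | succ n ih =>
      intro p hp
      obtain ⟨l, hl, hlen⟩ := Order.exists_series_of_le_height p hp
      have hlt : l.eraseLast.last < p := by
        rw [← hl]
        exact l.eraseLast_last_rel_last (by omega)
      have hh : (n : ℕ∞) ≤ Order.height l.eraseLast.last := by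
        have := Order.length_le_height_last (p := l.eraseLast)
        simpa [hlen] using this
      obtain ⟨q, hq, hqh⟩ := ih _ hh
      obtain ⟨Q, hle, hQ, e⟩ := Ideal.exists_ideal_over_prime_of_isIntegral (S := C) p.asIdeal
        q.asIdeal (by rw [hq]; exact hlt.le)
      have hqQ : q < ⟨Q, hQ⟩ := by
        refine lt_of_le_of_ne hle fun e' => hlt.ne ?_
        ext1
        rw [← hq, ← e, e']
      refine ⟨⟨Q, hQ⟩, e, ?_⟩
      push_cast
      exact (add_le_add_left hqh 1).trans (Order.height_add_one_le hqQ)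
  refine iSup_le fun l => ?_
  obtain ⟨q, -, hq⟩ := key l.length l.last Order.length_le_height_last
  exact (WithBot.coe_le_coe.mpr hq).trans (Order.height_le_krullDim q)

variable [Algebra ℝ C]

/-- Noether normalization, recorded as a statement on the dimension. -/
theorem exists_injective_ringKrullDim_eq [Nontrivial C] [Algebra.FiniteType ℝ C] :
    ∃ (d : ℕ) (g : MvPolynomial (Fin d) ℝ →ₐ[ℝ] C), Function.Injective g ∧ g.IsIntegral ∧
      ringKrullDim C = d := by
  obtain ⟨d, g, hinj, hint⟩ := exists_integral_inj_algHom_of_fg ℝ C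
  have hd : ringKrullDim (MvPolynomial (Fin d) ℝ) = d := by
    rw [MvPolynomial.ringKrullDim_of_isNoetherianRing, ringKrullDim_eq_zero_of_field]
    simp
  refine ⟨d, g, hinj, hint, ?_⟩
  rw [← hd]
  exact le_antisymm (ringKrullDim_le_of_isIntegral g.toRingHom hint)
    (ringKrullDim_le_of_isIntegral_of_injective g.toRingHom hint hinj)

end Dimension

theorem card_le_of_injective_of_isIntegral {C : Type} [CommRing C] [Algebra ℝ C] [IsDomain C]
    {κ : Type} [Fintype κ] {d : ℕ}
    {f : MvPolynomial κ ℝ →ₐ[ℝ] C} (hf : Function.Injective f)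
    {g : MvPolynomial (Fin d) ℝ →ₐ[ℝ] C} (hint : g.IsIntegral) :
    Fintype.card κ ≤ d := by
  have h1 : AlgebraicIndependent ℝ fun i => f (X i) := by
    rw [algebraicIndependent_iff_injective_aeval]
    convert hf
    ext i
    simp
  have hS : Algebra.adjoin ℝ (range fun i => g (X i)) = g.range := by
    rw [Algebra.adjoin_range_eq_range_aeval]
    congr 1
    ext i
    simp
  have halg : Algebra.IsAlgebraic (Algebra.adjoin ℝ (range fun i => g (X i))) C := by
    rw [hS]
    refine ⟨fun c => IsIntegral.isAlgebraic ?_⟩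
    obtain ⟨p, hp, e⟩ := hint c
    refine ⟨p.map g.rangeRestrict.toRingHom, hp.map _, ?_⟩
    rw [Polynomial.eval₂_map]
    exact e
  have h2 := h1.cardinalMk_le_trdeg.trans (Algebra.IsAlgebraic.trdeg_le_cardinalMk ℝ
    (range fun i => g (X i)))
  have h3 := h2.trans Cardinal.mk_range_le
  simpa using h3

theorem ringKrullDim_ge_of_injective {C : Type} [CommRing C] [Algebra ℝ C]
    [Algebra.FiniteType ℝ C] {κ : Type} [Fintype κ] {f : MvPolynomial κ ℝ →ₐ[ℝ] C}
    (hf : Function.Injective f) : (Fintype.card κ : WithBot ℕ∞) ≤ ringKrullDim C := by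
  -- Some prime of `C` lies over zero, so `C` may be replaced by a domain.
  obtain ⟨P, hP, e⟩ := Ideal.exists_comap_eq_of_mem_minimalPrimes_of_injective
    (f := f.toRingHom) hf (⊥ : Ideal (MvPolynomial κ ℝ)) (by
      rw [IsDomain.minimalPrimes_eq_singleton_bot]
      rfl)
  have hinj : Function.Injective ((Ideal.Quotient.mkₐ ℝ P).comp f) := by
    rw [injective_iff_map_eq_zero]
    intro a ha
    have h0 : f a ∈ P := Ideal.Quotient.eq_zero_iff_mem.mp ha
    have : a ∈ P.comap f.toRingHom := h0
    rw [e] at this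
    exact this
  obtain ⟨d, g, -, hint, hd⟩ := exists_injective_ringKrullDim_eq (C := C ⧸ P)
  refine le_trans ?_ (ringKrullDim_quotient_le P)
  rw [hd]
  exact_mod_cast card_le_of_injective_of_isIntegral hinj hint

/-- A set covered by finitely many polynomial images of affine spaces of dimension at most `N` has
dimension at most `N`. -/
theorem saDim_le_of_subset_iUnion {ι α : Type} {κ : α → Type} [Finite ι] [∀ i, Fintype (κ i)]
    [Finite α] {A : Set (ι → ℝ)} (ψ : ∀ i, ι → MvPolynomial (κ i) ℝ) {N : ℕ}
    (hN : ∀ i, Fintype.card (κ i) ≤ N)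
    (hA : ∀ x ∈ A, ∃ i, ∃ w : κ i → ℝ, ∀ j, x j = eval w (ψ i j)) :
    saDim A ≤ (N : WithBot ℕ∞) := by
  cases nonempty_fintype α
  rw [saDim]
  rcases subsingleton_or_nontrivial (MvPolynomial ι ℝ ⧸ vanishingIdeal ℝ A) with hC | hC
  · rw [ringKrullDim_eq_bot_of_subsingleton]
    exact bot_le
  obtain ⟨d, g, hinj, -, hd⟩ :=
    exists_injective_ringKrullDim_eq (C := MvPolynomial ι ℝ ⧸ vanishingIdeal ℝ A)
  rw [hd]
  choose F hF using fun j => Ideal.Quotient.mk_surjective (g (X j))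
  have hgF : ∀ f, g f = Ideal.Quotient.mk _ (bind₁ F f) := by
    intro f
    have : g = (Ideal.Quotient.mkₐ ℝ _).comp (bind₁ F) := by
      ext j
      simp [hF]
    rw [this]
    rfl
  by_contra hcon
  have hlt : N < d := by
    by_contra! hle
    exact hcon (by exact_mod_cast hle)
  -- Over each piece the coordinates are algebraically dependent.
  have hdep : ∀ i, ∃ f : MvPolynomial (Fin d) ℝ, f ≠ 0 ∧ bind₁ (ψ i) (bind₁ F f) = 0 := by
    intro i
    by_contra! h
    have hi : Function.Injective ((bind₁ (ψ i)).comp (bind₁ F)) := by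
      rw [injective_iff_map_eq_zero]
      intro f hf
      by_contra h0
      exact h f h0 hf
    have := ringKrullDim_ge_of_injective hi
    rw [MvPolynomial.ringKrullDim_of_isNoetherianRing, ringKrullDim_eq_zero_of_field, zero_add,
      Nat.card_eq_fintype_card, Fintype.card_fin] at this
    have : d ≤ Fintype.card (κ i) := by exact_mod_cast this
    have := hN i
    omega
  choose f hf0 hf using hdep
  -- The product of the dependencies vanishes on all of `A`, against the injectivity of `g`.
  have hprod : g (∏ i, f i) = 0 := by
    rw [hgF, Ideal.Quotient.eq_zero_iff_mem, mem_vanishingIdeal_iff]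
    intro x hx
    obtain ⟨i, w, hw⟩ := hA x hx
    rw [show x = fun j => eval w (ψ i j) from funext hw, map_prod, map_prod]
    refine Finset.prod_eq_zero (Finset.mem_univ i) ?_
    have := congrArg (eval w) (hf i)
    rw [map_zero, ← coe_aeval_eq_eval, RingHom.coe_coe, aeval_bind₁] at this
    exact this
  exact Finset.prod_ne_zero_iff.mpr (fun i _ => hf0 i)
    ((injective_iff_map_eq_zero g).mp hinj _ hprod)

/-- A set with a polynomial map to `ℝ^κ` of Zariski dense image has dimension at least `|κ|`. -/
theorem le_saDim_of_dense {ι κ : Type} [Finite ι] [Fintype κ]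
    {A : Set (ι → ℝ)} (π : κ → MvPolynomial ι ℝ)
    (hA : ∀ f : MvPolynomial κ ℝ, (∀ x ∈ A, eval (fun k => eval x (π k)) f = 0) → f = 0) :
    (Fintype.card κ : WithBot ℕ∞) ≤ saDim A := by
  refine ringKrullDim_ge_of_injective
    (f := (Ideal.Quotient.mkₐ ℝ (vanishingIdeal ℝ A)).comp (bind₁ π)) ?_
  rw [injective_iff_map_eq_zero]
  intro f hf
  refine hA f fun x hx => ?_
  have : bind₁ π f ∈ vanishingIdeal ℝ A := Ideal.Quotient.eq_zero_iff_mem.mp hf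
  have := this x hx
  rw [aeval_bind₁] at this
  exact this

/-! ### Truncated curves and coefficients of the gradient along a curve -/

theorem iteratedDeriv_eval_zero (p : Polynomial ℝ) (k : ℕ) :
    iteratedDeriv k (fun t => p.eval t) 0 = (k.factorial : ℝ) * p.coeff k := by
  have h : ∀ k, iteratedDeriv k (fun t => p.eval t) =
      fun t => (Polynomial.derivative^[k] p).eval t := by
    intro k
    induction k with
    | zero => simp
    | succ k ih =>
      rw [iteratedDeriv_succ, ih, Function.iterate_succ_apply']
      ext t
      exact Polynomial.deriv _
  rw [h]
  dsimp only
  rw [← Polynomial.coeff_zero_eq_eval_zero, Polynomial.coeff_iterate_derivative, zero_add,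
    Nat.descFactorial_self, nsmul_eq_mul]

theorem gradDeriv_eq {m : ℕ} (P : MvPolynomial (Fin m) ℝ) (J : Fin m → Polynomial ℝ)
    (ℓ : Fin m) (α : ℕ) :
    gradDeriv P J ℓ α = (α.factorial : ℝ) * (aeval J (pderiv ℓ P)).coeff α := by
  have h : ∀ (Q : MvPolynomial (Fin m) ℝ) (t : ℝ),
      eval (fun j => (J j).eval t) Q = (aeval J Q).eval t := by
    intro Q t
    induction Q using MvPolynomial.induction_on with
    | C r => simp
    | add p q hp hq => simp [hp, hq]
    | mul_X p j hp => simp [hp]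
  rw [gradDeriv, ← iteratedDeriv_eval_zero]
  simp only [h]

theorem vanishesOn_iff {m s : ℕ} {P : MvPolynomial (Fin m) ℝ} {J : Fin m → Polynomial ℝ} :
    VanishesOn s P J ↔ ∀ ℓ : Fin m, ∀ α ≤ s, (aeval J (pderiv ℓ P)).coeff α = 0 := by
  refine forall_congr' fun ℓ => forall₂_congr fun α _ => ?_
  rw [gradDeriv_eq, mul_eq_zero, or_iff_right (by positivity)]

theorem coeff_truncation {m s : ℕ} (γ : ℝ → Fin m → ℝ) (j : Fin m) (k : ℕ) :
    (truncation s γ j).coeff k =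
      if k ≤ s then iteratedDeriv k (fun t => γ t j) 0 / (k.factorial : ℝ) else 0 := by
  simp only [truncation, Polynomial.finsetSum_coeff, Polynomial.coeff_C_mul,
    Polynomial.coeff_X_pow, mul_ite, mul_one, mul_zero]
  rw [Finset.sum_ite_eq]
  simp

theorem mem_truncationsBy_iff {m s : ℕ} (hs : 1 ≤ s) {i : Fin m} {J : Fin m → Polynomial ℝ} :
    J ∈ truncationsBy s i ↔
      J i = Polynomial.X ∧ ∀ j, (J j).coeff 0 = 0 ∧ (J j).natDegree ≤ s := by
  constructor
  · rintro ⟨γ, ⟨-, h0, hi⟩, rfl⟩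
    refine ⟨?_, fun j => ⟨?_, ?_⟩⟩
    · ext k
      rw [coeff_truncation]
      have h1 : iteratedDeriv k (fun t => γ t i) 0 =
          iteratedDeriv k (fun t => (Polynomial.X : Polynomial ℝ).eval t) 0 :=
        Filter.EventuallyEq.iteratedDeriv_eq k (by simpa [Filter.EventuallyEq] using hi)
      rw [h1, iteratedDeriv_eval_zero, mul_div_cancel_left₀ _ (by positivity)]
      split_ifs with hk
      · rfl
      · rw [Polynomial.coeff_X, if_neg (by omega)]
    · rw [coeff_truncation, if_pos (Nat.zero_le _), iteratedDeriv_zero, h0]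
      simp
    · rw [Polynomial.natDegree_le_iff_coeff_eq_zero]
      intro k hk
      rw [coeff_truncation, if_neg (by omega)]
  · rintro ⟨hi, hJ⟩
    refine ⟨fun t j => (J j).eval t, ⟨?_, ?_, ?_⟩, ?_⟩
    · rw [analyticAt_pi_iff]
      exact fun j => AnalyticOnNhd.eval_polynomial (J j) 0 (mem_univ _)
    · ext j
      simp [← Polynomial.coeff_zero_eq_eval_zero, hJ]
    · simp [hi]
    · ext j k
      rw [coeff_truncation, iteratedDeriv_eval_zero, mul_div_cancel_left₀ _ (by positivity)]
      split_ifs with hk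
      · rfl
      · exact (Polynomial.coeff_eq_zero_of_natDegree_lt (by have := (hJ j).2; omega)).symm

theorem truncations_eq_iUnion (s m : ℕ) : truncations s m = ⋃ i, truncationsBy s i := by
  simp only [truncations, curves, image_iUnion, truncationsBy]

/-! ### Coordinates -/

/-- The polynomial with prescribed coefficients `p_μ`, `1 ≤ |μ| ≤ r`. -/
def polyOf {A : Type*} [CommRing A] {r m : ℕ} (p : MultiIdx r m → A) : MvPolynomial (Fin m) A :=
  ∑ μ, monomial μ.1 (p μ)

theorem coeff_polyOf {A : Type*} [CommRing A] {r m : ℕ} (p : MultiIdx r m → A) (μ : MultiIdx r m) :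
    (polyOf p).coeff μ.1 = p μ := by
  classical
  rw [polyOf, coeff_sum, Finset.sum_eq_single μ]
  · simp
  · intro ν _ hne
    rw [coeff_monomial, if_neg fun e => hne (Subtype.ext e)]
  · simp

theorem coeff_polyOf_eq_zero {A : Type*} [CommRing A] {r m : ℕ} (p : MultiIdx r m → A)
    {μ : Fin m →₀ ℕ} (hμ : ¬(1 ≤ μ.degree ∧ μ.degree ≤ r)) : (polyOf p).coeff μ = 0 := by
  classical
  rw [polyOf, coeff_sum]
  refine Finset.sum_eq_zero fun ν _ => ?_
  rw [coeff_monomial, if_neg]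
  rintro rfl
  exact hμ ν.2

theorem mem_polySpace_iff {r m : ℕ} {P : MvPolynomial (Fin m) ℝ} :
    P ∈ polySpace r m ↔ ∀ μ : Fin m →₀ ℕ, ¬(1 ≤ μ.degree ∧ μ.degree ≤ r) → P.coeff μ = 0 := by
  constructor
  · rintro ⟨h1, h2⟩ μ hμ
    by_cases h0 : μ.degree = 0
    · rw [(Finsupp.degree_eq_zero_iff _).mp h0, h2]
    · refine coeff_eq_zero_of_totalDegree_lt (h1.trans_lt ?_)
      rw [← Finsupp.degree_apply]
      omega
  · intro h
    refine ⟨Finset.sup_le fun μ hμ => ?_, h 0 (by simp)⟩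
    by_contra hlt
    exact mem_support_iff.mp hμ (h μ fun h' => hlt h'.2)

theorem polyOf_mem {r m : ℕ} (p : MultiIdx r m → ℝ) : polyOf p ∈ polySpace r m :=
  mem_polySpace_iff.mpr fun _ hμ => coeff_polyOf_eq_zero p hμ

theorem polyChart_polyOf {r m : ℕ} (p : MultiIdx r m → ℝ) : polyChart r m (polyOf p) = p :=
  funext fun μ => coeff_polyOf p μ

theorem polyOf_polyChart {r m : ℕ} {P : MvPolynomial (Fin m) ℝ} (hP : P ∈ polySpace r m) :
    polyOf (polyChart r m P) = P := by
  ext μ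
  by_cases hμ : 1 ≤ μ.degree ∧ μ.degree ≤ r
  · exact coeff_polyOf _ ⟨μ, hμ⟩
  · rw [coeff_polyOf_eq_zero _ hμ, mem_polySpace_iff.mp hP μ hμ]

theorem map_polyOf {A B : Type*} [CommRing A] [CommRing B] (φ : A →+* B) {r m : ℕ}
    (p : MultiIdx r m → A) : map φ (polyOf p) = polyOf fun μ => φ (p μ) := by
  simp [polyOf, map_monomial]

/-- The truncated curve parametrized by the `i`-th coordinate with prescribed coefficients. -/
def curveOf {s m : ℕ} (i : Fin m) (a : {j : Fin m // j ≠ i} × OrderIdx s → ℝ) :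
    Fin m → Polynomial ℝ :=
  fun j => if h : j = i then Polynomial.X else
    ∑ k : OrderIdx s, Polynomial.C (a (⟨j, h⟩, k)) * Polynomial.X ^ k.1

theorem curveOf_self {s m : ℕ} (i : Fin m) (a : {j : Fin m // j ≠ i} × OrderIdx s → ℝ) :
    curveOf i a i = Polynomial.X := by
  simp [curveOf]

theorem coeff_curveOf {s m : ℕ} (i : Fin m) (a : {j : Fin m // j ≠ i} × OrderIdx s → ℝ)
    (j : {j : Fin m // j ≠ i}) (k : ℕ) :
    (curveOf i a j.1).coeff k = if h : k ∈ Finset.Icc 1 s then a (j, ⟨k, h⟩) else 0 := by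
  simp only [curveOf, dif_neg j.2, Polynomial.finsetSum_coeff, Polynomial.coeff_C_mul,
    Polynomial.coeff_X_pow, mul_ite, mul_one, mul_zero]
  split_ifs with h
  · rw [Finset.sum_eq_single ⟨k, h⟩]
    · simp
    · intro k' _ hne
      rw [if_neg fun e => hne (Subtype.ext e.symm)]
    · simp
  · refine Finset.sum_eq_zero fun k' _ => if_neg ?_
    rintro rfl
    exact h k'.2

theorem curveOf_mem {s m : ℕ} (hs : 1 ≤ s) (i : Fin m)
    (a : {j : Fin m // j ≠ i} × OrderIdx s → ℝ) : curveOf i a ∈ truncationsBy s i := by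
  rw [mem_truncationsBy_iff hs]
  refine ⟨curveOf_self i a, fun j => ?_⟩
  by_cases hj : j = i
  · subst hj
    rw [curveOf_self]
    simpa using hs
  · constructor
    · rw [coeff_curveOf i a ⟨j, hj⟩, dif_neg (by simp)]
    · rw [Polynomial.natDegree_le_iff_coeff_eq_zero]
      intro k hk
      rw [coeff_curveOf i a ⟨j, hj⟩, dif_neg (by simp; omega)]

theorem curveOf_coeff {s m : ℕ} (hs : 1 ≤ s) {i : Fin m} {J : Fin m → Polynomial ℝ}
    (hJ : J ∈ truncationsBy s i) :
    curveOf (s := s) i (fun jk => (J jk.1.1).coeff jk.2.1) = J := by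
  rw [mem_truncationsBy_iff hs] at hJ
  ext j k
  by_cases hj : j = i
  · subst hj
    rw [curveOf_self, hJ.1]
  · rw [coeff_curveOf i _ ⟨j, hj⟩]
    split_ifs with hk
    · rfl
    · rcases Nat.eq_zero_or_pos k with rfl | h0
      · exact (hJ.2 j).1.symm
      · refine (Polynomial.coeff_eq_zero_of_natDegree_lt ?_).symm
        have := (hJ.2 j).2
        simp only [Finset.mem_Icc, not_and, not_le] at hk
        have := hk h0
        omega

/-! ### The linear change of variables -/

theorem totalDegree_aeval_le {σ τ : Type*} (f : σ → MvPolynomial τ ℝ)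
    (hf : ∀ j, (f j).totalDegree ≤ 1) (P : MvPolynomial σ ℝ) :
    (aeval f P).totalDegree ≤ P.totalDegree := by
  rw [aeval_def, eval₂_eq]
  refine totalDegree_finsetSum_le fun d hd => ?_
  refine (totalDegree_mul _ _).trans ?_
  rw [algebraMap_eq, totalDegree_C, zero_add]
  refine (totalDegree_finsetProd _ _).trans (le_trans ?_ (le_totalDegree hd))
  refine Finset.sum_le_sum fun j _ => (totalDegree_pow _ _).trans ?_
  calc d j * (f j).totalDegree ≤ d j * 1 := Nat.mul_le_mul_left _ (hf j)
    _ = d j := mul_one _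

theorem adaptedPoly_mem {r m : ℕ} (i : Fin m) (b : Fin m → ℝ) {P : MvPolynomial (Fin m) ℝ}
    (hP : P ∈ polySpace r m) : adaptedPoly i b P ∈ polySpace r m := by
  refine ⟨(totalDegree_aeval_le _ (fun j => ?_) P).trans hP.1, ?_⟩
  · split_ifs
    · exact (totalDegree_X _).le
    · refine (totalDegree_add _ _).trans (max_le (totalDegree_X _).le ?_)
      refine (totalDegree_mul _ _).trans ?_
      rw [totalDegree_C, totalDegree_X]
  · have h : ∀ Q : MvPolynomial (Fin m) ℝ, constantCoeff (adaptedPoly i b Q) = constantCoeff Q := by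
      intro Q
      induction Q using MvPolynomial.induction_on with
      | C r => simp [adaptedPoly]
      | add p q hp hq => simp only [adaptedPoly, map_add] at hp hq ⊢; rw [hp, hq]
      | mul_X p j hp =>
        simp only [adaptedPoly, map_mul, aeval_X] at hp ⊢
        split_ifs <;> simp
    exact (h P).trans hP.2

theorem adaptedPoly_neg {m : ℕ} (i : Fin m) (b : Fin m → ℝ) (P : MvPolynomial (Fin m) ℝ) :
    adaptedPoly i (-b) (adaptedPoly i b P) = P := by
  induction P using MvPolynomial.induction_on with
  | C r => simp [adaptedPoly]
  | add p q hp hq => simp only [adaptedPoly, map_add] at hp hq ⊢; rw [hp, hq]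
  | mul_X p j hp =>
    simp only [adaptedPoly, map_mul, aeval_X] at hp ⊢
    rw [hp]
    split_ifs with h
    · simp [h]
    · simp [h]

theorem adaptedPoly_congr {m : ℕ} (i : Fin m) {b b' : Fin m → ℝ} (h : ∀ j, j ≠ i → b j = b' j) :
    adaptedPoly i b = adaptedPoly i b' := by
  funext P
  unfold adaptedPoly
  congr 2
  funext j
  split_ifs with hj
  · rfl
  · rw [h j hj]

theorem aeval_adaptedCurve {m : ℕ} (i : Fin m) (b : Fin m → ℝ) (J : Fin m → Polynomial ℝ)
    (P : MvPolynomial (Fin m) ℝ) : aeval (adaptedCurve i b J) (adaptedPoly i b P) = aeval J P := by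
  induction P using MvPolynomial.induction_on with
  | C r => simp [adaptedPoly]
  | add p q hp hq => simp only [adaptedPoly, map_add] at hp hq ⊢; rw [hp, hq]
  | mul_X p j hp =>
    simp only [adaptedPoly, map_mul, aeval_X] at hp ⊢
    rw [hp]
    split_ifs with h
    · simp [adaptedCurve, h]
    · simp [adaptedCurve, h]

/-- The chain rule for the linear change of variables. -/
theorem pderiv_adaptedPoly {m : ℕ} (i : Fin m) (b : Fin m → ℝ) (P : MvPolynomial (Fin m) ℝ)
    (ℓ : Fin m) :
    pderiv ℓ (adaptedPoly i b P) = adaptedPoly i b (pderiv ℓ P) +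
      if ℓ = i then ∑ j ∈ Finset.univ.erase i, C (b j) * adaptedPoly i b (pderiv j P) else 0 := by
  induction P using MvPolynomial.induction_on with
  | C r => simp [adaptedPoly]
  | add p q hp hq =>
    simp only [adaptedPoly, map_add] at hp hq ⊢
    rw [hp, hq]
    split_ifs
    · simp only [mul_add, Finset.sum_add_distrib]; ring
    · ring
  | mul_X p k hp =>
    simp only [adaptedPoly, map_mul, aeval_X, Derivation.leibniz, smul_eq_mul, map_add] at hp ⊢
    rw [hp]
    set ψ : MvPolynomial (Fin m) ℝ →ₐ[ℝ] MvPolynomial (Fin m) ℝ :=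
      aeval (fun j => if j = i then (X i : MvPolynomial (Fin m) ℝ) else X j + C (b j) * X i)
    have hψ : ∀ j : Fin m, ψ (pderiv j (X k)) = if k = j then 1 else 0 := by
      intro j
      rw [pderiv_X, Pi.single_apply]
      split_ifs <;> simp
    simp only [hψ]
    by_cases hk : k = i
    · subst hk
      by_cases hl : ℓ = k
      · subst hl
        simp only [if_true, pderiv_X_self, mul_add, Finset.sum_add_distrib, Finset.mul_sum]
        rw [Finset.sum_eq_zero (f := fun x =>
            C (b x) * (ψ p * if ℓ = x then (1 : MvPolynomial (Fin m) ℝ) else 0))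
          fun j hj => by rw [if_neg (Finset.ne_of_mem_erase hj).symm]; ring]
        simp only [mul_left_comm]
        ring
      · simp [hl, Ne.symm hl, pderiv_X]
    · by_cases hl : ℓ = i
      · subst hl
        have h1 : pderiv ℓ (X k + C (b k) * X ℓ : MvPolynomial (Fin m) ℝ) = C (b k) := by
          simp [pderiv_X, hk]
        simp only [if_neg hk, if_true, h1, mul_add, Finset.sum_add_distrib, Finset.mul_sum]
        rw [Finset.sum_eq_single (f := fun x =>
            C (b x) * (ψ p * if k = x then (1 : MvPolynomial (Fin m) ℝ) else 0))
          k (fun j _ hj => by rw [if_neg hj.symm]; ring)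
          (fun h => absurd (Finset.mem_erase.mpr ⟨hk, Finset.mem_univ _⟩) h)]
        simp only [mul_left_comm, if_true]
        ring
      · have h1 : pderiv ℓ (X k + C (b k) * X i : MvPolynomial (Fin m) ℝ) =
            if k = ℓ then 1 else 0 := by
          simp [pderiv_X, Ne.symm hl, Pi.single_apply]
        simp only [if_neg hk, if_neg hl, h1]
        ring

/-- Vanishing of the gradient along a curve does not depend on the linear coordinates. -/
theorem vanishesOn_adapted_iff {m s : ℕ} (i : Fin m) (b : Fin m → ℝ)
    {P : MvPolynomial (Fin m) ℝ} {J : Fin m → Polynomial ℝ} :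
    VanishesOn s (adaptedPoly i b P) (adaptedCurve i b J) ↔ VanishesOn s P J := by
  have key : ∀ ℓ α, (aeval (adaptedCurve i b J) (pderiv ℓ (adaptedPoly i b P))).coeff α =
      (aeval J (pderiv ℓ P)).coeff α + if ℓ = i then
        ∑ j ∈ Finset.univ.erase i, b j * (aeval J (pderiv j P)).coeff α else 0 := by
    intro ℓ α
    rw [pderiv_adaptedPoly, map_add, aeval_adaptedCurve, Polynomial.coeff_add]
    split_ifs
    · simp [aeval_adaptedCurve]
    · simp
  simp only [vanishesOn_iff, key]
  constructor
  · intro h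
    have h1 : ∀ ℓ, ℓ ≠ i → ∀ α ≤ s, (aeval J (pderiv ℓ P)).coeff α = 0 := by
      intro ℓ hℓ α hα
      simpa [hℓ] using h ℓ α hα
    intro ℓ α hα
    by_cases hℓ : ℓ = i
    · have := h ℓ α hα
      rw [if_pos hℓ, Finset.sum_eq_zero fun j hj => by
        rw [h1 j (Finset.ne_of_mem_erase hj) α hα, mul_zero], add_zero] at this
      exact this
    · exact h1 ℓ hℓ α hα
  · intro h ℓ α hα
    rw [h ℓ α hα, Finset.sum_eq_zero fun j _ => by rw [h j α hα, mul_zero]]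
    simp

/-- The coefficients of the transformed polynomial are polynomials in the coefficients of the
polynomial and of the change of variables. -/
theorem exists_coeff_adaptedPoly {κ : Type*} {r m : ℕ} (i : Fin m) (b : Fin m → MvPolynomial κ ℝ)
    (p : MultiIdx r m → MvPolynomial κ ℝ) (μ : Fin m →₀ ℕ) :
    ∃ Φ : MvPolynomial κ ℝ, ∀ x : κ → ℝ,
      (adaptedPoly i (fun j => eval x (b j)) (polyOf fun μ => eval x (p μ))).coeff μ =
        eval x Φ := by
  refine ⟨(bind₁ (fun j => if j = i then (X i : MvPolynomial (Fin m) (MvPolynomial κ ℝ))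
    else X j + C (b j) * X i) (polyOf p)).coeff μ, fun x => ?_⟩
  rw [← coeff_map, map_bind₁, map_polyOf, adaptedPoly]
  rw [bind₁]
  congr 3
  funext j
  split_ifs <;> simp

/-! ### Expansion of the gradient along a curve tangent to a coordinate axis -/

theorem aeval_monomial_curve {m : ℕ} (J : Fin m → Polynomial ℝ) (τ : Fin m →₀ ℕ) (c : ℝ) :
    aeval J (monomial τ c) = Polynomial.C c * ∏ j, J j ^ τ j := by
  rw [aeval_monomial, Finsupp.prod_fintype _ _ fun _ => pow_zero _]
  rfl

theorem coeff_aeval_pderiv_polyOf {r m : ℕ} (p : MultiIdx r m → ℝ) (J : Fin m → Polynomial ℝ)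
    (ℓ : Fin m) (α : ℕ) :
    (aeval J (pderiv ℓ (polyOf p))).coeff α =
      ∑ μ : MultiIdx r m, (μ.1 ℓ : ℝ) * p μ *
        (∏ j, J j ^ (μ.1 - Finsupp.single ℓ 1 : Fin m →₀ ℕ) j).coeff α := by
  simp only [polyOf, map_sum, pderiv_monomial, aeval_monomial_curve, Polynomial.finsetSum_coeff,
    Polynomial.coeff_C_mul]
  exact Finset.sum_congr rfl fun μ _ => by ring

theorem X_pow_dvd_aeval_sub {m n : ℕ} {J J' : Fin m → Polynomial ℝ}
    (h : ∀ j, Polynomial.X ^ n ∣ J j - J' j) (Q : MvPolynomial (Fin m) ℝ) :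
    Polynomial.X ^ n ∣ aeval J Q - aeval J' Q := by
  induction Q using MvPolynomial.induction_on with
  | C r => simp
  | add p q hp hq =>
    rw [map_add, map_add, add_sub_add_comm]
    exact dvd_add hp hq
  | mul_X p j hp =>
    rw [map_mul, map_mul, aeval_X, aeval_X, show aeval J p * J j - aeval J' p * J' j =
      (aeval J p - aeval J' p) * J j + aeval J' p * (J j - J' j) by ring]
    exact dvd_add (hp.mul_right _) ((h j).mul_left _)

theorem coeff_aeval_congr {m α : ℕ} {J J' : Fin m → Polynomial ℝ}
    (h : ∀ j, ∀ k ≤ α, (J j).coeff k = (J' j).coeff k) (Q : MvPolynomial (Fin m) ℝ) :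
    (aeval J Q).coeff α = (aeval J' Q).coeff α := by
  have := X_pow_dvd_aeval_sub (n := α + 1) (J := J) (J' := J') (fun j => by
    rw [Polynomial.X_pow_dvd_iff]
    intro k hk
    rw [Polynomial.coeff_sub, h j k (by omega), sub_self]) Q
  rw [Polynomial.X_pow_dvd_iff] at this
  have := this α (by omega)
  rwa [Polynomial.coeff_sub, sub_eq_zero] at this

section Expansion

variable {r s m : ℕ} {i : Fin m} {y : AdaptedIdx r s i → ℝ} {J : Fin m → Polynomial ℝ}

/-- The curve `J` is tangent to the `i`-th axis, parametrized by the `i`-th coordinate, and its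
other coefficients up to the order `s` are the coordinates `a_{jk}` of `y`. -/
structure IsAdaptedTo (y : AdaptedIdx r s i → ℝ) (J : Fin m → Polynomial ℝ) : Prop where
  self : J i = Polynomial.X
  low : ∀ j : {j : Fin m // j ≠ i}, ∀ k < 2, (J j.1).coeff k = 0
  high : ∀ j : {j : Fin m // j ≠ i}, ∀ k, 2 ≤ k → k ≤ s →
    (J j.1).coeff k = eval y (aVar r s i j k)

/-- The coefficients of a monomial along an adapted curve, by the multinomial theorem. -/
theorem IsAdaptedTo.coeff_prod (h : IsAdaptedTo y J) (τ : Fin m →₀ ℕ) {α : ℕ} (hα : α ≤ s) :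
    (∏ j, J j ^ τ j).coeff α = eval y (gSum r s i τ α) := by
  -- Truncate the components of `J` beyond the order `α`, which does not affect the coefficient.
  set K : {j : Fin m // j ≠ i} → Polynomial ℝ := fun j =>
    ∑ u : {u : ℕ // u ∈ Finset.Icc 2 α},
      Polynomial.C (eval y (aVar r s i j u.1)) * Polynomial.X ^ u.1 with hK
  set J' : Fin m → Polynomial ℝ := fun j =>
    if hj : j = i then Polynomial.X else K ⟨j, hj⟩ with hJ'
  have hcoeff : ∀ j k, k ≤ α → (J j).coeff k = (J' j).coeff k := by
    intro j k hk
    by_cases hj : j = i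
    · subst hj
      simp [hJ', h.self]
    · simp only [hJ', dif_neg hj, hK, Polynomial.finsetSum_coeff, Polynomial.coeff_C_mul,
        Polynomial.coeff_X_pow, mul_ite, mul_one, mul_zero]
      by_cases h2 : k < 2
      · rw [h.low ⟨j, hj⟩ k h2, Finset.sum_eq_zero]
        intro u _
        have := (Finset.mem_Icc.mp u.2).1
        rw [if_neg (by omega)]
      · rw [h.high ⟨j, hj⟩ k (by omega) (by omega),
          Finset.sum_eq_single ⟨k, Finset.mem_Icc.mpr ⟨by omega, hk⟩⟩]
        · simp
        · intro u _ hne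
          rw [if_neg fun e => hne (Subtype.ext e.symm)]
        · simp
  have h1 : (∏ j, J j ^ τ j).coeff α = (∏ j, J' j ^ τ j).coeff α := by
    have := coeff_aeval_congr hcoeff (monomial τ 1)
    rwa [aeval_monomial_curve, aeval_monomial_curve, map_one, one_mul, one_mul] at this
  have h2 : ∏ j, J' j ^ τ j = Polynomial.X ^ τ i * ∏ j : {j : Fin m // j ≠ i}, K j ^ τ j.1 := by
    rw [← Finset.mul_prod_erase _ _ (Finset.mem_univ i)]
    congr 1
    · simp [hJ']
    · rw [Finset.prod_subtype (p := fun j => j ≠ i) (Finset.univ.erase i) (by simp)]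
      exact Finset.prod_congr rfl fun j _ => by simp only [hJ', dif_neg j.2]
  have h3 : ∏ j : {j : Fin m // j ≠ i}, K j ^ τ j.1 =
      ∑ k ∈ Fintype.piFinset fun j : {j : Fin m // j ≠ i} =>
          (Finset.univ : Finset {u : ℕ // u ∈ Finset.Icc 2 α}).piAntidiag (τ j.1),
        Polynomial.C (∏ j, ((Nat.multinomial Finset.univ (k j) : ℕ) : ℝ) *
          ∏ u, eval y (aVar r s i j u.1) ^ k j u) *
        Polynomial.X ^ (∑ j, ∑ u, u.1 * k j u) := by
    simp only [hK, Finset.sum_pow_eq_sum_piAntidiag]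
    rw [Finset.prod_univ_sum]
    refine Finset.sum_congr rfl fun k _ => ?_
    simp only [mul_pow, Finset.prod_mul_distrib, map_mul, map_prod, map_pow, map_natCast,
      ← Finset.prod_pow_eq_pow_sum, pow_mul]
    ring
  rw [h1, h2, h3, Finset.mul_sum, Polynomial.finsetSum_coeff, gSum, map_sum]
  have h4 : gFamilies i τ α = (Fintype.piFinset fun j : {j : Fin m // j ≠ i} =>
      (Finset.univ : Finset {u : ℕ // u ∈ Finset.Icc 2 α}).piAntidiag (τ j.1)).filter
        fun k => α = τ i + ∑ j, ∑ u, u.1 * k j u := by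
    ext k
    rw [mem_gFamilies, Finset.mem_filter, Fintype.mem_piFinset]
    simp [eq_comm]
  rw [h4, Finset.sum_filter]
  refine Finset.sum_congr rfl fun k _ => ?_
  rw [mul_left_comm, ← pow_add, Polynomial.coeff_C_mul, Polynomial.coeff_X_pow, mul_ite, mul_one,
    mul_zero]
  split_ifs
  · simp
  · rfl

theorem IsAdaptedTo.coeff_prod_eq_zero (h : IsAdaptedTo y J) (τ : Fin m →₀ ℕ) {α : ℕ}
    (hτ : α < τ.degree) : (∏ j, J j ^ τ j).coeff α = 0 := by
  have h0 : ∀ j, Polynomial.X ∣ J j := by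
    intro j
    rw [Polynomial.X_dvd_iff]
    by_cases hj : j = i
    · rw [hj, h.self, Polynomial.coeff_X_zero]
    · exact h.low ⟨j, hj⟩ 0 (by omega)
  have : Polynomial.X ^ τ.degree ∣ ∏ j, J j ^ τ j := by
    rw [Finsupp.degree_eq_sum, ← Finset.prod_pow_eq_pow_sum]
    exact Finset.prod_dvd_prod_of_dvd _ _ fun j _ => pow_dvd_pow_of_dvd (h0 j) _
  exact Polynomial.X_pow_dvd_iff.mp this α hτ

theorem prod_pow_nu (J : Fin m → Polynomial ℝ) (j : Fin m) (β : ℕ) :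
    ∏ k, J k ^ (nu i j β) k = J i ^ β * J j := by
  simp only [nu, Finsupp.add_apply, pow_add, Finset.prod_mul_distrib]
  congr 1
  · rw [Finset.prod_eq_single i (fun k _ hk => by rw [Finsupp.single_eq_of_ne hk, pow_zero])
      (by simp), Finsupp.single_eq_same]
  · rw [Finset.prod_eq_single j (fun k _ hk => by rw [Finsupp.single_eq_of_ne hk, pow_zero])
      (by simp), Finsupp.single_eq_same, pow_one]

theorem nu_sub_single (j : Fin m) (β : ℕ) : nu i j β - Finsupp.single j 1 = Finsupp.single i β := by
  simp [nu]

theorem degree_nu (j : Fin m) (β : ℕ) : (nu i j β).degree = β + 1 := by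
  simp [nu]

theorem nu_injective {j j' : Fin m} {β β' : ℕ} (h : nu i j β = nu i j' β') : j = j' ∧ β = β' := by
  have h1 : β = β' := by
    have := congrArg Finsupp.degree h
    rw [degree_nu, degree_nu] at this
    omega
  subst h1
  exact ⟨Finsupp.single_left_injective one_ne_zero (add_left_cancel h), rfl⟩

theorem IsAdaptedTo.coeff_nu_sub (h : IsAdaptedTo y J) {j : Fin m} (β α : ℕ) :
    (∏ k, J k ^ (nu i j β - Finsupp.single j 1 : Fin m →₀ ℕ) k).coeff α =
      if α = β then 1 else 0 := by
  rw [nu_sub_single, Finset.prod_eq_single i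
    (fun k _ hk => by rw [Finsupp.single_eq_of_ne hk, pow_zero]) (by simp), Finsupp.single_eq_same,
    h.self, Polynomial.coeff_X_pow]

theorem nu_apply_ne {j k : Fin m} (β : ℕ) (hk : k ≠ i) : nu i j β k = if j = k then 1 else 0 := by
  simp [nu, Finsupp.single_apply, Ne.symm hk]

theorem nu_apply_self {j : Fin m} (β : ℕ) (hj : j ≠ i) : nu i j β i = β := by
  simp [nu, hj]

/-- A multi-index of degree between `1` and `α + 1` is either special or one of the `ν(j,β)`. -/
theorem exists_eq_nu {α : ℕ} {μ : Fin m →₀ ℕ} (h1 : 1 ≤ μ.degree) (h2 : μ.degree ≤ α + 1)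
    (h : μ ∉ specialM i α) : ∃ j, ∃ β ≤ α, μ = nu i j β := by
  by_cases hd : μ.degree = 1
  · obtain ⟨j, hj⟩ : ∃ j, μ = Finsupp.single j 1 := by
      obtain ⟨j, hj⟩ : ∃ j, 1 ≤ μ j := by
        by_contra! hc
        have : μ = 0 := Finsupp.ext fun j => by simpa using hc j
        rw [this, map_zero] at h1
        omega
      have hle : Finsupp.single j 1 ≤ μ := Finsupp.single_le_iff.mpr hj
      have h0 : (μ - Finsupp.single j 1).degree + (Finsupp.single j 1).degree = μ.degree := by
        rw [← map_add, tsub_add_cancel_of_le hle]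
      rw [Finsupp.degree_single, hd, Nat.add_eq_right, Finsupp.degree_eq_zero_iff] at h0
      exact ⟨j, by rw [← tsub_add_cancel_of_le hle, h0, zero_add]⟩
    exact ⟨j, 0, Nat.zero_le _, by simp [nu, hj]⟩
  · by_contra! hc
    exact h ⟨by omega, h2, fun j β hβ => hc j β (Finset.mem_Icc.mp hβ).2⟩

theorem nu_notMem_specialM (j : Fin m) (β α : ℕ) : nu i j β ∉ specialM i α := by
  rintro ⟨h1, h2, h3⟩
  rw [degree_nu] at h1 h2
  exact h3 j β (Finset.mem_Icc.mpr ⟨by omega, by omega⟩) rfl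

theorem remainderTerm_eq_zero (r s : ℕ) (i ℓ : Fin m) {α : ℕ} (hα : α ≤ 1) :
    remainderTerm r s i ℓ α = 0 := by
  classical
  rw [remainderTerm, Finset.filter_false_of_mem, Finset.sum_empty]
  rintro μ - ⟨⟨k, hk⟩, hM, hℓ⟩
  rw [mem_gFamilies] at hk
  have hempty : IsEmpty {u : ℕ // u ∈ Finset.Icc 2 α} :=
    ⟨fun u => by have := Finset.mem_Icc.mp u.2; omega⟩
  simp only [Finset.univ_eq_empty, Finset.sum_empty, Finset.sum_const_zero, add_zero] at hk
  have hsub : μ.1 - Finsupp.single ℓ 1 = Finsupp.single i α := by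
    ext j
    by_cases hj : j = i
    · subst hj
      rw [hk.2, Finsupp.single_eq_same]
    · rw [← hk.1 ⟨j, hj⟩, Finsupp.single_eq_of_ne hj]
  have hμ : μ.1 = nu i ℓ α := by
    rw [nu, ← hsub, tsub_add_cancel_of_le]
    rw [Finsupp.single_le_iff]
    omega
  exact nu_notMem_specialM ℓ α α (hμ ▸ hM)

/-- The formula for orders at least two also covers the orders zero and one. -/
theorem explicitQ_eq (r s : ℕ) (i ℓ : Fin m) (α : ℕ) :
    explicitQ r s i ℓ α = if ℓ = i then
      ((α + 1 : ℕ) : MvPolynomial (AdaptedIdx r s i) ℝ) * pVar r s i (nu i i α)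
        + ∑ j : {j : Fin m // j ≠ i}, ∑ β ∈ Finset.Icc 1 (α - 1),
            (β : MvPolynomial (AdaptedIdx r s i) ℝ) * pVar r s i (nu i j.1 β)
              * aVar r s i j (α - (β - 1))
        + remainderTerm r s i i α
    else pVar r s i (nu i ℓ α) + remainderTerm r s i ℓ α := by
  rw [explicitQ]
  by_cases h0 : α = 0
  · subst h0
    rw [if_pos rfl, remainderTerm_eq_zero r s i i (by omega),
      remainderTerm_eq_zero r s i ℓ (by omega)]
    split_ifs with h
    · simp [h]
    · simp
  · rw [if_neg h0]
    by_cases h1 : α = 1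
    · subst h1
      rw [if_pos rfl, remainderTerm_eq_zero r s i i le_rfl, remainderTerm_eq_zero r s i ℓ le_rfl]
      split_ifs with h
      · simp
      · simp
    · rw [if_neg h1]

/-- The coefficients of the gradient along an adapted curve are the explicit polynomials. -/
theorem IsAdaptedTo.coeff_gradient (h : IsAdaptedTo y J) (hsr : s + 1 ≤ r) (ℓ : Fin m) {α : ℕ}
    (hα : α ≤ s) :
    (aeval J (pderiv ℓ (polyOf fun μ => y (Sum.inl μ)))).coeff α =
      eval y (explicitQ r s i ℓ α) := by
  classical
  set t : (Fin m →₀ ℕ) → ℝ := fun μ => (μ ℓ : ℝ) * eval y (pVar r s i μ) *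
    (∏ j, J j ^ (μ - Finsupp.single ℓ 1 : Fin m →₀ ℕ) j).coeff α with ht
  have hp : ∀ μ : MultiIdx r m, eval y (pVar r s i μ.1) = y (Sum.inl μ) := fun μ => by
    rw [pVar, dif_pos μ.2, eval_X]
  rw [coeff_aeval_pderiv_polyOf]
  simp only [← hp]
  change ∑ μ : MultiIdx r m, t μ.1 = _
  rw [← Finset.sum_filter_add_sum_filter_not Finset.univ (fun μ : MultiIdx r m =>
    (gFamilies i (μ.1 - Finsupp.single ℓ 1) α).Nonempty ∧ μ.1 ∈ specialM i α ∧ μ.1 ℓ ≠ 0)]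
  have hrem : ∑ μ : MultiIdx r m with
      (gFamilies i (μ.1 - Finsupp.single ℓ 1) α).Nonempty ∧ μ.1 ∈ specialM i α ∧ μ.1 ℓ ≠ 0,
      t μ.1 = eval y (remainderTerm r s i ℓ α) := by
    rw [remainderTerm, map_sum]
    refine Finset.sum_congr rfl fun μ _ => ?_
    rw [ht, map_mul, map_mul, map_natCast, ← h.coeff_prod _ hα]
  rw [hrem]
  -- Only the `ν(j,β)` contribute to the remaining sum.
  have hzero : ∀ μ : MultiIdx r m,
      ¬((gFamilies i (μ.1 - Finsupp.single ℓ 1) α).Nonempty ∧ μ.1 ∈ specialM i α ∧ μ.1 ℓ ≠ 0) →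
      t μ.1 ≠ 0 → ∃ j, ∃ β ≤ α, μ.1 = nu i j β := by
    intro μ hμ hne
    have hℓ : μ.1 ℓ ≠ 0 := by
      rintro h0
      exact hne (by simp [ht, h0])
    have hc : (∏ j, J j ^ (μ.1 - Finsupp.single ℓ 1 : Fin m →₀ ℕ) j).coeff α ≠ 0 :=
      right_ne_zero_of_mul hne
    have hG : (gFamilies i (μ.1 - Finsupp.single ℓ 1) α).Nonempty := by
      by_contra hG
      rw [Finset.not_nonempty_iff_eq_empty] at hG
      rw [h.coeff_prod _ hα, gSum, hG] at hc
      simp at hc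
    have hdeg : μ.1.degree ≤ α + 1 := by
      by_contra! hlt
      refine hc (h.coeff_prod_eq_zero _ ?_)
      have : (μ.1 - Finsupp.single ℓ 1).degree + (Finsupp.single ℓ 1).degree = μ.1.degree := by
        rw [← map_add, tsub_add_cancel_of_le]
        rw [Finsupp.single_le_iff]
        omega
      rw [Finsupp.degree_single] at this
      omega
    exact exists_eq_nu μ.2.1 hdeg fun hM => hμ ⟨hG, hM, hℓ⟩
  have hmem : ∀ j, ∀ β ≤ α, 1 ≤ (nu i j β).degree ∧ (nu i j β).degree ≤ r := fun j β hβ => by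
    rw [degree_nu]; omega
  have hnot : ∀ j, ∀ β, ∀ hβ : β ≤ α, (⟨nu i j β, hmem j β hβ⟩ : MultiIdx r m) ∈
      Finset.univ.filter fun μ : MultiIdx r m =>
        ¬((gFamilies i (μ.1 - Finsupp.single ℓ 1) α).Nonempty ∧ μ.1 ∈ specialM i α ∧ μ.1 ℓ ≠ 0) :=
    fun j β hβ => Finset.mem_filter.mpr
      ⟨Finset.mem_univ _, fun hh => nu_notMem_specialM j β α hh.2.1⟩
  by_cases hℓ : ℓ = i
  · subst hℓ
    have htj : ∀ j : {j : Fin m // j ≠ ℓ}, ∀ β, 1 ≤ β → β ≤ α → t (nu ℓ j.1 β) =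
        (β : ℝ) * eval y (pVar r s ℓ (nu ℓ j.1 β)) * (J j.1).coeff (α - (β - 1)) := by
      intro j β h1 h2
      have e : nu ℓ j.1 β - Finsupp.single ℓ 1 = nu ℓ j.1 (β - 1) := by
        obtain ⟨β, rfl⟩ : ∃ b, β = b + 1 := ⟨β - 1, by omega⟩
        rw [nu, nu, Nat.add_sub_cancel, Finsupp.single_add, add_right_comm, add_tsub_cancel_right]
      have hle : β - 1 ≤ α := by omega
      simp only [ht]
      rw [e, prod_pow_nu, h.self, nu_apply_self β j.2, Polynomial.coeff_X_pow_mul', if_pos hle]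
    have hti : t (nu ℓ ℓ α) = ((α + 1 : ℕ) : ℝ) * eval y (pVar r s ℓ (nu ℓ ℓ α)) := by
      simp only [ht, h.coeff_nu_sub]
      simp [nu]
    -- For `ℓ = i` the contributions come from `ν(i,α)` and from the `ν(j,β)` with `j ≠ i` and
    -- `1 ≤ β ≤ α - 1`: for `β = 0` the multi-index does not involve `x_i`, and for `β = α` the
    -- coefficient of `J_j` has order one, hence vanishes.
    set N : Finset (Fin m →₀ ℕ) :=
      (Finset.univ ×ˢ Finset.Icc 1 (α - 1)).image
        fun jβ : {j : Fin m // j ≠ ℓ} × ℕ => nu ℓ jβ.1.1 jβ.2 with hN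
    have hiN : nu ℓ ℓ α ∉ N := by
      intro hmem'
      obtain ⟨jβ, -, e⟩ := Finset.mem_image.mp hmem'
      exact jβ.1.2 (nu_injective e).1
    have hsum : ∑ μ : MultiIdx r m with
        ¬((gFamilies ℓ (μ.1 - Finsupp.single ℓ 1) α).Nonempty ∧ μ.1 ∈ specialM ℓ α ∧ μ.1 ℓ ≠ 0),
        t μ.1 = ∑ μ ∈ insert (nu ℓ ℓ α) N, t μ := by
      rw [← Finset.sum_image (f := t) (g := fun μ : MultiIdx r m => μ.1)
        fun _ _ _ _ e => Subtype.ext e]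
      symm
      refine Finset.sum_subset ?_ ?_
      · intro μ hμ
        rcases Finset.mem_insert.mp hμ with rfl | hμ
        · exact Finset.mem_image.mpr ⟨_, hnot ℓ α le_rfl, rfl⟩
        · obtain ⟨jβ, hjβ, rfl⟩ := Finset.mem_image.mp hμ
          have := Finset.mem_Icc.mp (Finset.mem_product.mp hjβ).2
          exact Finset.mem_image.mpr ⟨_, hnot jβ.1.1 jβ.2 (by omega), rfl⟩
      · intro μ' hμ' hμN
        obtain ⟨μ, hμ, rfl⟩ := Finset.mem_image.mp hμ'
        by_contra h0
        obtain ⟨j, β, hβ, e⟩ := hzero μ (Finset.mem_filter.mp hμ).2 h0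
        rw [e] at h0 hμN
        by_cases hj : j = ℓ
        · subst hj
          simp only [ht, h.coeff_nu_sub] at h0
          have hβα : α = β := by
            by_contra hc
            simp [hc] at h0
          exact hμN (Finset.mem_insert.mpr (.inl (by rw [hβα])))
        · have hβ1 : 1 ≤ β := by
            by_contra! hlt
            refine h0 ?_
            simp only [ht, Nat.lt_one_iff.mp hlt, nu_apply_self 0 hj]
            simp
          rw [htj ⟨j, hj⟩ β hβ1 hβ] at h0
          have hhigh : ¬ α - (β - 1) < 2 := fun hlt =>
            right_ne_zero_of_mul h0 (h.low ⟨j, hj⟩ _ hlt)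
          refine hμN (Finset.mem_insert.mpr (.inr (Finset.mem_image.mpr
            ⟨(⟨j, hj⟩, β), Finset.mem_product.mpr ⟨Finset.mem_univ _, Finset.mem_Icc.mpr ?_⟩,
              rfl⟩)))
          dsimp only
          omega
    rw [hsum, Finset.sum_insert hiN, hN, Finset.sum_image (by
      rintro ⟨j, β⟩ - ⟨j', β'⟩ - e
      obtain ⟨e1, e2⟩ := nu_injective e
      exact Prod.ext (Subtype.ext e1) e2), Finset.sum_product, hti, explicitQ_eq, if_pos rfl]
    simp only [map_add, map_mul, map_sum, map_natCast]
    rw [add_comm]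
    congr 2
    refine Finset.sum_congr rfl fun j _ => Finset.sum_congr rfl fun β hβ => ?_
    have := Finset.mem_Icc.mp hβ
    rw [htj j β (by omega) (by omega), h.high j _ (by omega) (by omega)]
  · -- For `ℓ ≠ i` only `ν(ℓ,α)` contributes.
    have hsum : ∑ μ : MultiIdx r m with
        ¬((gFamilies i (μ.1 - Finsupp.single ℓ 1) α).Nonempty ∧ μ.1 ∈ specialM i α ∧ μ.1 ℓ ≠ 0),
        t μ.1 = eval y (pVar r s i (nu i ℓ α)) := by
      rw [Finset.sum_eq_single_of_mem _ (hnot ℓ α le_rfl)]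
      · simp only [ht, h.coeff_nu_sub, nu_apply_ne α hℓ]
        simp
      · intro μ hμ hne
        by_contra h0
        obtain ⟨j, β, hβ, e⟩ := hzero μ (Finset.mem_filter.mp hμ).2 h0
        rw [e] at h0
        by_cases hj : j = ℓ
        · subst hj
          simp only [ht, h.coeff_nu_sub] at h0
          have hβα : α = β := by
            by_contra hc
            simp [hc] at h0
          subst hβα
          exact hne (Subtype.ext e)
        · simp [ht, nu_apply_ne β hℓ, hj] at h0
    rw [hsum, explicitQ_eq, if_neg hℓ, map_add, add_comm]

end Expansion

/-! ### The ideal of the explicit equations -/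

section Ideal

variable {r s m : ℕ} {i : Fin m}

/-- The coordinate `𝚙_{ν(ℓ,α)}`, which is the leading variable of the equation `q_{ℓα}`. -/
def nuIdx (hsr : s + 1 ≤ r) (i : Fin m) (e : Fin m × Fin (s + 1)) : AdaptedIdx r s i :=
  Sum.inl ⟨nu i e.1 e.2, by rw [degree_nu]; have := e.2.2; omega⟩

theorem nuIdx_injective (hsr : s + 1 ≤ r) : Function.Injective (nuIdx hsr i) := by
  rintro ⟨ℓ, α⟩ ⟨ℓ', α'⟩ h
  obtain ⟨h1, h2⟩ := nu_injective (congrArg Subtype.val (Sum.inl_injective h))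
  exact Prod.ext h1 (Fin.ext h2)

theorem pVar_nu (hsr : s + 1 ≤ r) (e : Fin m × Fin (s + 1)) :
    pVar r s i (nu i e.1 e.2) = X (nuIdx hsr i e) := by
  rw [pVar, dif_pos]
  rfl

/-- The value of the coordinate `𝚙_{ν(ℓ,α)}` in terms of the free coordinates that solves the
equations. -/
def solution (r s : ℕ) {m : ℕ} (i ℓ : Fin m) (α : ℕ) : MvPolynomial (AdaptedIdx r s i) ℝ :=
  if ℓ = i then
    -(C ((α + 1 : ℝ)⁻¹) * (∑ j : {j : Fin m // j ≠ i}, ∑ β ∈ Finset.Icc 1 (α - 1),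
      (β : MvPolynomial (AdaptedIdx r s i) ℝ) * (-remainderTerm r s i j.1 β)
        * aVar r s i j (α - (β - 1)) + remainderTerm r s i i α))
  else -remainderTerm r s i ℓ α

open Classical in
/-- The substitution that replaces every leading variable by its solution. -/
def solve (hsr : s + 1 ≤ r) (i : Fin m) (k : AdaptedIdx r s i) :
    MvPolynomial (AdaptedIdx r s i) ℝ :=
  if h : ∃ e, nuIdx hsr i e = k then solution r s i h.choose.1 h.choose.2 else X k

theorem solve_nuIdx (hsr : s + 1 ≤ r) (e : Fin m × Fin (s + 1)) :
    solve hsr i (nuIdx hsr i e) = solution r s i e.1 e.2 := by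
  have h : ∃ e', nuIdx hsr i e' = nuIdx hsr i e := ⟨e, rfl⟩
  rw [solve, dif_pos h, nuIdx_injective hsr h.choose_spec]

theorem solve_of_notMem (hsr : s + 1 ≤ r) {k : AdaptedIdx r s i} (h : k ∉ range (nuIdx hsr i)) :
    solve hsr i k = X k := by
  exact dif_neg h

theorem inr_notMem_range_nuIdx (hsr : s + 1 ≤ r) (jk) :
    (Sum.inr jk : AdaptedIdx r s i) ∉ range (nuIdx hsr i) := by
  rintro ⟨e, he⟩
  exact Sum.inl_ne_inr he

section Free

variable {B : Type*} [CommRing B] [Algebra ℝ B] {θ₁ θ₂ : MvPolynomial (AdaptedIdx r s i) ℝ →ₐ[ℝ] B}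

theorem map_aVar_congr {hsr : s + 1 ≤ r} (h : ∀ k ∉ range (nuIdx hsr i), θ₁ (X k) = θ₂ (X k))
    (j : {j : Fin m // j ≠ i}) (k : ℕ) : θ₁ (aVar r s i j k) = θ₂ (aVar r s i j k) := by
  rw [aVar]
  split_ifs with hk
  · exact h _ (inr_notMem_range_nuIdx hsr _)
  · rw [map_zero, map_zero]

/-- The remainders involve the free coordinates only. -/
theorem map_remainderTerm_congr {hsr : s + 1 ≤ r}
    (h : ∀ k ∉ range (nuIdx hsr i), θ₁ (X k) = θ₂ (X k)) (ℓ : Fin m) (α : ℕ) :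
    θ₁ (remainderTerm r s i ℓ α) = θ₂ (remainderTerm r s i ℓ α) := by
  classical
  rw [remainderTerm, map_sum, map_sum]
  refine Finset.sum_congr rfl fun μ hμ => ?_
  have h1 : θ₁ (pVar r s i μ.1) = θ₂ (pVar r s i μ.1) := by
    rw [pVar, dif_pos μ.2]
    refine h _ ?_
    rintro ⟨e, he⟩
    have : nu i e.1 e.2 = μ.1 := congrArg Subtype.val (Sum.inl_injective he)
    exact nu_notMem_specialM e.1 e.2 α (this ▸ (Finset.mem_filter.mp hμ).2.2.1)
  have h2 : θ₁ (gSum r s i (μ.1 - Finsupp.single ℓ 1) α) =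
      θ₂ (gSum r s i (μ.1 - Finsupp.single ℓ 1) α) := by
    simp only [gSum, map_sum, map_prod, map_mul, map_pow, map_natCast, map_aVar_congr h]
  rw [map_mul, map_mul, map_mul, map_mul, h1, h2, map_natCast, map_natCast]

theorem map_solution_congr {hsr : s + 1 ≤ r}
    (h : ∀ k ∉ range (nuIdx hsr i), θ₁ (X k) = θ₂ (X k)) (ℓ : Fin m) (α : ℕ) :
    θ₁ (solution r s i ℓ α) = θ₂ (solution r s i ℓ α) := by
  have hC : ∀ c : ℝ, θ₁ (C c) = θ₂ (C c) := fun c => by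
    rw [← algebraMap_eq, AlgHom.commutes, AlgHom.commutes]
  rw [solution]
  split_ifs
  · simp only [map_neg, map_mul, map_add, map_sum, map_natCast, hC, map_aVar_congr h,
      map_remainderTerm_congr h]
  · rw [map_neg, map_neg, map_remainderTerm_congr h]

theorem map_solve_congr {hsr : s + 1 ≤ r}
    (h : ∀ k ∉ range (nuIdx hsr i), θ₁ (X k) = θ₂ (X k)) (k : AdaptedIdx r s i) :
    θ₁ (solve hsr i k) = θ₂ (solve hsr i k) := by
  by_cases hk : k ∈ range (nuIdx hsr i)
  · obtain ⟨e, rfl⟩ := hk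
    rw [solve_nuIdx]
    exact map_solution_congr h _ _
  · rw [solve_of_notMem hsr hk]
    exact h k hk

end Free

theorem C_inv_mul_cast (α : ℕ) :
    ((α + 1 : ℕ) : MvPolynomial (AdaptedIdx r s i) ℝ) * C ((α + 1 : ℝ)⁻¹) = 1 := by
  rw [← map_natCast (C : ℝ →+* MvPolynomial (AdaptedIdx r s i) ℝ), ← map_mul, Nat.cast_add,
    Nat.cast_one, mul_inv_cancel₀ (by positivity), map_one]

/-- The substitution kills the equations. -/
theorem bind₁_solve_explicitQ (hsr : s + 1 ≤ r) (ℓ : Fin m) {α : ℕ} (hα : α ≤ s) :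
    bind₁ (solve hsr i) (explicitQ r s i ℓ α) = 0 := by
  have hfree : ∀ k ∉ range (nuIdx hsr i), bind₁ (solve hsr i) (X k) =
      AlgHom.id ℝ (MvPolynomial (AdaptedIdx r s i) ℝ) (X k) := fun k hk => by
    rw [bind₁_X_right, solve_of_notMem hsr hk, AlgHom.id_apply]
  have hν : ∀ j β, β ≤ s → bind₁ (solve hsr i) (pVar r s i (nu i j β)) = solution r s i j β := by
    intro j β hβ
    have := pVar_nu (i := i) hsr (j, ⟨β, Nat.lt_succ_of_le hβ⟩)
    dsimp only at this
    rw [this, bind₁_X_right, solve_nuIdx]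
  rw [explicitQ_eq]
  split_ifs with h
  · rw [map_add, map_add, map_mul, map_natCast, hν _ _ hα, map_remainderTerm_congr hfree,
      AlgHom.id_apply, map_sum]
    have hs : ∀ j : {j : Fin m // j ≠ i}, bind₁ (solve hsr i) (∑ β ∈ Finset.Icc 1 (α - 1),
        (β : MvPolynomial (AdaptedIdx r s i) ℝ) * pVar r s i (nu i j.1 β)
          * aVar r s i j (α - (β - 1))) = ∑ β ∈ Finset.Icc 1 (α - 1),
        (β : MvPolynomial (AdaptedIdx r s i) ℝ) * (-remainderTerm r s i j.1 β)
          * aVar r s i j (α - (β - 1)) := by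
      intro j
      rw [map_sum]
      refine Finset.sum_congr rfl fun β hβ => ?_
      have := Finset.mem_Icc.mp hβ
      rw [map_mul, map_mul, map_natCast, hν _ _ (by omega), map_aVar_congr hfree, AlgHom.id_apply,
        solution, if_neg j.2]
    simp only [hs]
    rw [solution, if_pos rfl, mul_neg, ← mul_assoc, C_inv_mul_cast]
    ring
  · rw [map_add, hν _ _ hα, map_remainderTerm_congr hfree, AlgHom.id_apply, solution, if_neg h]
    ring

/-- The ideal generated by the equations. -/
def eqIdeal (r s : ℕ) {m : ℕ} (i : Fin m) : Ideal (MvPolynomial (AdaptedIdx r s i) ℝ) :=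
  Ideal.span {q | ∃ ℓ : Fin m, ∃ α : ℕ, α ≤ s ∧ q = explicitQ r s i ℓ α}

/-- Modulo the ideal each leading variable equals its solution. The equation for `ℓ = i` also
contains leading variables of the equations for `j ≠ i`, which are eliminated first. -/
theorem pVar_sub_solution_mem (ℓ : Fin m) {α : ℕ} (hα : α ≤ s) :
    pVar r s i (nu i ℓ α) - solution r s i ℓ α ∈ eqIdeal r s i := by
  have hq : ∀ ℓ α, α ≤ s → explicitQ r s i ℓ α ∈ eqIdeal r s i := fun ℓ α h =>
    Ideal.subset_span ⟨ℓ, α, h, rfl⟩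
  have hoff : ∀ ℓ ≠ i, ∀ α ≤ s, pVar r s i (nu i ℓ α) - solution r s i ℓ α ∈ eqIdeal r s i := by
    intro ℓ hℓ α h
    have := hq ℓ α h
    rw [explicitQ_eq, if_neg hℓ] at this
    rwa [solution, if_neg hℓ, sub_neg_eq_add]
  by_cases hℓ : ℓ = i
  · subst hℓ
    have h1 : (C ((α + 1 : ℝ)⁻¹) * (explicitQ r s ℓ ℓ α -
        ∑ j : {j : Fin m // j ≠ ℓ}, ∑ β ∈ Finset.Icc 1 (α - 1),
          (β : MvPolynomial (AdaptedIdx r s ℓ) ℝ) *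
            (pVar r s ℓ (nu ℓ j.1 β) - solution r s ℓ j.1 β)
              * aVar r s ℓ j (α - (β - 1)))) ∈ eqIdeal r s ℓ := by
      refine Ideal.mul_mem_left _ _
        (sub_mem (hq ℓ α hα) (sum_mem fun j _ => sum_mem fun β hβ => ?_))
      have := Finset.mem_Icc.mp hβ
      exact Ideal.mul_mem_right _ _ (Ideal.mul_mem_left _ _ (hoff j.1 j.2 β (by omega)))
    convert h1 using 1
    have hsol : ∀ (j : {j : Fin m // j ≠ ℓ}) β,
        solution r s ℓ j.1 β = -remainderTerm r s ℓ j.1 β := fun j β => by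
      rw [solution, if_neg j.2]
    simp only [hsol, mul_sub, sub_mul, Finset.sum_sub_distrib]
    rw [explicitQ_eq, if_pos rfl, solution, if_pos rfl]
    linear_combination (pVar r s ℓ (nu ℓ ℓ α)) * -(C_inv_mul_cast (r := r) (s := s) (i := ℓ) α)
  · exact hoff ℓ hℓ α hα

theorem X_sub_solve_mem (hsr : s + 1 ≤ r) (k : AdaptedIdx r s i) :
    X k - solve hsr i k ∈ eqIdeal r s i := by
  by_cases hk : k ∈ range (nuIdx hsr i)
  · obtain ⟨e, rfl⟩ := hk
    rw [solve_nuIdx, ← pVar_nu]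
    exact pVar_sub_solution_mem _ (Nat.lt_succ_iff.mp e.2.2)
  · rw [solve_of_notMem hsr hk, sub_self]
    exact zero_mem _

theorem sub_bind₁_solve_mem (hsr : s + 1 ≤ r) (f : MvPolynomial (AdaptedIdx r s i) ℝ) :
    f - bind₁ (solve hsr i) f ∈ eqIdeal r s i := by
  have : Ideal.Quotient.mkₐ ℝ (eqIdeal r s i) =
      (Ideal.Quotient.mkₐ ℝ (eqIdeal r s i)).comp (bind₁ (solve hsr i)) := by
    ext k
    rw [AlgHom.comp_apply, bind₁_X_right]
    exact Ideal.Quotient.eq.mpr (X_sub_solve_mem hsr k)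
  exact Ideal.Quotient.eq.mp (DFunLike.congr_fun this f)

/-- The common zero set of the equations. -/
def eqZeros (r s : ℕ) {m : ℕ} (i : Fin m) : Set (AdaptedIdx r s i → ℝ) :=
  {y | ∀ ℓ : Fin m, ∀ α : ℕ, α ≤ s → eval y (explicitQ r s i ℓ α) = 0}

theorem eval_eq_zero_of_mem_eqIdeal {y : AdaptedIdx r s i → ℝ} (hy : y ∈ eqZeros r s i)
    {f : MvPolynomial (AdaptedIdx r s i) ℝ} (hf : f ∈ eqIdeal r s i) : eval y f = 0 := by
  have : eqIdeal r s i ≤ RingHom.ker (eval y) := by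
    rw [eqIdeal, Ideal.span_le]
    rintro _ ⟨ℓ, α, hα, rfl⟩
    exact hy ℓ α hα
  exact this hf

/-- The equations generate the ideal of their zero set, since modulo them every polynomial is
congruent to one in the free coordinates. -/
theorem vanishingIdeal_eqZeros (hsr : s + 1 ≤ r) :
    vanishingIdeal ℝ (eqZeros r s i) = eqIdeal r s i := by
  refine le_antisymm (fun f hf => ?_) fun f hf y hy => eval_eq_zero_of_mem_eqIdeal hy hf
  -- Substituting the solutions into `f` gives a polynomial that vanishes everywhere.
  have h0 : bind₁ (solve hsr i) f = 0 := by
    refine MvPolynomial.funext fun y => ?_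
    have hev : ∀ g, eval y (bind₁ (solve hsr i) g) = eval (fun k => eval y (solve hsr i k)) g :=
      fun g => by
        have := aeval_bind₁ (fun k => y k) (solve hsr i) g
        exact this
    rw [hev, map_zero]
    refine hf _ fun ℓ α hα => ?_
    rw [← hev, bind₁_solve_explicitQ hsr ℓ hα, map_zero]
  have := sub_bind₁_solve_mem hsr f
  rwa [h0, sub_zero] at this

/-- The zero set of the equations is parametrized by the free coordinates. -/
theorem exists_param_eqZeros (hsr : s + 1 ≤ r) (i : Fin m) :
    ∃ ψ : AdaptedIdx r s i → MvPolynomial {k : AdaptedIdx r s i // k ∉ range (nuIdx hsr i)} ℝ,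
      ∀ y ∈ eqZeros r s i, ∃ w, ∀ k, y k = eval w (ψ k) := by
  classical
  let ζ : AdaptedIdx r s i → MvPolynomial {k : AdaptedIdx r s i // k ∉ range (nuIdx hsr i)} ℝ :=
    fun k => if h : k ∉ range (nuIdx hsr i) then X ⟨k, h⟩ else 0
  refine ⟨fun k => bind₁ ζ (solve hsr i k), fun y hy => ⟨fun k => y k.1, fun k => ?_⟩⟩
  have h1 : y k = eval y (solve hsr i k) := by
    have := eval_eq_zero_of_mem_eqIdeal hy (X_sub_solve_mem hsr k)
    rwa [map_sub, eval_X, sub_eq_zero] at this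
  rw [h1]
  refine map_solve_congr (θ₁ := aeval y) (θ₂ := (aeval fun k => y k.1).comp (bind₁ ζ))
    (fun k hk => ?_) k
  simp only [AlgHom.comp_apply, aeval_X, bind₁_X_right, ζ, dif_pos hk]

theorem card_free (hsr : s + 1 ≤ r) (i : Fin m)
    [Fintype {k : AdaptedIdx r s i // k ∉ range (nuIdx hsr i)}] :
    Fintype.card {k : AdaptedIdx r s i // k ∉ range (nuIdx hsr i)} + m * (s + 1) =
      Fintype.card (AdaptedIdx r s i) := by
  classical
  have h1 := Fintype.card_subtype_compl (fun k : AdaptedIdx r s i => k ∈ range (nuIdx hsr i))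
  have h2 : Fintype.card {k : AdaptedIdx r s i // k ∈ range (nuIdx hsr i)} = m * (s + 1) := by
    have := Set.card_range_of_injective (nuIdx_injective (i := i) hsr)
    rw [Fintype.card_prod, Fintype.card_fin, Fintype.card_fin] at this
    rw [← this]
  have h3 := Fintype.card_subtype_le (fun k : AdaptedIdx r s i => k ∈ range (nuIdx hsr i))
  rw [h2] at h1 h3
  have h4 : Fintype.card {k : AdaptedIdx r s i // k ∉ range (nuIdx hsr i)} =
      Fintype.card {k : AdaptedIdx r s i // ¬ k ∈ range (nuIdx hsr i)} :=
    Fintype.card_congr (Equiv.refl _)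
  omega

end Ideal

/-! ### The adapted charts -/

section Charts

variable {r s m : ℕ} {i : Fin m}

theorem isAdaptedTo_adaptedCurve (hs : 1 ≤ s) (P : MvPolynomial (Fin m) ℝ)
    {J : Fin m → Polynomial ℝ} (hJ : J ∈ truncationsBy s i) :
    IsAdaptedTo (adaptedChart r s i (P, J)) (adaptedCurve i (linearPart J) J) := by
  rw [mem_truncationsBy_iff hs] at hJ
  have hc : ∀ j : {j : Fin m // j ≠ i}, ∀ k, (adaptedCurve i (linearPart J) J j.1).coeff k =
      (J j.1).coeff k - (J j.1).coeff 1 * (Polynomial.X : Polynomial ℝ).coeff k := by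
    intro j k
    rw [adaptedCurve, if_neg j.2, hJ.1, Polynomial.coeff_sub, Polynomial.coeff_C_mul]
    rfl
  refine ⟨by rw [adaptedCurve, if_pos rfl, hJ.1], fun j k hk => ?_, fun j k h1 h2 => ?_⟩
  · rw [hc]
    interval_cases k
    · simp [(hJ.2 j.1).1]
    · simp
  · rw [hc, Polynomial.coeff_X, if_neg (by omega), mul_zero, sub_zero, aVar,
      dif_pos (Finset.mem_Icc.mpr ⟨by omega, h2⟩), eval_X]
    rfl

theorem coeff_gradient_adapted (hs : 1 ≤ s) (hsr : s + 1 ≤ r) {P : MvPolynomial (Fin m) ℝ}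
    (hP : P ∈ polySpace r m) {J : Fin m → Polynomial ℝ} (hJ : J ∈ truncationsBy s i)
    (ℓ : Fin m) {α : ℕ} (hα : α ≤ s) :
    (aeval (adaptedCurve i (linearPart J) J)
      (pderiv ℓ (adaptedPoly i (linearPart J) P))).coeff α =
      eval (adaptedChart r s i (P, J)) (explicitQ r s i ℓ α) := by
  rw [← (isAdaptedTo_adaptedCurve hs P hJ).coeff_gradient hsr ℓ hα]
  congr 3
  exact (polyOf_polyChart (adaptedPoly_mem i _ hP)).symm

theorem mem_zSetBy_iff (hs : 1 ≤ s) (hsr : s + 1 ≤ r)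
    {x : MvPolynomial (Fin m) ℝ × (Fin m → Polynomial ℝ)} :
    x ∈ zSetBy r s i ↔
      x ∈ polySpace r m ×ˢ truncationsBy s i ∧ adaptedChart r s i x ∈ eqZeros r s i := by
  refine and_congr_right fun hx => ?_
  rw [← vanishesOn_adapted_iff i (linearPart x.2), vanishesOn_iff]
  refine forall_congr' fun ℓ => forall₂_congr fun α hα => ?_
  rw [coeff_gradient_adapted hs hsr hx.1 hx.2 ℓ hα]

theorem bijOn_adaptedChart (hs : 1 ≤ s) (i : Fin m) :
    BijOn (adaptedChart r s i) (polySpace r m ×ˢ truncationsBy s i) univ := by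
  refine ⟨mapsTo_univ _ _, ?_, ?_⟩
  · rintro ⟨P, J⟩ ⟨hP, hJ⟩ ⟨P', J'⟩ ⟨hP', hJ'⟩ e
    have e2 : ∀ jk : {j : Fin m // j ≠ i} × OrderIdx s,
        (J jk.1.1).coeff jk.2.1 = (J' jk.1.1).coeff jk.2.1 := fun jk => congrFun e (Sum.inr jk)
    have eJ : J = J' := by
      have hJ1 : J ∈ truncationsBy s i := hJ
      have hJ2 : J' ∈ truncationsBy s i := hJ'
      rw [← curveOf_coeff hs hJ1, ← curveOf_coeff hs hJ2]
      congr 1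
      exact funext e2
    subst eJ
    have e1 : polyChart r m (adaptedPoly i (linearPart J) P) =
        polyChart r m (adaptedPoly i (linearPart J) P') := funext fun μ => congrFun e (Sum.inl μ)
    have e3 : adaptedPoly i (linearPart J) P = adaptedPoly i (linearPart J) P' := by
      rw [← polyOf_polyChart (adaptedPoly_mem i _ hP), e1,
        polyOf_polyChart (adaptedPoly_mem i _ hP')]
    have eP : P = P' := by
      rw [← adaptedPoly_neg i (linearPart J) P, e3, adaptedPoly_neg]
    rw [eP]
  · intro y _
    set J := curveOf i fun jk => y (Sum.inr jk) with hJ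
    have hJm : J ∈ truncationsBy s i := curveOf_mem hs i _
    have hPm : adaptedPoly i (-linearPart J) (polyOf fun μ : MultiIdx r m => y (Sum.inl μ)) ∈
        polySpace r m := adaptedPoly_mem i _ (polyOf_mem _)
    refine ⟨(adaptedPoly i (-linearPart J) (polyOf fun μ => y (Sum.inl μ)), J),
      mk_mem_prod hPm hJm, ?_⟩
    funext k
    rcases k with μ | ⟨j, k⟩
    · have := adaptedPoly_neg i (-linearPart J) (polyOf fun μ => y (Sum.inl μ))
      rw [neg_neg] at this
      change polyChart r m (adaptedPoly i (linearPart J) (adaptedPoly i (-linearPart J)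
        (polyOf fun μ => y (Sum.inl μ)))) μ = _
      rw [this]
      exact congrFun (polyChart_polyOf _) μ
    · simp only [adaptedChart, Sum.elim_inr, hJ]
      rw [coeff_curveOf, dif_pos k.2]

theorem adaptedChart_image_zSetBy (hs : 1 ≤ s) (hsr : s + 1 ≤ r) (i : Fin m) :
    adaptedChart r s i '' zSetBy r s i = eqZeros r s i := by
  ext y
  constructor
  · rintro ⟨x, hx, rfl⟩
    exact ((mem_zSetBy_iff hs hsr).mp hx).2
  · intro hy
    obtain ⟨x, hx, rfl⟩ := (bijOn_adaptedChart (r := r) hs i).surjOn (mem_univ y)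
    exact ⟨x, (mem_zSetBy_iff hs hsr).mpr ⟨hx, hy⟩, rfl⟩

/-- The adapted coordinates are polynomials in the standard ones. -/
theorem exists_adaptedChart_eq (r : ℕ) (hs : 1 ≤ s) (i : Fin m) :
    ∃ Φ : AdaptedIdx r s i → MvPolynomial (MultiIdx r m ⊕ (Fin m × OrderIdx s)) ℝ,
      ∀ x ∈ polySpace r m ×ˢ truncationsBy s i, ∀ k,
        adaptedChart r s i x k = eval (stdChart r s m x) (Φ k) := by
  choose Φ hΦ using fun μ : MultiIdx r m =>
    exists_coeff_adaptedPoly (κ := MultiIdx r m ⊕ (Fin m × OrderIdx s)) i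
      (fun j => X (Sum.inr (j, ⟨1, Finset.mem_Icc.mpr ⟨le_rfl, hs⟩⟩)))
      (fun μ : MultiIdx r m => X (Sum.inl μ)) μ.1
  refine ⟨Sum.elim Φ fun jk => X (Sum.inr (jk.1.1, jk.2)), fun x hx k => ?_⟩
  rcases k with μ | jk
  · rw [Sum.elim_inl, ← hΦ]
    simp only [eval_X]
    change (adaptedPoly i (linearPart x.2) x.1).coeff μ.1 =
      (adaptedPoly i (linearPart x.2) (polyOf (polyChart r m x.1))).coeff μ.1
    rw [polyOf_polyChart hx.1]
  · rw [Sum.elim_inr, eval_X]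
    rfl

/-- The standard coordinates are polynomials in the adapted ones. -/
theorem exists_stdChart_eq (r : ℕ) (hs : 1 ≤ s) (i : Fin m) :
    ∃ Ψ : MultiIdx r m ⊕ (Fin m × OrderIdx s) → MvPolynomial (AdaptedIdx r s i) ℝ,
      ∀ x ∈ polySpace r m ×ˢ truncationsBy s i, ∀ k,
        stdChart r s m x k = eval (adaptedChart r s i x) (Ψ k) := by
  have h1 : 1 ∈ Finset.Icc 1 s := Finset.mem_Icc.mpr ⟨le_rfl, hs⟩
  choose Ψ hΨ using fun μ : MultiIdx r m =>
    exists_coeff_adaptedPoly (κ := AdaptedIdx r s i) i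
      (fun j => if h : j ≠ i then -X (Sum.inr (⟨j, h⟩, ⟨1, h1⟩)) else 0)
      (fun μ : MultiIdx r m => X (Sum.inl μ)) μ.1
  refine ⟨Sum.elim Ψ fun jk => if h : jk.1 ≠ i then X (Sum.inr (⟨jk.1, h⟩, jk.2)) else
    C ((Polynomial.X : Polynomial ℝ).coeff jk.2.1), fun x hx k => ?_⟩
  rcases k with μ | ⟨j, k⟩
  · rw [Sum.elim_inl, ← hΨ]
    simp only [eval_X]
    rw [adaptedPoly_congr i (b' := -linearPart x.2) fun j hj => by
      rw [dif_pos hj, map_neg, eval_X]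
      rfl]
    change x.1.coeff μ.1 = (adaptedPoly i (-linearPart x.2)
      (polyOf (polyChart r m (adaptedPoly i (linearPart x.2) x.1)))).coeff μ.1
    rw [polyOf_polyChart (adaptedPoly_mem i _ hx.1), adaptedPoly_neg]
  · rw [Sum.elim_inr]
    by_cases hj : j = i
    · subst hj
      rw [dif_neg (by simp), eval_C]
      change (x.2 j).coeff k.1 = _
      rw [((mem_truncationsBy_iff hs).mp hx.2).1]
    · rw [dif_pos hj, eval_X]
      rfl

/-- A point of the standard coordinate space comes from a curve parametrized by the `i`-th
coordinate as soon as its coordinates `a_{ik}` are the coefficients of `t`. -/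
theorem stdChart_eq (hs : 1 ≤ s) {y : MultiIdx r m ⊕ (Fin m × OrderIdx s) → ℝ}
    (hy : ∀ k : OrderIdx s, y (Sum.inr (i, k)) = (Polynomial.X : Polynomial ℝ).coeff k.1) :
    ∃ x ∈ polySpace r m ×ˢ truncationsBy s i, stdChart r s m x = y := by
  have hJ : curveOf i (fun jk => y (Sum.inr (jk.1.1, jk.2))) ∈ truncationsBy s i :=
    curveOf_mem hs i _
  have hP : polyOf (fun μ => y (Sum.inl μ)) ∈ polySpace r m := polyOf_mem _
  refine ⟨(polyOf fun μ => y (Sum.inl μ), curveOf i fun jk => y (Sum.inr (jk.1.1, jk.2))),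
    mk_mem_prod hP hJ, ?_⟩
  funext k
  rcases k with μ | ⟨j, k⟩
  · exact congrFun (polyChart_polyOf fun μ => y (Sum.inl μ)) μ
  · simp only [stdChart, Sum.elim_inr]
    by_cases hj : j = i
    · subst hj
      rw [curveOf_self, hy]
    · rw [coeff_curveOf i _ ⟨j, hj⟩, dif_pos k.2]

theorem isAlgebraicSet_zSetBy (hs : 1 ≤ s) (hsr : s + 1 ≤ r) (i : Fin m) :
    IsAlgebraicSet (stdChart r s m '' zSetBy r s i) := by
  classical
  obtain ⟨Φ, hΦ⟩ := exists_adaptedChart_eq r hs i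
  have hev : ∀ x ∈ polySpace r m ×ˢ truncationsBy s i, ∀ q,
      eval (stdChart r s m x) (bind₁ Φ q) = eval (adaptedChart r s i x) q := by
    intro x hx q
    have := aeval_bind₁ (fun k => stdChart r s m x k) Φ q
    rw [show adaptedChart r s i x = fun k => eval (stdChart r s m x) (Φ k) from
      funext fun k => hΦ x hx k]
    exact this
  refine ⟨(Finset.univ.image fun k : OrderIdx s => X (Sum.inr (i, k)) -
      C ((Polynomial.X : Polynomial ℝ).coeff k.1)) ∪
    (Finset.univ ×ˢ Finset.range (s + 1)).image fun e : Fin m × ℕ =>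
      bind₁ Φ (explicitQ r s i e.1 e.2), ?_⟩
  ext y
  constructor
  · rintro ⟨x, hx, rfl⟩ f hf
    have hx' := (mem_zSetBy_iff hs hsr).mp hx
    rcases Finset.mem_union.mp hf with hf | hf
    · obtain ⟨k, -, rfl⟩ := Finset.mem_image.mp hf
      rw [map_sub, eval_X, eval_C, sub_eq_zero]
      change (x.2 i).coeff k.1 = _
      rw [((mem_truncationsBy_iff hs).mp hx.1.2).1]
    · obtain ⟨e, he, rfl⟩ := Finset.mem_image.mp hf
      rw [hev x hx.1]
      exact hx'.2 _ _ (Nat.lt_succ_iff.mp (Finset.mem_range.mp (Finset.mem_product.mp he).2))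
  · intro hy
    obtain ⟨x, hx, rfl⟩ := stdChart_eq (r := r) (i := i) hs (y := y) (fun k => by
      have := hy _ (Finset.mem_union_left _ (Finset.mem_image_of_mem _ (Finset.mem_univ k)))
      rwa [map_sub, eval_X, eval_C, sub_eq_zero] at this)
    refine ⟨x, (mem_zSetBy_iff hs hsr).mpr ⟨hx, fun ℓ α hα => ?_⟩, rfl⟩
    rw [← hev x hx]
    exact hy _ (Finset.mem_union_right _ (Finset.mem_image.mpr ⟨(ℓ, α), Finset.mem_product.mpr
      ⟨Finset.mem_univ _, Finset.mem_range.mpr (Nat.lt_succ_of_le hα)⟩, rfl⟩))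

end Charts

/-! ### Critical curves of generic polynomials -/

section Newton

variable {m : ℕ} {i : Fin m}

theorem coeff_zero_aeval {J : Fin m → Polynomial ℝ} (hJ : ∀ j, (J j).coeff 0 = 0)
    (Q : MvPolynomial (Fin m) ℝ) : (aeval J Q).coeff 0 = Q.coeff 0 := by
  induction Q using MvPolynomial.induction_on with
  | C r => simp
  | add p q hp hq => rw [map_add, Polynomial.coeff_add, hp, hq, coeff_add]
  | mul_X p j hp =>
    rw [map_mul, aeval_X, Polynomial.mul_coeff_zero, hJ, mul_zero]
    exact (by simp : (0 : ℝ) = constantCoeff (p * X j))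

/-- First order expansion of a polynomial along a perturbed curve. -/
theorem X_pow_succ_dvd_aeval_add {J : Fin m → Polynomial ℝ} (hJ : ∀ j, (J j).coeff 0 = 0)
    (c : Fin m → ℝ) {N : ℕ} (hN : 1 ≤ N) (Q : MvPolynomial (Fin m) ℝ) :
    Polynomial.X ^ (N + 1) ∣
      aeval (fun j => J j + Polynomial.C (c j) * Polynomial.X ^ N) Q - aeval J Q -
        Polynomial.C (∑ j, c j * Q.coeff (Finsupp.single j 1)) * Polynomial.X ^ N := by
  classical
  induction Q using MvPolynomial.induction_on with
  | C r =>
    simp [coeff_C, Finsupp.single_eq_zero, eq_comm (a := (0 : Fin m →₀ ℕ))]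
  | add p q hp hq =>
    convert dvd_add hp hq using 1
    simp only [map_add, coeff_add, mul_add, Finset.sum_add_distrib]
    ring
  | mul_X p j hp =>
    have he : ∑ k, c k * (p * X j).coeff (Finsupp.single k 1) = c j * p.coeff 0 := by
      rw [Finset.sum_eq_single j]
      · rw [coeff_mul_X']
        simp
      · intro k _ hk
        rw [coeff_mul_X', if_neg, mul_zero]
        simpa using hk.symm
      · simp
    obtain ⟨A, hA⟩ := hp
    obtain ⟨B, hB⟩ := Polynomial.X_dvd_iff.mpr (hJ j)
    obtain ⟨D, hD⟩ : Polynomial.X ∣ aeval J p - Polynomial.C (p.coeff 0) := by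
      rw [Polynomial.X_dvd_iff, Polynomial.coeff_sub, coeff_zero_aeval hJ, Polynomial.coeff_C_zero,
        sub_self]
    obtain ⟨M, rfl⟩ : ∃ M, N = M + 1 := ⟨N - 1, by omega⟩
    rw [he, map_mul, map_mul, aeval_X, aeval_X]
    set e := ∑ k, c k * p.coeff (Finsupp.single k 1)
    set p' := aeval (fun j => J j + Polynomial.C (c j) * Polynomial.X ^ (M + 1)) p
    refine ⟨Polynomial.C e * (B + Polynomial.C (c j) * Polynomial.X ^ M) +
      A * (J j + Polynomial.C (c j) * Polynomial.X ^ (M + 1)) + Polynomial.C (c j) * D, ?_⟩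
    rw [map_mul]
    linear_combination (J j + Polynomial.C (c j) * Polynomial.X ^ (M + 1)) * hA +
      Polynomial.C (c j) * Polynomial.X ^ (M + 1) * hD +
      Polynomial.C e * Polynomial.X ^ (M + 1) * hB

/-- If the Jacobian matrix with respect to the coordinates other than `x_i` is invertible, the
equations `F_ℓ = 0` have a solution to any finite order, by Newton iteration. -/
theorem exists_curve_of_det_ne_zero (F : {j : Fin m // j ≠ i} → MvPolynomial (Fin m) ℝ)
    (h0 : ∀ ℓ, (F ℓ).coeff 0 = 0)
    (hdet : (Matrix.of fun ℓ j : {j : Fin m // j ≠ i} =>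
      (F ℓ).coeff (Finsupp.single j.1 1)).det ≠ 0) (n : ℕ) :
    ∃ J : Fin m → Polynomial ℝ, J i = Polynomial.X ∧ (∀ j, (J j).coeff 0 = 0) ∧
      (∀ j ≠ i, (J j).natDegree ≤ n) ∧ ∀ ℓ, ∀ α ≤ n, (aeval J (F ℓ)).coeff α = 0 := by
  classical
  induction n with
  | zero =>
    have hJ : ∀ j, ((fun j : Fin m => if j = i then (Polynomial.X : Polynomial ℝ) else 0) j).coeff 0
        = 0 := fun j => by dsimp only; split_ifs <;> simp
    refine ⟨fun j => if j = i then Polynomial.X else 0, if_pos rfl, hJ, fun j hj => by simp [hj],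
      fun ℓ α hα => ?_⟩
    rw [Nat.le_zero.mp hα, coeff_zero_aeval hJ, h0]
  | succ n ih =>
    obtain ⟨J, hi, hJ0, hd, hv⟩ := ih
    set H : Matrix {j : Fin m // j ≠ i} {j : Fin m // j ≠ i} ℝ :=
      Matrix.of fun ℓ j => (F ℓ).coeff (Finsupp.single j.1 1) with hH
    set v : {j : Fin m // j ≠ i} → ℝ := fun ℓ => (aeval J (F ℓ)).coeff (n + 1) with hvdef
    -- The correction `u t^(n+1)` cancels the coefficients of order `n + 1`.
    obtain ⟨u, hu⟩ : ∃ u, H.mulVec u = -v :=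
      ⟨H⁻¹.mulVec (-v), by
        rw [Matrix.mulVec_mulVec, Matrix.mul_nonsing_inv _ (isUnit_iff_ne_zero.mpr hdet),
          Matrix.one_mulVec]⟩
    set c : Fin m → ℝ := fun j => if h : j ≠ i then u ⟨j, h⟩ else 0 with hc
    have hci : c i = 0 := by simp [hc]
    refine ⟨fun j => J j + Polynomial.C (c j) * Polynomial.X ^ (n + 1), by simp [hci, hi],
      fun j => by simp [hJ0], fun j hj => ?_, fun ℓ α hα => ?_⟩
    · refine (Polynomial.natDegree_add_le _ _).trans (max_le ((hd j hj).trans (by omega)) ?_)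
      exact Polynomial.natDegree_C_mul_X_pow_le _ _
    · have := X_pow_succ_dvd_aeval_add hJ0 c (N := n + 1) (by omega) (F ℓ)
      rw [Polynomial.X_pow_dvd_iff] at this
      have := this α (by omega)
      rw [Polynomial.coeff_sub, Polynomial.coeff_sub, Polynomial.coeff_C_mul,
        Polynomial.coeff_X_pow] at this
      rcases hα.eq_or_lt with rfl | hlt
      · have hs : ∑ j, c j * (F ℓ).coeff (Finsupp.single j 1) = -v ℓ := by
          rw [← Pi.neg_apply, ← hu, ← Finset.add_sum_erase _ _ (Finset.mem_univ i), hci, zero_mul,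
            zero_add, Finset.sum_subtype (p := fun j => j ≠ i) (Finset.univ.erase i) (by simp),
            Matrix.mulVec, dotProduct]
          refine Finset.sum_congr rfl fun j _ => ?_
          simp only [hc, dif_pos j.2, hH, Matrix.of_apply]
          ring
        rw [if_pos rfl, hs, mul_one] at this
        simp only [hvdef] at this
        linarith
      · rw [if_neg (by omega), hv ℓ α (by omega)] at this
        linarith

end Newton

section Generic

variable {r s m : ℕ} {i : Fin m}

/-- The labels of the coefficients that cannot be prescribed for an `s`-vanishing polynomial: the
linear ones and those of the pure powers `x_i²,…, x_i^{s+1}`. -/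
def boundIdx (hsr : s + 1 ≤ r) (i : Fin m) : Fin m ⊕ Fin s → MultiIdx r m
  | Sum.inl ℓ => ⟨Finsupp.single ℓ 1, by rw [Finsupp.degree_single]; omega⟩
  | Sum.inr k => ⟨Finsupp.single i (k.1 + 2), by
      rw [Finsupp.degree_single]; have := k.2; omega⟩

theorem boundIdx_injective (hsr : s + 1 ≤ r) : Function.Injective (boundIdx hsr i) := by
  rintro (ℓ | k) (ℓ' | k') h
  · have : Finsupp.single ℓ 1 = Finsupp.single ℓ' 1 := congrArg Subtype.val h
    rw [Finsupp.single_left_injective one_ne_zero this]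
  · have : Finsupp.single ℓ 1 = Finsupp.single i (k'.1 + 2) := congrArg Subtype.val h
    have := congrArg Finsupp.degree this
    rw [Finsupp.degree_single, Finsupp.degree_single] at this
    omega
  · have : Finsupp.single i (k.1 + 2) = Finsupp.single ℓ' 1 := congrArg Subtype.val h
    have := congrArg Finsupp.degree this
    rw [Finsupp.degree_single, Finsupp.degree_single] at this
    omega
  · have : Finsupp.single i (k.1 + 2) = Finsupp.single i (k'.1 + 2) := congrArg Subtype.val h
    have := congrArg Finsupp.degree this
    rw [Finsupp.degree_single, Finsupp.degree_single] at this
    rw [Fin.ext (by omega : k.1 = k'.1)]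

/-- The labels of the coefficients that can be prescribed generically. -/
abbrev UnboundIdx (hsr : s + 1 ≤ r) (i : Fin m) : Type :=
  {μ : MultiIdx r m // μ ∉ range (boundIdx hsr i)}

instance instFintypeUnboundIdx (hsr : s + 1 ≤ r) (i : Fin m) : Fintype (UnboundIdx hsr i) :=
  Fintype.ofFinite _

theorem card_unboundIdx (hsr : s + 1 ≤ r) (i : Fin m) :
    Fintype.card (UnboundIdx hsr i) + (m + s) = Fintype.card (MultiIdx r m) := by
  classical
  have h1 := Fintype.card_subtype_compl (fun k : MultiIdx r m => k ∈ range (boundIdx hsr i))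
  have h2 : Fintype.card {k : MultiIdx r m // k ∈ range (boundIdx hsr i)} = m + s := by
    have := Set.card_range_of_injective (boundIdx_injective (i := i) hsr)
    rw [Fintype.card_sum, Fintype.card_fin, Fintype.card_fin] at this
    rw [← this]
  have h3 := Fintype.card_subtype_le (fun k : MultiIdx r m => k ∈ range (boundIdx hsr i))
  rw [h2] at h1 h3
  have h4 : Fintype.card (UnboundIdx hsr i) =
    Fintype.card {k : MultiIdx r m // ¬ k ∈ range (boundIdx hsr i)} :=
    Fintype.card_congr (Equiv.refl _)
  omega

/-- The label of `x_j x_ℓ`, for `j, ℓ ≠ i`. -/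
def hessIdx (hs : 1 ≤ s) (hsr : s + 1 ≤ r) (j ℓ : {j : Fin m // j ≠ i}) : UnboundIdx hsr i :=
  ⟨⟨Finsupp.single j.1 1 + Finsupp.single ℓ.1 1, by
    rw [map_add, Finsupp.degree_single, Finsupp.degree_single]; omega⟩, by
    rintro ⟨k | k, hk⟩
    · have := congrArg Finsupp.degree (congrArg Subtype.val hk)
      simp only [boundIdx, map_add, Finsupp.degree_single] at this
      omega
    · have := DFunLike.congr_fun (congrArg Subtype.val hk) j.1
      simp [boundIdx, j.2] at this
      omega⟩

/-- The Hessian matrix with respect to the coordinates other than `x_i`, in terms of the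
coefficients. -/
def hessMatrix (hs : 1 ≤ s) (hsr : s + 1 ≤ r) (i : Fin m) :
    Matrix {j : Fin m // j ≠ i} {j : Fin m // j ≠ i} (MvPolynomial (UnboundIdx hsr i) ℝ) :=
  Matrix.of fun ℓ j => X (hessIdx hs hsr j ℓ) *
    C (((Finsupp.single j.1 1 : Fin m →₀ ℕ) ℓ.1 : ℝ) + 1)

open Classical in
theorem det_hessMatrix_ne_zero (hs : 1 ≤ s) (hsr : s + 1 ≤ r) :
    (hessMatrix hs hsr i).det ≠ 0 := by
  intro h
  -- At `∑ x_j² / 2` the Hessian matrix is the identity.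
  let w : UnboundIdx hsr i → ℝ := fun μ => if ∃ j, μ = hessIdx hs hsr j j then 2⁻¹ else 0
  have h1 : (eval w).mapMatrix (hessMatrix hs hsr i) = 1 := by
    ext ℓ j
    rw [RingHom.mapMatrix_apply, Matrix.map_apply, hessMatrix, Matrix.of_apply, map_mul, eval_X,
      eval_C]
    by_cases hj : ℓ = j
    · subst hj
      rw [Matrix.one_apply_eq]
      simp only [w]
      rw [if_pos ⟨ℓ, rfl⟩, Finsupp.single_eq_same]
      norm_num
    · rw [Matrix.one_apply_ne hj]
      simp only [w]
      rw [if_neg, zero_mul]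
      rintro ⟨k, hk⟩
      have h2 : Finsupp.single j.1 1 + Finsupp.single ℓ.1 1 =
          Finsupp.single k.1 1 + Finsupp.single k.1 1 :=
        congrArg Subtype.val (congrArg Subtype.val hk)
      have hne : j.1 ≠ ℓ.1 := fun e => hj (Subtype.ext e.symm)
      have h3 := DFunLike.congr_fun h2 j.1
      simp only [Finsupp.add_apply, Finsupp.single_apply, if_true, if_neg hne.symm] at h3
      split_ifs at h3
      omega
  have h4 := congrArg (eval w) h
  rw [RingHom.map_det, h1, Matrix.det_one, map_zero] at h4
  exact one_ne_zero h4

/-- Generic values of the unbound coefficients extend to an `s`-vanishing polynomial: the equations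
for `ℓ ≠ i` determine the curve, those for `ℓ = i` the coefficients of the pure powers of `x_i`. -/
theorem exists_mem_zSetBy (hs : 1 ≤ s) (hsr : s + 1 ≤ r) (w : UnboundIdx hsr i → ℝ)
    (hw : eval w (hessMatrix hs hsr i).det ≠ 0) :
    ∃ x ∈ zSetBy r s i, ∀ μ : UnboundIdx hsr i, x.1.coeff μ.1.1 = w μ := by
  classical
  set p₀ : MultiIdx r m → ℝ := fun μ => if h : μ ∉ range (boundIdx hsr i) then w ⟨μ, h⟩ else 0
    with hp₀
  set P₀ : MvPolynomial (Fin m) ℝ := polyOf p₀ with hP₀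
  have hlin : ∀ ℓ : Fin m, P₀.coeff (Finsupp.single ℓ 1) = 0 := by
    intro ℓ
    have := coeff_polyOf p₀ (boundIdx hsr i (Sum.inl ℓ))
    exact this.trans (dif_neg (not_not.mpr (mem_range_self _)))
  have hlin' : ∀ ℓ : Fin m, (pderiv ℓ P₀).coeff 0 = 0 := by
    intro ℓ
    rw [coeff_pderiv, zero_add, hlin, zero_mul]
  have hdet : (Matrix.of fun ℓ j : {j : Fin m // j ≠ i} =>
      (pderiv ℓ.1 P₀).coeff (Finsupp.single j.1 1)).det ≠ 0 := by
    convert hw using 1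
    rw [RingHom.map_det]
    congr 1
    ext ℓ j
    rw [RingHom.mapMatrix_apply, Matrix.map_apply, hessMatrix, Matrix.of_apply, Matrix.of_apply,
      map_mul, eval_X, eval_C, coeff_pderiv]
    congr 1
    have := coeff_polyOf p₀ (hessIdx hs hsr j ℓ).1
    rw [hp₀] at this
    simp only [dif_pos (hessIdx hs hsr j ℓ).2] at this
    exact this
  obtain ⟨J, hi, hJ0, hd, hv⟩ := exists_curve_of_det_ne_zero
    (fun ℓ : {j : Fin m // j ≠ i} => pderiv ℓ.1 P₀) (fun ℓ => hlin' ℓ.1) hdet s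
  have hJ : J ∈ truncationsBy s i := by
    rw [mem_truncationsBy_iff hs]
    refine ⟨hi, fun j => ⟨hJ0 j, ?_⟩⟩
    by_cases hj : j = i
    · rw [hj, hi, Polynomial.natDegree_X]
      exact hs
    · exact hd j hj
  -- Along `J` the `i`-th partial derivative of `c x_i^(k+2)` is `(k + 2) c t^(k+1)`.
  set c : ℕ → ℝ := fun k => -(aeval J (pderiv i P₀)).coeff (k + 1) / (k + 2 : ℝ) with hc
  set P : MvPolynomial (Fin m) ℝ :=
    P₀ + ∑ k ∈ Finset.range s, monomial (Finsupp.single i (k + 2)) (c k) with hP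
  have hPmem : P ∈ polySpace r m := by
    rw [mem_polySpace_iff]
    intro μ hμ
    rw [hP, coeff_add, mem_polySpace_iff.mp (polyOf_mem p₀) μ hμ, zero_add, coeff_sum]
    refine Finset.sum_eq_zero fun k hk => ?_
    rw [coeff_monomial, if_neg]
    rintro rfl
    rw [Finsupp.degree_single] at hμ
    have := Finset.mem_range.mp hk
    omega
  refine ⟨(P, J), ⟨mk_mem_prod hPmem hJ, ?_⟩, fun μ => ?_⟩
  · rw [vanishesOn_iff]
    intro ℓ α hα
    by_cases hℓ : ℓ = i
    · subst hℓ
      have hsum : (aeval J (pderiv ℓ (∑ k ∈ Finset.range s,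
          monomial (Finsupp.single ℓ (k + 2)) (c k)))).coeff α =
          ∑ k ∈ Finset.range s, if α = k + 1 then c k * (k + 2) else 0 := by
        rw [map_sum, map_sum, Polynomial.finsetSum_coeff]
        refine Finset.sum_congr rfl fun k _ => ?_
        rw [pderiv_monomial, Finsupp.single_eq_same, ← Finsupp.single_tsub, aeval_monomial_curve,
          Finset.prod_eq_single ℓ
            (fun j _ hj => by rw [Finsupp.single_eq_of_ne hj, pow_zero]) (by simp),
          Finsupp.single_eq_same, hi, Polynomial.coeff_C_mul, Polynomial.coeff_X_pow]
        simp
      rw [hP, map_add, map_add, Polynomial.coeff_add, hsum]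
      rcases Nat.eq_zero_or_pos α with rfl | hpos
      · rw [coeff_zero_aeval hJ0, hlin', Finset.sum_eq_zero, add_zero]
        intro k _
        rw [if_neg (by omega)]
      · obtain ⟨k, rfl⟩ : ∃ k, α = k + 1 := ⟨α - 1, by omega⟩
        rw [Finset.sum_eq_single k (fun k' _ hk' => if_neg (by omega))
          (fun hk => absurd (Finset.mem_range.mpr (by omega)) hk), if_pos rfl, hc]
        have : (k : ℝ) + 2 ≠ 0 := by positivity
        field_simp
        ring
    · have hz : pderiv ℓ (∑ k ∈ Finset.range s, monomial (Finsupp.single i (k + 2)) (c k)) = 0 := by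
        rw [map_sum]
        refine Finset.sum_eq_zero fun k _ => ?_
        rw [pderiv_monomial, Finsupp.single_eq_of_ne hℓ]
        simp
      rw [hP, map_add, hz, add_zero]
      exact hv ⟨ℓ, hℓ⟩ α hα
  · change P.coeff μ.1.1 = w μ
    rw [hP, coeff_add, hP₀, coeff_polyOf, coeff_sum, Finset.sum_eq_zero, add_zero, hp₀]
    · simp only [dif_pos μ.2]
    · intro k hk
      rw [coeff_monomial, if_neg]
      intro e
      exact μ.2 ⟨Sum.inr ⟨k, Finset.mem_range.mp hk⟩, Subtype.ext e⟩

/-- The projection of `Z^i` to the unbound coefficients is Zariski dense. -/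
theorem eq_zero_of_forall_zSetBy (hs : 1 ≤ s) (hsr : s + 1 ≤ r)
    (f : MvPolynomial (UnboundIdx hsr i) ℝ)
    (hf : ∀ x ∈ zSetBy r s i, eval (fun μ : UnboundIdx hsr i => x.1.coeff μ.1.1) f = 0) :
    f = 0 := by
  -- Where the Hessian determinant does not vanish, `f` is evaluated at a point of the projection.
  have h : f * (hessMatrix hs hsr i).det = 0 := by
    refine MvPolynomial.funext fun w => ?_
    rw [map_mul, map_zero]
    by_cases hw : eval w (hessMatrix hs hsr i).det = 0
    · rw [hw, mul_zero]
    · obtain ⟨x, hx, e⟩ := exists_mem_zSetBy hs hsr w hw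
      have := hf x hx
      rw [show (fun μ : UnboundIdx hsr i => x.1.coeff μ.1.1) = w from _root_.funext e] at this
      rw [this, zero_mul]
  exact (mul_eq_zero.mp h).resolve_right (det_hessMatrix_ne_zero hs hsr)

end Generic

/-! ### Dimensions -/

section Codimension

variable {r s m : ℕ}

theorem stdChart_image_prod (r s m : ℕ) :
    stdChart r s m '' (polySpace r m ×ˢ truncations s m) =
      ⋃ i, stdChart r s m '' (polySpace r m ×ˢ truncationsBy s i) := by
  rw [truncations_eq_iUnion, prod_iUnion, image_iUnion]

theorem polyChart_image_polySpace (r m : ℕ) : polyChart r m '' polySpace r m = univ :=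
  eq_univ_of_forall fun p => ⟨polyOf p, polyOf_mem p, polyChart_polyOf p⟩

theorem sVanishingSet_eq (r s m : ℕ) : sVanishingSet r s m = Prod.fst '' zSet r s m := by
  ext P
  constructor
  · rintro ⟨hP, γ, hγ, hv⟩
    obtain ⟨i, hi⟩ := mem_iUnion.mp hγ
    exact ⟨(P, truncation s γ), mem_iUnion.mpr ⟨i, ⟨mk_mem_prod hP ⟨γ, hi, rfl⟩, hv⟩⟩, rfl⟩
  · rintro ⟨⟨P, J⟩, hx, rfl⟩
    obtain ⟨i, ⟨hP, γ, hγ, e⟩, hv⟩ := mem_iUnion.mp hx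
    exact ⟨hP, γ, mem_iUnion.mpr ⟨i, hγ⟩, by rw [e]; exact hv⟩

theorem card_adaptedIdx (r s : ℕ) (i : Fin m) :
    Fintype.card (AdaptedIdx r s i) = Fintype.card (MultiIdx r m) + (m - 1) * s := by
  classical
  rw [Fintype.card_sum, Fintype.card_prod]
  congr 2
  · rw [Fintype.card_subtype_compl, Fintype.card_fin, Fintype.card_subtype_eq]
  · rw [Fintype.card_coe, Nat.card_Icc, Nat.add_sub_cancel]

theorem saDim_univ (ι : Type) [Fintype ι] :
    saDim (univ : Set (ι → ℝ)) = (Fintype.card ι : WithBot ℕ∞) := by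
  refine le_antisymm ?_ ?_
  · refine saDim_le_of_subset_iUnion (α := Unit) (κ := fun _ => ι) (fun _ j => X j)
      (fun _ => le_rfl) fun x _ => ⟨(), x, fun j => (eval_X j).symm⟩
  · refine le_saDim_of_dense X fun f hf => MvPolynomial.funext fun x => ?_
    rw [map_zero, ← hf x (mem_univ x)]
    simp

theorem saDim_stdChart_prod (hm : 1 ≤ m) (hs : 1 ≤ s) :
    saDim (stdChart r s m '' (polySpace r m ×ˢ truncations s m)) =
      ((Fintype.card (MultiIdx r m) + (m - 1) * s : ℕ) : WithBot ℕ∞) := by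
  choose Ψ hΨ using fun i : Fin m => exists_stdChart_eq (m := m) r hs i
  refine le_antisymm ?_ ?_
  · refine saDim_le_of_subset_iUnion Ψ (fun i => (card_adaptedIdx r s i).le) ?_
    rw [stdChart_image_prod]
    intro y hy
    obtain ⟨i, x, hx, rfl⟩ := mem_iUnion.mp hy
    exact ⟨i, _, hΨ i x hx⟩
  · let i : Fin m := ⟨0, hm⟩
    obtain ⟨Φ, hΦ⟩ := exists_adaptedChart_eq (m := m) r hs i
    rw [← card_adaptedIdx r s i]
    refine le_saDim_of_dense Φ fun f hf => MvPolynomial.funext fun y => ?_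
    obtain ⟨x, hx, rfl⟩ := (bijOn_adaptedChart (r := r) hs i).surjOn (mem_univ y)
    rw [map_zero, ← hf (stdChart r s m x) ?_]
    · congr 2
      exact _root_.funext fun k => hΦ x hx k
    · rw [stdChart_image_prod]
      exact mem_iUnion.mpr ⟨i, x, hx, rfl⟩

/-- Each piece `Z^i` is a polynomial image of the space of free adapted coordinates. -/
theorem exists_param_zSetBy (hs : 1 ≤ s) (hsr : s + 1 ≤ r) (i : Fin m) :
    ∃ ψ : MultiIdx r m ⊕ (Fin m × OrderIdx s) →
        MvPolynomial {k : AdaptedIdx r s i // k ∉ range (nuIdx hsr i)} ℝ,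
      ∀ x ∈ zSetBy r s i, ∃ w, ∀ k, stdChart r s m x k = eval w (ψ k) := by
  obtain ⟨Ψ, hΨ⟩ := exists_stdChart_eq (m := m) r hs i
  obtain ⟨ψ, hψ⟩ := exists_param_eqZeros hsr i
  refine ⟨fun k => bind₁ ψ (Ψ k), fun x hx => ?_⟩
  obtain ⟨hx1, hx2⟩ := (mem_zSetBy_iff hs hsr).mp hx
  obtain ⟨w, hw⟩ := hψ _ hx2
  refine ⟨w, fun k => ?_⟩
  rw [hΨ x hx1, _root_.funext hw]
  exact (aeval_bind₁ w ψ (Ψ k)).symm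

/-- The number of free adapted coordinates equals the number of unbound coefficients, so that the
upper and lower bounds for the dimensions agree. -/
theorem card_free_eq (hsr : s + 1 ≤ r) (hm : 1 ≤ m) (i : Fin m)
    [Fintype {k : AdaptedIdx r s i // k ∉ range (nuIdx hsr i)}] :
    Fintype.card {k : AdaptedIdx r s i // k ∉ range (nuIdx hsr i)} =
      Fintype.card (UnboundIdx hsr i) := by
  have h1 := card_free hsr i
  have h2 := card_unboundIdx hsr i
  rw [card_adaptedIdx] at h1
  obtain ⟨n, rfl⟩ : ∃ n, m = n + 1 := ⟨m - 1, by omega⟩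
  rw [Nat.add_sub_cancel] at h1
  nlinarith

theorem saDim_zSet (hm : 1 ≤ m) (hs : 1 ≤ s) (hsr : s + 1 ≤ r) :
    saDim (stdChart r s m '' zSet r s m) =
      ((Fintype.card (MultiIdx r m) - (m + s) : ℕ) : WithBot ℕ∞) := by
  classical
  have hcard : ∀ i : Fin m, Fintype.card (UnboundIdx hsr i) =
      Fintype.card (MultiIdx r m) - (m + s) := fun i => by
    have := card_unboundIdx hsr i
    omega
  choose ψ hψ using fun i : Fin m => exists_param_zSetBy hs hsr i
  refine le_antisymm ?_ ?_
  · refine saDim_le_of_subset_iUnion ψ (fun i => ((card_free_eq hsr hm i).trans (hcard i)).le) ?_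
    rintro _ ⟨x, hx, rfl⟩
    obtain ⟨i, hi⟩ := mem_iUnion.mp hx
    exact ⟨i, hψ i x hi⟩
  · let i : Fin m := ⟨0, hm⟩
    rw [← hcard i]
    refine le_saDim_of_dense (fun μ : UnboundIdx hsr i => X (Sum.inl μ.1)) fun f hf =>
      eq_zero_of_forall_zSetBy hs hsr f fun x hx => ?_
    rw [← hf (stdChart r s m x) ⟨x, mem_iUnion.mpr ⟨i, hx⟩, rfl⟩]
    simp only [eval_X]
    rfl

theorem saDim_sVanishingSet (hm : 1 ≤ m) (hs : 1 ≤ s) (hsr : s + 1 ≤ r) :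
    saDim (polyChart r m '' sVanishingSet r s m) =
      ((Fintype.card (MultiIdx r m) - (m + s) : ℕ) : WithBot ℕ∞) := by
  classical
  have hcard : ∀ i : Fin m, Fintype.card (UnboundIdx hsr i) =
      Fintype.card (MultiIdx r m) - (m + s) := fun i => by
    have := card_unboundIdx hsr i
    omega
  rw [sVanishingSet_eq]
  choose ψ hψ using fun i : Fin m => exists_param_zSetBy hs hsr i
  refine le_antisymm ?_ ?_
  · refine saDim_le_of_subset_iUnion (fun i μ => ψ i (Sum.inl μ))
      (fun i => ((card_free_eq hsr hm i).trans (hcard i)).le) ?_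
    rintro _ ⟨_, ⟨x, hx, rfl⟩, rfl⟩
    obtain ⟨i, hi⟩ := mem_iUnion.mp hx
    obtain ⟨w, hw⟩ := hψ i x hi
    exact ⟨i, w, fun μ => hw (Sum.inl μ)⟩
  · let i : Fin m := ⟨0, hm⟩
    rw [← hcard i]
    refine le_saDim_of_dense (fun μ : UnboundIdx hsr i => X μ.1) fun f hf =>
      eq_zero_of_forall_zSetBy hs hsr f fun x hx => ?_
    rw [← hf (polyChart r m x.1) ⟨x.1, ⟨x, mem_iUnion.mpr ⟨i, hx⟩, rfl⟩, rfl⟩]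
    simp only [eval_X]
    rfl

theorem isAlgebraicSet_zSet (hs : 1 ≤ s) (hsr : s + 1 ≤ r) :
    IsAlgebraicSet (stdChart r s m '' zSet r s m) := by
  rw [zSet, image_iUnion]
  exact isAlgebraicSet_iUnion fun i => isAlgebraicSet_zSetBy hs hsr i

/-- In coordinates the `s`-vanishing polynomials form the projection of the algebraic set `Z`. -/
theorem isSemialgebraicSet_sVanishingSet (hs : 1 ≤ s) (hsr : s + 1 ≤ r) :
    IsSemialgebraicSet (polyChart r m '' sVanishingSet r s m) := by
  have h := (isAlgebraicSet_zSet (m := m) hs hsr).signDetermined.projection.isSemialgebraicSet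
  convert h using 1
  rw [sVanishingSet_eq]
  ext p
  constructor
  · rintro ⟨_, ⟨x, hx, rfl⟩, rfl⟩
    exact ⟨fun jk => (x.2 jk.1).coeff jk.2.1, x, hx, rfl⟩
  · rintro ⟨a, x, hx, e⟩
    refine ⟨x.1, ⟨x, hx, rfl⟩, _root_.funext fun μ => ?_⟩
    exact congrFun e (Sum.inl μ)

theorem zSet_subset (r s m : ℕ) : zSet r s m ⊆ polySpace r m ×ˢ truncations s m := by
  rw [truncations_eq_iUnion, prod_iUnion]
  exact iUnion_mono fun i x hx => hx.1

end Codimension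

end SVanishing

end

theorem mainTheorem10 (r s m : ℕ) (hr : 2 ≤ r) (hm : 1 ≤ m) (hs : 1 ≤ s) (hsr : s + 1 ≤ r) :
    -- `Z` is algebraic
    SVanishing.IsAlgebraicSet (SVanishing.stdChart r s m '' SVanishing.zSet r s m) ∧
    -- the equations and the ideal of each of its pieces `Z^i`, in the adapted chart
    (∀ i : Fin m,
      Set.BijOn (SVanishing.adaptedChart r s i)
        (SVanishing.polySpace r m ×ˢ SVanishing.truncationsBy s i) Set.univ ∧
      (∀ P ∈ SVanishing.polySpace r m, ∀ J ∈ SVanishing.truncationsBy s i,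
        ∀ ℓ : Fin m, ∀ α : ℕ, α ≤ s →
          SVanishing.gradDeriv (SVanishing.adaptedPoly i (SVanishing.linearPart J) P)
              (SVanishing.adaptedCurve i (SVanishing.linearPart J) J) ℓ α
            = (α.factorial : ℝ) *
              MvPolynomial.eval (SVanishing.adaptedChart r s i (P, J))
                (SVanishing.explicitQ r s i ℓ α)) ∧
      SVanishing.zSetBy r s i =
        (SVanishing.polySpace r m ×ˢ SVanishing.truncationsBy s i) ∩
          SVanishing.adaptedChart r s i ⁻¹'
            {y | ∀ ℓ : Fin m, ∀ α : ℕ, α ≤ s →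
              MvPolynomial.eval y (SVanishing.explicitQ r s i ℓ α) = 0} ∧
      MvPolynomial.vanishingIdeal ℝ (SVanishing.adaptedChart r s i '' SVanishing.zSetBy r s i) =
        Ideal.span {q | ∃ ℓ : Fin m, ∃ α : ℕ, α ≤ s ∧ q = SVanishing.explicitQ r s i ℓ α}) ∧
    -- the codimension of `Z` in `𝒫(r,m) × ϑ_m(s)`
    SVanishing.HasCodimIn (SVanishing.stdChart r s m '' SVanishing.zSet r s m)
      (SVanishing.stdChart r s m '' (SVanishing.polySpace r m ×ˢ SVanishing.truncations s m))
      (m * (s + 1)) ∧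
    -- `σ` is the projection of `Z`; it is semi-algebraic, of codimension `s + m` in `𝒫(r,m)`
    SVanishing.sVanishingSet r s m = Prod.fst '' SVanishing.zSet r s m ∧
    SVanishing.IsSemialgebraicSet (SVanishing.polyChart r m '' SVanishing.sVanishingSet r s m) ∧
    SVanishing.HasCodimIn (SVanishing.polyChart r m '' SVanishing.sVanishingSet r s m)
      (SVanishing.polyChart r m '' SVanishing.polySpace r m) (s + m) := by
  have hc : m + s ≤ Fintype.card (SVanishing.MultiIdx r m) := by
    have := SVanishing.card_unboundIdx (i := (⟨0, hm⟩ : Fin m)) hsr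
    omega
  refine ⟨SVanishing.isAlgebraicSet_zSet hs hsr, fun i =>
    ⟨SVanishing.bijOn_adaptedChart hs i, fun P hP J hJ ℓ α hα => ?_, ?_, ?_⟩, ⟨?_, ?_⟩,
    SVanishing.sVanishingSet_eq r s m, SVanishing.isSemialgebraicSet_sVanishingSet hs hsr, ⟨?_, ?_⟩⟩
  · rw [SVanishing.gradDeriv_eq, SVanishing.coeff_gradient_adapted hs hsr hP hJ ℓ hα]
  · ext x
    exact SVanishing.mem_zSetBy_iff hs hsr
  · rw [SVanishing.adaptedChart_image_zSetBy hs hsr]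
    exact SVanishing.vanishingIdeal_eqZeros hsr
  · exact Set.image_mono (SVanishing.zSet_subset r s m)
  · rw [SVanishing.saDim_zSet hm hs hsr, SVanishing.saDim_stdChart_prod hm hs, ← Nat.cast_add]
    congr 1
    obtain ⟨n, rfl⟩ : ∃ n, m = n + 1 := ⟨m - 1, by omega⟩
    obtain ⟨d, hd⟩ := Nat.exists_eq_add_of_le hc
    rw [hd, Nat.add_sub_cancel_left, Nat.add_sub_cancel]
    ring
  · exact Set.image_mono fun P hP => hP.1
  · rw [SVanishing.polyChart_image_polySpace, SVanishing.saDim_univ,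
      SVanishing.saDim_sVanishingSet hm hs hsr, ← Nat.cast_add]
    congr 1
    omega
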